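/- Let $L$ be a non-degenerate even lattice of rank $1$, $V_L$ the lattice vertex algebra of $L$ over $\mathbb C$, $M(1)\subset V_L$ the Heisenberg vertex operator algebra of $\mathbb C\otimes_{\mathbb Z}L$ with its standard conformal vector $\omega=\frac12 h(-1)^2\mathbf 1$ ($\langle h,h\rangle=1$), and $\theta$ the involution of $V_L$ induced from the $-1$-isometry of $L$. Let $V_L^+$ and $M(1)^+$ be the fixed point subalgebras of $\theta$ in $V_L$ and in $M(1)$. Let $M$ be a non-zero weak $V_L^+$-module, that is, a non-zero complex vector space with a linear map $a\otimes u\mapsto Y(a,x)u=\sum_{n\in\mathbb Z}a_nu\,x^{-n-1}$ from $V_L^+\otimes M$ to $M((x))$ such that $Y(\mathbf 1,x)=\mathrm{id}_M$ and the Jacobi identity holds (no grading is assumed). Put $$\Omega_{M(1)^+}(M)=\{u\in M : a_iu=0\ \text{for all homogeneous } a\in M(1)^+ \text{ and all } i>\mathrm{wt}\,a-1\},$$ where $a$ is homogeneous of weight $\mathrm{wt}\,a$ if $\omega_1a=(\mathrm{wt}\,a)\,a$. Then $\Omega_{M(1)^+}(M)$, as a module for the Zhu algebra $A(M(1)^+)$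 on which the class of a homogeneous $a$ acts as $a_{\mathrm{wt}\,a-1}$, contains an irreducible $A(M(1)^+)$-submodule. In particular, there is a non-zero $M(1)^+$-submodule $W$ of $M$, i.e. a non-zero subspace $W$ stable under all $a_n$ $(a\in M(1)^+,\ n\in\mathbb Z)$ that is a module for the vertex operator algebra $M(1)^+$: $W$ is the direct sum of its $\omega_1$-eigenspaces, these are finite dimensional, and they vanish for eigenvalues of sufficiently negative real part. -/

import Mathlib

noncomputable section

namespace LatticeVA

/-! ## The rank one lattice vertex algebra

`L = ℤα` with `⟨α, α⟩ = N`, `N` a non-zero even integer.  All values of the form are even, so the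
commutator map of the central extension of `L` is trivial, the extension splits, and the (twisted)
group algebra of `L` is the ordinary one.  Hence `V_L = S(ĥ₋) ⊗ ℂ[L] = ⨁_{m ∈ ℤ} M(1, mα)`. -/

/-- `S(ĥ₋)` for `h = ℂα`: the variable `X k` stands for `α(-k-1) = α ⊗ t^(-k-1)`. -/
abbrev Fock : Type := MvPolynomial ℕ ℂ

/-- The space `V_L`.  The summand with index `m` is `M(1, mα) = S(ĥ₋) ⊗ e^{mα}`. -/
abbrev Space : Type := ℤ →₀ Fock

/-- `e^{mα}` -/
def expVec (m : ℤ) : Space := Finsupp.single m 1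

/-- The vacuum vector `e^0`. -/
def vac : Space := expVec 0

/-- The conformal vector `(1/2) h(-1)² 𝟏` with `⟨h, h⟩ = 1`, that is `(1/(2N)) α(-1)² 𝟏`. -/
def omega (N : ℤ) : Space :=
  Finsupp.single 0 (MvPolynomial.C (1 / (2 * (N : ℂ))) * MvPolynomial.X 0 ^ 2)

/-- The action of `α(i)`, `i ≥ 0`, on `M(1, pα)`: `α(0)` is the scalar `⟨α, pα⟩ = N p`, and
`[α(i), α(-j)] = i N δ_{ij}` makes `α(i)` the operator `i N ∂/∂α(-i)` for `i > 0`. -/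
def heis (N p : ℤ) : ℕ → (Fock →ₗ[ℂ] Fock)
  | 0 => ((N * p : ℤ) : ℂ) • LinearMap.id
  | i + 1 => ((N * (i + 1) : ℤ) : ℂ) • (MvPolynomial.pderiv (R := ℂ) i).toLinearMap

/-- The exponential `exp (∑_{k ≥ 1} m α(-k) x^k / k)`. -/
def expCreation (m : ℤ) : PowerSeries Fock :=
  PowerSeries.subst
    (PowerSeries.mk fun k : ℕ =>
      match k with
      | 0 => (0 : Fock)
      | k + 1 => MvPolynomial.C ((m : ℂ) / ((k : ℂ) + 1)) * MvPolynomial.X k)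
    (PowerSeries.exp Fock)

lemma mul_smul_laurent (c : ℂ) (f g : LaurentSeries Fock) : f * c • g = c • (f * g) :=
  @mul_smul_comm ℂ (LaurentSeries Fock) _ _
    (@Algebra.to_smulCommClass ℂ (LaurentSeries Fock) _ _ HahnSeries.instAlgebra) c f g

/-- Multiplication by a Laurent series. -/
def mulLaurent (f : LaurentSeries Fock) : LaurentSeries Fock →ₗ[ℂ] LaurentSeries Fock where
  toFun g := f * g
  map_add' := mul_add f
  map_smul' c g := mul_smul_laurent c f g

/-- The exponential `exp (-∑_{k ≥ 1} m α(k) x^(-k) / k)`.  As `α(k) = k N ∂/∂α(-k)`, it is the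
translation `α(-k) ↦ α(-k) - m N x^(-k)`. -/
def expAnnihilation (N m : ℤ) : Fock →+* LaurentSeries Fock :=
  MvPolynomial.eval₂Hom (HahnSeries.C.comp MvPolynomial.C) fun k : ℕ =>
    HahnSeries.C (MvPolynomial.X k : Fock)
      - HahnSeries.single (-((k : ℤ) + 1)) (MvPolynomial.C ((m * N : ℤ) : ℂ))

lemma expAnnihilation_smul (N m : ℤ) (c : ℂ) (g : Fock) :
    expAnnihilation N m (c • g) = c • expAnnihilation N m g := by
  rw [MvPolynomial.smul_eq_C_mul, map_mul]
  apply HahnSeries.ext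
  funext i
  simp [expAnnihilation, MvPolynomial.smul_eq_C_mul]

/-- The restriction of
`Y(e^{mα}, x) = exp (∑ mα(-k) x^k/k) exp (-∑ mα(k) x^(-k)/k) e^{mα} x^{mα(0)}`
to a map `M(1, pα) → M(1, (m+p)α)((x))`. -/
def expField (N m p : ℤ) : Fock →ₗ[ℂ] LaurentSeries Fock where
  toFun g := HahnSeries.single (m * p * N) (1 : Fock)
    * HahnSeries.ofPowerSeries ℤ Fock (expCreation m) * expAnnihilation N m g
  map_add' g g' := by rw [map_add, mul_add]
  map_smul' c g := by rw [expAnnihilation_smul, mul_smul_laurent, RingHom.id_apply]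

/-- The creation part `∑_{i < 0} binom(-i-1, k) α(i) x^(-i-1-k) = ∑_{r ≥ 0} binom(r+k, k) α(-(r+k)-1) x^r`
of the field `(1/k!) (d/dx)^k α(x)`, where `α(x) = ∑_i α(i) x^(-i-1)`. -/
def creationPart (k : ℕ) : LaurentSeries Fock :=
  HahnSeries.ofPowerSeries ℤ Fock
    (PowerSeries.mk fun r : ℕ => ((r + k).choose k : Fock) * MvPolynomial.X (r + k))

lemma heis_finite (N p : ℤ) (g : Fock) : (Function.support fun i => heis N p i g).Finite := by
  refine Set.Finite.subset
    ((Set.finite_singleton 0).union ((g.vars.finite_toSet).image Nat.succ)) ?_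
  intro i hi
  cases i with
  | zero => simp
  | succ j =>
    right
    refine ⟨j, ?_, rfl⟩
    by_contra h
    exact hi (by simp [heis, MvPolynomial.pderiv_eq_zero_of_notMem_vars h])

lemma annihilation_support_finite (N p : ℤ) (F : Fock →ₗ[ℂ] LaurentSeries Fock)
    (c : ℕ → LaurentSeries Fock) (g : Fock) :
    (Function.support fun i => c i * F (heis N p i g)).Finite :=
  (heis_finite N p g).subset fun i hi h => hi (by simp only at h; simp [h])

/-- The map `g ↦ ∑_{i ≥ 0} binom(-i-1, k) x^(-i-1-k) F(x) α(i) g`, for `g ∈ M(1, pα)`: the field `F`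
composed with the annihilation part of `(1/k!) (d/dx)^k α(x)`, which acts first. -/
def annihilationPart (N p : ℤ) (k : ℕ) (F : Fock →ₗ[ℂ] LaurentSeries Fock) :
    Fock →ₗ[ℂ] LaurentSeries Fock where
  toFun g := ∑ᶠ i : ℕ,
    HahnSeries.single (-(i : ℤ) - 1 - k) (((Ring.choose (-(i : ℤ) - 1) k : ℤ)) : Fock)
      * F (heis N p i g)
  map_add' g g' := by
    rw [← finsum_add_distrib (annihilation_support_finite N p F _ g)
      (annihilation_support_finite N p F _ g')]
    simp only [map_add, mul_add]
  map_smul' c g := by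
    rw [RingHom.id_apply, smul_finsum]
    simp only [map_smul, mul_smul_laurent]

/-- The restriction to `M(1, pα) → M(1, (m+p)α)((x))` of the vertex operator of
`α(-k₁-1) ⋯ α(-k_r-1) e^{mα}`, i.e. the normally ordered product
`: (1/k₁!) (d/dx)^{k₁} α(x) ⋯ (1/k_r!) (d/dx)^{k_r} α(x) Y(e^{mα}, x) :`
for the list `[k₁, …, k_r]`. -/
def field (N m p : ℤ) : List ℕ → (Fock →ₗ[ℂ] LaurentSeries Fock)
  | [] => expField N m p
  | k :: l => mulLaurent (creationPart k) ∘ₗ field N m p l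
      + annihilationPart N p k (field N m p l)

/-- The inclusion `M(1, qα)((x)) → V_L((x))`. -/
def inclusion (q : ℤ) : LaurentSeries Fock →ₗ[ℂ] HahnModule ℤ ℂ Space where
  toFun f := HahnModule.of ℂ (HahnSeries.map f (Finsupp.lsingle (R := ℂ) (M := Fock) q))
  map_add' f g := by
    apply HahnModule.ext
    funext i
    simp [HahnSeries.map]
  map_smul' c f := by
    apply HahnModule.ext
    funext i
    exact (Finsupp.lsingle (R := ℂ) (M := Fock) q).map_smul c (f.coeff i)

/-- The vertex operator on `V_L` of the vector `α(-k₁-1) ⋯ α(-k_r-1) e^{mα}`. -/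
def monomialOperator (N m : ℤ) (l : List ℕ) : VertexOperator ℂ Space :=
  Finsupp.lsum ℂ fun p => inclusion (m + p) ∘ₗ field N m p l

/-- The state-field map `Y : V_L → Hom(V_L, V_L((x)))`, by linear extension from the monomials
`α(-k₁-1) ⋯ α(-k_r-1) e^{mα}`, `k₁ ≤ ⋯ ≤ k_r`. -/
def vertexMap (N : ℤ) : Space →ₗ[ℂ] VertexOperator ℂ Space :=
  Finsupp.lsum ℂ fun m =>
    (MvPolynomial.basisMonomials ℕ ℂ).constr ℂ fun s =>
      monomialOperator N m ((Finsupp.toMultiset s).sort)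

/-- The product `a_n b`, the coefficient of `x^(-n-1)` in `Y(a, x) b`. -/
def prod (N : ℤ) (a : Space) (n : ℤ) (b : Space) : Space :=
  VertexOperator.ncoeff (vertexMap N a) n b

/-- The restriction of `θ` to `S(ĥ₋)`: `α(-i) ↦ -α(-i)`. -/
def fockTheta : Fock →ₐ[ℂ] Fock := MvPolynomial.aeval fun k => -MvPolynomial.X k

/-- The involution `θ` of `V_L` induced from the `-1`-isometry of `L`:
`θ(α(-i₁) ⋯ α(-i_r) e^{mα}) = (-1)^r α(-i₁) ⋯ α(-i_r) e^{-mα}`. -/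
def theta : Space →ₗ[ℂ] Space :=
  Finsupp.lsum ℂ fun m => Finsupp.lsingle (-m) ∘ₗ fockTheta.toLinearMap

/-! `θ` is an automorphism: `θ(a_n b) = θ(a)_n θ(b)`. -/

/-- `θ` applied to the coefficients of a Laurent series. -/
def laurentTheta : LaurentSeries Fock →+* LaurentSeries Fock where
  toFun f := HahnSeries.map f (fockTheta : Fock →+* Fock)
  map_one' := HahnSeries.map_one (fockTheta : Fock →+* Fock).toMonoidWithZeroHom
  map_mul' f g := HahnSeries.map_mul (fockTheta : Fock →ₙ+* Fock)
  map_zero' := by ext; simp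
  map_add' f g := HahnSeries.map_add (fockTheta : Fock →+* Fock).toAddMonoidHom

@[simp] lemma laurentTheta_coeff (f : LaurentSeries Fock) (i : ℤ) :
    (laurentTheta f).coeff i = fockTheta (f.coeff i) := rfl

@[simp] lemma laurentTheta_single (i : ℤ) (r : Fock) :
    laurentTheta (HahnSeries.single i r) = HahnSeries.single i (fockTheta r) := by
  apply HahnSeries.ext
  funext j
  by_cases h : j = i
  · simp [h]
  · simp [HahnSeries.coeff_single_of_ne h]

lemma laurentTheta_ofPowerSeries (f : PowerSeries Fock) :
    laurentTheta (HahnSeries.ofPowerSeries ℤ Fock f)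
      = HahnSeries.ofPowerSeries ℤ Fock (PowerSeries.map (fockTheta : Fock →+* Fock) f) := by
  apply HahnSeries.ext
  funext j
  rw [laurentTheta_coeff]
  rw [PowerSeries.coeff_coe, PowerSeries.coeff_coe]
  split_ifs <;> simp

@[simp] lemma fockTheta_X (k : ℕ) : fockTheta (MvPolynomial.X k) = -MvPolynomial.X k :=
  MvPolynomial.aeval_X _ k

lemma expCreation_theta (m : ℤ) :
    PowerSeries.map (fockTheta : Fock →+* Fock) (expCreation m) = expCreation (-m) := by
  unfold expCreation
  erw [PowerSeries.map_subst (PowerSeries.HasSubst.of_constantCoeff_zero' (by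
    rw [← PowerSeries.coeff_zero_eq_constantCoeff_apply, PowerSeries.coeff_mk]))]
  rw [PowerSeries.map_exp]
  congr 1
  ext k : 1
  erw [PowerSeries.coeff_map]
  rw [PowerSeries.coeff_mk, PowerSeries.coeff_mk]
  cases k with
  | zero => simp
  | succ k =>
    simp [neg_div]

lemma expAnnihilation_theta (N m : ℤ) (g : Fock) :
    laurentTheta (expAnnihilation N m g) = expAnnihilation N (-m) (fockTheta g) := by
  have h : laurentTheta.comp (expAnnihilation N m)
      = (expAnnihilation N (-m)).comp (fockTheta : Fock →+* Fock) := by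
    apply MvPolynomial.ringHom_ext
    · intro r
      simp [expAnnihilation]
    · intro k
      simp [expAnnihilation, sub_eq_add_neg, add_comm]
  exact DFunLike.congr_fun h g

lemma heis_theta (N p : ℤ) (i : ℕ) (g : Fock) :
    fockTheta (heis N p i g) = -heis N (-p) i (fockTheta g) := by
  cases i with
  | zero => simp [heis]
  | succ i =>
    have h : ∀ g : Fock, fockTheta (MvPolynomial.pderiv i g)
        = -MvPolynomial.pderiv i (fockTheta g) := by
      intro g
      induction g using MvPolynomial.induction_on with
      | C a => simp
      | add f g hf hg => simp [hf, hg, add_comm]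
      | mul_X f n hf =>
        by_cases hn : n = i
        · subst hn
          simp [hf]
        · simp [hf, MvPolynomial.pderiv_X_of_ne hn]
    simp [heis, h]

lemma field_theta (N m p : ℤ) (l : List ℕ) (g : Fock) :
    laurentTheta (field N m p l g)
      = (-1) ^ l.length * field N (-m) (-p) l (fockTheta g) := by
  induction l generalizing g with
  | nil =>
    simp [field, expField, laurentTheta_ofPowerSeries, expCreation_theta, expAnnihilation_theta]
  | cons k l ih =>
    have hc : laurentTheta (creationPart k) = -creationPart k := by
      rw [creationPart, laurentTheta_ofPowerSeries, ← map_neg]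
      congr 1
      ext r : 1
      simp
    have ha : laurentTheta (annihilationPart N p k (field N m p l) g)
        = (-1) ^ (l.length + 1)
          * annihilationPart N (-p) k (field N (-m) (-p) l) (fockTheta g) := by
      simp only [annihilationPart, LinearMap.coe_mk, AddHom.coe_mk]
      rw [show laurentTheta (∑ᶠ i : ℕ, _) = ∑ᶠ i : ℕ, laurentTheta _ from
        map_finsum laurentTheta (annihilation_support_finite N p _ _ g)]
      rw [mul_finsum]
      refine finsum_congr fun i => ?_
      rw [map_mul, ih, heis_theta, map_neg, laurentTheta_single]
      simp only [map_intCast]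
      ring
    simp only [field, LinearMap.add_apply, LinearMap.comp_apply, mulLaurent, LinearMap.coe_mk,
      AddHom.coe_mk, map_add, map_mul, hc, ih, ha, List.length_cons]
    ring

lemma theta_inclusion (q i : ℤ) (f : LaurentSeries Fock) :
    theta (((HahnModule.of ℂ).symm (inclusion q f)).coeff i)
      = ((HahnModule.of ℂ).symm (inclusion (-q) (laurentTheta f))).coeff i := by
  simp [theta, inclusion, HahnSeries.map]

lemma prod_monomial (N m p n : ℤ) (s : ℕ →₀ ℕ) (g : Fock) :
    prod N (Finsupp.single m (MvPolynomial.monomial s 1)) n (Finsupp.single p g)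
      = ((HahnModule.of ℂ).symm
          (inclusion (m + p) (field N m p ((Finsupp.toMultiset s).sort) g))).coeff (-n - 1) := by
  have h : (MvPolynomial.monomial s (1 : ℂ)) = MvPolynomial.basisMonomials ℕ ℂ s := by simp
  rw [prod, vertexMap, Finsupp.lsum_single, h, Module.Basis.constr_basis, monomialOperator,
    VertexOperator.ncoeff_apply, HVertexOperator.coeff_apply_apply, Finsupp.lsum_single]
  rfl

lemma theta_single (m : ℤ) (f : Fock) :
    theta (Finsupp.single m f) = Finsupp.single (-m) (fockTheta f) := by
  simp [theta]

lemma fockTheta_monomial (s : ℕ →₀ ℕ) :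
    fockTheta (MvPolynomial.monomial s 1)
      = (-1 : ℂ) ^ (Finsupp.toMultiset s).card • MvPolynomial.monomial s (1 : ℂ) := by
  rw [fockTheta, MvPolynomial.aeval_monomial, MvPolynomial.monomial_eq, Finsupp.card_toMultiset]
  simp only [Finsupp.prod, Finsupp.sum]
  have h : ∀ x : ℕ, (-MvPolynomial.X x : Fock) ^ s x = (-1) ^ s x * MvPolynomial.X x ^ s x :=
    fun x => neg_pow _ _
  simp only [h, Finset.prod_mul_distrib, Finset.prod_pow_eq_pow_sum]
  simp [MvPolynomial.smul_eq_C_mul]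

lemma neg_one_pow_mul_hahn {A : Type} [CommRing A] [Algebra ℂ A] (k : ℕ) (F : HahnSeries ℤ A) :
    (-1) ^ k * F = (-1 : ℂ) ^ k • F := by
  rcases Nat.even_or_odd k with hk | hk <;> simp [hk.neg_one_pow]

theorem theta_prod (N : ℤ) (a : Space) (n : ℤ) (b : Space) :
    theta (prod N a n b) = prod N (theta a) n (theta b) := by
  have hadd : ∀ a a' b : Space, prod N (a + a') n b = prod N a n b + prod N a' n b := by
    intro a a' b; simp [prod]
  have hsmul : ∀ (c : ℂ) (a b : Space), prod N (c • a) n b = c • prod N a n b := by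
    intro c a b; simp [prod]
  have hadd' : ∀ a b b' : Space, prod N a n (b + b') = prod N a n b + prod N a n b' := by
    intro a b b'; simp [prod]
  have hz : ∀ b : Space, prod N 0 n b = 0 := by intro b; simp [prod]
  have hz' : ∀ a : Space, prod N a n 0 = 0 := by intro a; simp [prod]
  induction b using Finsupp.induction_linear with
  | zero => simp [hz']
  | add b b' hb hb' => rw [hadd', map_add, map_add, hadd', hb, hb']
  | single p g =>
  induction a using Finsupp.induction_linear with
  | zero => simp [hz]
  | add a a' ha ha' => rw [hadd, map_add, map_add, hadd, ha, ha']
  | single m f =>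
  induction f using MvPolynomial.induction_on' with
  | add f f' hf hf' =>
    rw [Finsupp.single_add, hadd, map_add, map_add, hadd, hf, hf']
  | monomial s c =>
    have hc : (Finsupp.single m (MvPolynomial.monomial s c) : Space)
        = c • Finsupp.single m (MvPolynomial.monomial s 1) := by
      rw [Finsupp.smul_single, MvPolynomial.smul_monomial, smul_eq_mul, mul_one]
    rw [hc, hsmul, map_smul, map_smul, hsmul, prod_monomial, theta_inclusion, theta_single,
      theta_single, fockTheta_monomial, ← Finsupp.smul_single, hsmul, prod_monomial, field_theta,
      Multiset.length_sort, neg_add]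
    congr 1
    rw [neg_one_pow_mul_hahn, map_smul]
    rfl

/-! ## Vertex subalgebras and their weak modules -/

/-- A vertex subalgebra of `V_L`: a subspace containing `𝟏` and closed under all products. -/
structure VertexSubalgebra (N : ℤ) extends Submodule ℂ Space where
  vac_mem : vac ∈ carrier
  prod_mem : ∀ a ∈ carrier, ∀ b ∈ carrier, ∀ n : ℤ, prod N a n b ∈ carrier

namespace VertexSubalgebra

variable {N : ℤ}

/-- The underlying vector space of a vertex subalgebra. -/
def Carrier (P : VertexSubalgebra N) : Type := P.toSubmodule

instance : CoeSort (VertexSubalgebra N) Type := ⟨Carrier⟩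

instance (P : VertexSubalgebra N) : AddCommGroup P := inferInstanceAs (AddCommGroup P.toSubmodule)

instance (P : VertexSubalgebra N) : Module ℂ P := inferInstanceAs (Module ℂ P.toSubmodule)

/-- The inclusion of `P` in `V_L`. -/
def val (P : VertexSubalgebra N) : P →ₗ[ℂ] Space := P.toSubmodule.subtype

/-- The inclusion of a vertex subalgebra in a larger one. -/
def incl {Q P : VertexSubalgebra N} (h : Q.toSubmodule ≤ P.toSubmodule) : Q →ₗ[ℂ] P :=
  Submodule.inclusion h

/-- The vacuum vector of `P`. -/
def one (P : VertexSubalgebra N) : P := ⟨vac, P.vac_mem⟩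

/-- The product `a_n b` of `P`. -/
def mul (P : VertexSubalgebra N) (a : P) (n : ℤ) (b : P) : P :=
  ⟨prod N (P.val a) n (P.val b), P.prod_mem _ a.2 _ b.2 n⟩

/-- `a` is homogeneous of weight `d`, that is `ω_1 a = d a`. -/
def IsHomogeneous {P : VertexSubalgebra N} (d : ℤ) (a : P) : Prop :=
  prod N (omega N) 1 (P.val a) = (d : ℂ) • P.val a

end VertexSubalgebra

/-- The fixed point subalgebra `V_L^+` of `θ` in `V_L`. -/
def VLPlus (N : ℤ) : VertexSubalgebra N where
  toSubmodule := LinearMap.ker (theta - LinearMap.id)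
  vac_mem := by
    simp [vac, expVec, theta_single]
  prod_mem a ha b hb n := by
    simp only [AddSubsemigroup.mem_carrier, AddSubmonoid.mem_toSubsemigroup,
      Submodule.mem_toAddSubmonoid, LinearMap.mem_ker, LinearMap.sub_apply, LinearMap.id_apply,
      sub_eq_zero] at ha hb ⊢
    rw [theta_prod, ha, hb]

lemma prod_mem_range_single_zero (N : ℤ) (f g : Fock) (n : ℤ) :
    prod N (Finsupp.single 0 f) n (Finsupp.single 0 g)
      ∈ LinearMap.range (Finsupp.lsingle (R := ℂ) (M := Fock) (0 : ℤ)) := by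
  induction f using MvPolynomial.induction_on' with
  | add f f' hf hf' =>
    have h : prod N (Finsupp.single 0 (f + f')) n (Finsupp.single 0 g)
        = prod N (Finsupp.single 0 f) n (Finsupp.single 0 g)
          + prod N (Finsupp.single 0 f') n (Finsupp.single 0 g) := by
      simp [prod]
    rw [h]
    exact Submodule.add_mem _ hf hf'
  | monomial s c =>
    have h : prod N (Finsupp.single 0 (MvPolynomial.monomial s c)) n (Finsupp.single 0 g)
        = c • prod N (Finsupp.single 0 (MvPolynomial.monomial s 1)) n (Finsupp.single 0 g) := by
      have hc : (Finsupp.single 0 (MvPolynomial.monomial s c) : Space)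
          = c • Finsupp.single 0 (MvPolynomial.monomial s 1) := by
        rw [Finsupp.smul_single, MvPolynomial.smul_monomial, smul_eq_mul, mul_one]
      rw [hc]
      simp only [prod, map_smul, Pi.smul_apply, LinearMap.smul_apply]
    rw [h, prod_monomial]
    exact Submodule.smul_mem _ _ ⟨_, rfl⟩

/-- The Heisenberg vertex subalgebra `M(1) = M(1, 0)` of `V_L`. -/
def M1 (N : ℤ) : VertexSubalgebra N where
  toSubmodule := LinearMap.range (Finsupp.lsingle (R := ℂ) (M := Fock) (0 : ℤ))
  vac_mem := ⟨1, rfl⟩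
  prod_mem := by
    rintro _ ⟨f, rfl⟩ _ ⟨g, rfl⟩ n
    exact prod_mem_range_single_zero N f g n

/-- The fixed point subalgebra `M(1)^+` of `θ` in `M(1)`. -/
def M1Plus (N : ℤ) : VertexSubalgebra N where
  toSubmodule := (M1 N).toSubmodule ⊓ (VLPlus N).toSubmodule
  vac_mem := ⟨(M1 N).vac_mem, (VLPlus N).vac_mem⟩
  prod_mem a ha b hb n :=
    ⟨(M1 N).prod_mem a ha.1 b hb.1 n, (VLPlus N).prod_mem a ha.2 b hb.2 n⟩

lemma M1Plus_le_VLPlus (N : ℤ) : (M1Plus N).toSubmodule ≤ (VLPlus N).toSubmodule := inf_le_right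

lemma omega_mem_M1Plus (N : ℤ) : omega N ∈ (M1Plus N).toSubmodule := by
  refine ⟨⟨_, rfl⟩, ?_⟩
  change theta (omega N) - omega N = 0
  rw [omega, theta_single, map_mul, map_pow, fockTheta_X, neg_sq, fockTheta, MvPolynomial.aeval_C,
    neg_zero]
  exact sub_self _

/-- The conformal vector of `M(1)^+`. -/
def omegaM1Plus (N : ℤ) : M1Plus N := ⟨omega N, omega_mem_M1Plus N⟩

/-- A weak `P`-module structure on the complex vector space `M`: a linear map
`Y : P → Hom(M, M((x)))`, `Y(a, x) u = ∑ a_n u x^(-n-1)`, such that `Y(𝟏, x) = id` and the Jacobi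
identity holds.  The latter is an identity of formal distributions in `x₀, x₁, x₂`; it is stated
here as the equality of the coefficients of `x₀^(-l-1) x₁^(-m-1) x₂^(-n-1)` for all `l, m, n ∈ ℤ`.
All sums are finite. -/
structure WeakModule {N : ℤ} (P : VertexSubalgebra N) (M : Type*) [AddCommGroup M] [Module ℂ M] where
  Y : P →ₗ[ℂ] VertexOperator ℂ M
  vacuum : ∀ u : M, Y P.one u = HahnModule.of ℂ (HahnSeries.single 0 u)
  jacobi : ∀ (a b : P) (u : M) (l m n : ℤ),
    ∑ᶠ i : ℕ, Ring.choose m i •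
        VertexOperator.ncoeff (Y (P.mul a (l + i) b)) (m + n - i) u
      = ∑ᶠ i : ℕ, ((-1) ^ i * Ring.choose l i : ℤ) •
        (VertexOperator.ncoeff (Y a) (l + m - i) (VertexOperator.ncoeff (Y b) (n + i) u)
          - (l.negOnePow : ℤ) •
            VertexOperator.ncoeff (Y b) (l + n - i) (VertexOperator.ncoeff (Y a) (m + i) u))

namespace WeakModule

variable {N : ℤ} {P : VertexSubalgebra N} {M : Type*} [AddCommGroup M] [Module ℂ M]

/-- The operator `a_n` on `M`. -/
def act (𝓜 : WeakModule P M) (a : P) (n : ℤ) : Module.End ℂ M :=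
  VertexOperator.ncoeff (𝓜.Y a) n

/-- Restriction of a weak module to a smaller vertex subalgebra. -/
def restrict (𝓜 : WeakModule P M) (Q : VertexSubalgebra N)
    (h : Q.toSubmodule ≤ P.toSubmodule) : WeakModule Q M where
  Y := 𝓜.Y ∘ₗ VertexSubalgebra.incl h
  vacuum u := 𝓜.vacuum u
  jacobi a b u l m n := 𝓜.jacobi (VertexSubalgebra.incl h a) (VertexSubalgebra.incl h b) u l m n

/-- A weak `V_L^+`-module as a weak `M(1)^+`-module. -/
def toM1Plus (𝓜 : WeakModule (VLPlus N) M) : WeakModule (M1Plus N) M :=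
  𝓜.restrict (M1Plus N) (M1Plus_le_VLPlus N)

/-- `Ω_P(M)`: the vectors `u` with `a_i u = 0` for all homogeneous `a ∈ P` and all `i > wt a - 1`. -/
def Omega (𝓜 : WeakModule P M) : Submodule ℂ M where
  carrier := {u | ∀ (d : ℤ) (a : P), VertexSubalgebra.IsHomogeneous d a →
    ∀ i : ℤ, d - 1 < i → 𝓜.act a i u = 0}
  zero_mem' _ _ _ _ _ := map_zero _
  add_mem' hu hv d a ha i hi := by rw [map_add, hu d a ha i hi, hv d a ha i hi, add_zero]
  smul_mem' c u hu d a ha i hi := by rw [map_smul, hu d a ha i hi, smul_zero]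

/-- For a vertex operator algebra `P` with conformal vector `w`, the subspace `W` of the weak module
`M` is a `P`-submodule which is a module for the vertex operator algebra `P`: it is stable under all
`a_n`, it is the direct sum of its eigenspaces for `w_1`, these are finite dimensional, and they
vanish for eigenvalues of sufficiently negative real part. -/
structure IsOrdinarySubmodule (𝓜 : WeakModule P M) (w : P) (W : Submodule ℂ M) : Prop where
  act_mem : ∀ (a : P) (n : ℤ), ∀ u ∈ W, 𝓜.act a n u ∈ W
  graded : ⨆ z : ℂ, W ⊓ Module.End.eigenspace (𝓜.act w 1) z = W
  finite : ∀ z : ℂ, FiniteDimensional ℂ ↥(W ⊓ Module.End.eigenspace (𝓜.act w 1) z)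
  bounded : ∃ r : ℝ, ∀ z : ℂ, z.re < r → W ⊓ Module.End.eigenspace (𝓜.act w 1) z = ⊥

end WeakModule

/-! ## The Zhu algebra -/

section Zhu

variable {N : ℤ} (P : VertexSubalgebra N)

/-- `a ∘ b = ∑_{i ≥ 0} binom(d, i) a_{i-2} b`, for `a` homogeneous of weight `d`. -/
def zhuCirc (d : ℤ) (a b : P) : P := ∑ᶠ i : ℕ, Ring.choose d i • P.mul a ((i : ℤ) - 2) b

/-- `a * b = ∑_{i ≥ 0} binom(d, i) a_{i-1} b`, for `a` homogeneous of weight `d`. -/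
def zhuMul (d : ℤ) (a b : P) : P := ∑ᶠ i : ℕ, Ring.choose d i • P.mul a ((i : ℤ) - 1) b

/-- `O(P)`, the span of all `a ∘ b`; as `a ∘ b` is extended linearly to all `a`, it is enough to
take homogeneous `a`. -/
def zhuO : Submodule ℂ P :=
  Submodule.span ℂ
    {c | ∃ (d : ℤ) (a b : P), VertexSubalgebra.IsHomogeneous d a ∧ c = zhuCirc P d a b}

/-- The underlying space of the Zhu algebra `A(P) = P / O(P)`; its multiplication is induced by
`*`, and its unit is the class of `𝟏`. -/
abbrev ZhuAlgebra : Type := P ⧸ zhuO P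

/-- The class in `A(P)` of an element of `P`. -/
def zhuClass (a : P) : ZhuAlgebra P := (zhuO P).mkQ a

/-- The structure of a module for the associative algebra `A(P)` on the vector space `U`.  The
product of `A(P)` is bilinear and `P` is spanned by homogeneous elements, so multiplicativity is
required for the products `[a] [b] = [a * b]` with `a` homogeneous. -/
structure ZhuModule (U : Type*) [AddCommGroup U] [Module ℂ U] where
  ρ : ZhuAlgebra P →ₗ[ℂ] Module.End ℂ U
  map_one : ρ (zhuClass P P.one) = 1
  map_mul : ∀ (d : ℤ) (a b : P), VertexSubalgebra.IsHomogeneous d a →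
    ρ (zhuClass P (zhuMul P d a b)) = ρ (zhuClass P a) * ρ (zhuClass P b)

variable {P} {U : Type*} [AddCommGroup U] [Module ℂ U]

/-- `S` is an `A(P)`-submodule of `U`. -/
def ZhuModule.IsSubmodule (R : ZhuModule P U) (S : Submodule ℂ U) : Prop :=
  ∀ x : ZhuAlgebra P, ∀ u ∈ S, R.ρ x u ∈ S

/-- `S` is an irreducible `A(P)`-submodule of `U`. -/
def ZhuModule.IsIrreducibleSubmodule (R : ZhuModule P U) (S : Submodule ℂ U) : Prop :=
  R.IsSubmodule S ∧ S ≠ ⊥ ∧ ∀ S' ≤ S, R.IsSubmodule S' → S' = ⊥ ∨ S' = S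

/-- `R` is the standard `A(P)`-module structure on `Ω_P(M)`: the class of a homogeneous `a` acts as
`o(a) = a_{wt a - 1}`. -/
def ZhuModule.IsStandard {M : Type*} [AddCommGroup M] [Module ℂ M] {𝓜 : WeakModule P M}
    (R : ZhuModule P 𝓜.Omega) : Prop :=
  ∀ (d : ℤ) (a : P), VertexSubalgebra.IsHomogeneous d a →
    ∀ u : 𝓜.Omega, (R.ρ (zhuClass P a) u : M) = 𝓜.act a (d - 1) u

end Zhu

end LatticeVA

end

/-!
Write `J = α(-1) α(-3) 𝟏`, `L(s) = ω_{s+1}` and `J(s) = J_{s+3}`.  The vertex algebra `M(1)^+` is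
strongly generated by `ω` and `J` (`exists_words_of_isHomogeneous`).  Let `z ≠ 0` be annihilated by
`L(s)` and `J(s)`, `s > 0`, and an eigenvector of `L(0)` and `J(0)`.  Strong generation shows that
the `M(1)^+`-submodule generated by `z` is spanned by words in the `L(s)`, `J(s)` with `s < 0`,
applied to `z` (`apply_mem_negWords`, `act_mem_level`).  The words of a given total index span a
finite dimensional space of `L(0)`-eigenvectors, and the only one of index zero is the empty word.
So the submodule is an ordinary module, while `ℂ z ⊆ Ω` is a one dimensional, hence irreducible,
module for the Zhu algebra.

It remains to find `z` (`exists_common_eigenvector`).  Since no grading of `M` is given, this has to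
use the vectors of `V_L^+` outside of `M(1)^+`.  For `e = e^{mα} + e^{-mα}` with `m ≥ 2`, the space
`M(1, mα)` has no Virasoro singular vectors of level at most `4`, and `J_{-1} e = κ ω_{-1} ω_{-1} e
+ …` up to vectors which are linear in `ω` or derivatives (`quarticRelations_expPlus`).  The
coefficients `κ` for `m = 2` and `m = 3` differ (`quarticCoeff_ne`).  Let `u ≠ 0` with `L(s) u = 0`
for `s > S` and `J(s) u = 0` for `s > 2S`, which holds for large `S`.  Some mode of `e` does not
vanish on `u`, since the ideal of `V_L^+` generated by `e` contains the vacuum vector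
(`exists_expPlus_act_ne_zero`); let `e_n` be the last such mode.  Comparing the highest modes of
both sides of the relation for `J_{-1} e` yields `e_n J(2S) u = κ e_n L(S)² u`, with terms of lower
order in `L(0)` if `S = 0`.  Because `e_n` commutes with `L(S)` and `J(2S)` on such vectors, again
up to lower order terms if `S = 0`, the vector `e_n u` satisfies `J(2S) v = κ L(S)² v`
(`quarticEq_act`).  This equation is inherited by further vectors `e'_k v`, so that two different
values of `κ` can be combined: there is `v ≠ 0` with `L(S)² v = J(2S) v = 0` if `S > 0`, and then
`S` can be lowered (`exists_trunc_pred`).  For `S = 0` the combination is a quadratic equation for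
`L(0)` on `v`, which gives an eigenvector of `L(0)`, and `J(0)` acts on it by a polynomial in
`L(0)`.
-/

noncomputable section

namespace LatticeVA

open MvPolynomial

/-! ### The fields of quadratic vectors -/

lemma expCreation_zero : expCreation 0 = 1 := by
  have key : ∀ f : PowerSeries Fock, f = 0 → PowerSeries.subst f (PowerSeries.exp Fock) = 1 := by
    rintro _ rfl
    ext k : 1
    rw [PowerSeries.coeff_subst' PowerSeries.HasSubst.zero', finsum_eq_single _ 0]
    · simp
    · intro n hn
      simp [hn]
  refine key _ ?_
  ext k : 1
  rw [PowerSeries.coeff_mk]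
  cases k <;> simp

lemma field_nil (N p : ℤ) (g : Fock) : field N 0 p [] g = HahnSeries.C g := by
  have h : expAnnihilation N 0 = HahnSeries.C := by
    apply MvPolynomial.ringHom_ext
    · intro r
      simp [expAnnihilation]
    · intro k
      simp [expAnnihilation]
  simp [field, expField, expCreation_zero, h]

lemma creationPart_coeff_nat (k e : ℕ) :
    (creationPart k).coeff (e : ℤ) = ((e + k).choose k : Fock) * X (e + k) := by
  rw [creationPart, HahnSeries.ofPowerSeries_apply_coeff, PowerSeries.coeff_mk]

lemma creationPart_coeff_neg (k : ℕ) (e : ℤ) (he : e < 0) : (creationPart k).coeff e = 0 := by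
  rw [creationPart, PowerSeries.coeff_coe, if_pos he]

/-- If `α(r) g = 0` for `r ≥ R`, the annihilation part is a finite sum. -/
lemma annihilationPart_eq_sum {N p : ℤ} {g : Fock} {R : ℕ} (hR : ∀ r, R ≤ r → heis N p r g = 0)
    (k : ℕ) (F : Fock →ₗ[ℂ] LaurentSeries Fock) :
    annihilationPart N p k F g = ∑ r ∈ Finset.range R,
      HahnSeries.single (-(r : ℤ) - 1 - k) (((Ring.choose (-(r : ℤ) - 1) k : ℤ)) : Fock)
        * F (heis N p r g) := by
  change ∑ᶠ i : ℕ, _ = _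
  apply finsum_eq_sum_of_support_subset
  intro i hi
  by_contra h
  simp only [Finset.coe_range, Set.mem_Iio, not_lt] at h
  exact hi (by simp [hR i h])

lemma heis_comm (N p : ℤ) (r s : ℕ) (g : Fock) :
    heis N p r (heis N p s g) = heis N p s (heis N p r g) := by
  cases r with
  | zero => simp [heis]
  | succ r =>
    cases s with
    | zero =>
      simp only [heis, LinearMap.smul_apply, map_smul, LinearMap.id_apply]
      exact smul_comm _ _ _
    | succ s =>
      simp only [heis, LinearMap.smul_apply, map_smul, Derivation.coeFn_coe]
      rw [smul_comm]
      have h : (pderiv (R := ℂ) r) ((pderiv s) g) = (pderiv s) ((pderiv r) g) := by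
        have hc : ⁅(pderiv (R := ℂ) (σ := ℕ) r), (pderiv (R := ℂ) s)⁆ = 0 := by
          apply MvPolynomial.derivation_ext
          intro i
          rw [Derivation.commutator_apply]
          simp [pderiv_X, Pi.single_apply]
          split_ifs <;> simp
        have := congrArg (fun D => D g) hc
        simp only [Derivation.commutator_apply, Derivation.zero_apply] at this
        exact sub_eq_zero.1 this
      rw [h]

/-- The coefficient of `x^e` in the field of `α(-i-1) α(-j-1)` on `M(1, pα)`. -/
def quad (N p : ℤ) (i j : ℕ) (e : ℤ) (g : Fock) : Fock := (field N 0 p [i, j] g).coeff e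

/-- The coefficient `binom(-r-1, i)` of `α(r)` in the field `(1/i!) (d/dx)^i α(x)`. -/
def annCoeff (r i : ℕ) : Fock := ((Ring.choose (-(r : ℤ) - 1) i : ℤ) : Fock)

/-- The field of `α(-i-1) α(-j-1)` as a normally ordered product: two creation operators, one
creation and one annihilation operator, and two annihilation operators. -/
lemma quad_eq {N p : ℤ} {g : Fock} {R : ℕ} (hR : ∀ r, R ≤ r → heis N p r g = 0)
    (i j : ℕ) (e : ℤ) :
    quad N p i j e g = (creationPart i * creationPart j).coeff e * g
      + ∑ r ∈ Finset.range R, (annCoeff r j * (creationPart i).coeff (e + r + 1 + j)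
          + annCoeff r i * (creationPart j).coeff (e + r + 1 + i)) * heis N p r g
      + ∑ r ∈ Finset.range R, ∑ s ∈ Finset.range R,
          if e + r + s + 2 + i + j = 0 then
            annCoeff r i * annCoeff s j * heis N p s (heis N p r g) else 0 := by
  have hR' : ∀ r s, R ≤ s → heis N p s (heis N p r g) = 0 := by
    intro r s hs
    rw [heis_comm, hR s hs, map_zero]
  have h1 : ∀ (g : Fock), (∀ r, R ≤ r → heis N p r g = 0) → field N 0 p [j] g =
      creationPart j * HahnSeries.C g + ∑ r ∈ Finset.range R,
        HahnSeries.single (-(r : ℤ) - 1 - j) (annCoeff r j)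
          * HahnSeries.C (heis N p r g) := by
    intro g hg
    change creationPart j * field N 0 p [] g + annihilationPart N p j (field N 0 p []) g = _
    rw [annihilationPart_eq_sum hg]
    simp only [field_nil]
    rfl
  have h2 : field N 0 p [i, j] g = creationPart i * field N 0 p [j] g
      + ∑ r ∈ Finset.range R, HahnSeries.single (-(r : ℤ) - 1 - i) (annCoeff r i)
          * field N 0 p [j] (heis N p r g) := by
    change creationPart i * field N 0 p [j] g + annihilationPart N p i (field N 0 p [j]) g = _
    rw [annihilationPart_eq_sum hR]
    rfl
  have hC : ∀ (f : LaurentSeries Fock) (g : Fock) (e : ℤ),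
      (f * HahnSeries.C g).coeff e = f.coeff e * g := by
    intro f g e
    rw [HahnSeries.C_apply, HahnSeries.coeff_mul_single_zero]
  have hS : ∀ (a : ℤ) (b : Fock) (f : LaurentSeries Fock) (e : ℤ),
      (HahnSeries.single a b * f).coeff e = b * f.coeff (e - a) := by
    intro a b f e
    rw [HahnSeries.coeff_single_mul]
  rw [quad, h2, h1 g hR, mul_add, ← mul_assoc, HahnSeries.coeff_add, HahnSeries.coeff_add, hC,
    Finset.mul_sum, HahnSeries.coeff_sum, HahnSeries.coeff_sum, add_assoc, add_assoc]
  congr 1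
  have h3 : ∀ r ∈ Finset.range R, (creationPart i * (HahnSeries.single (-(r : ℤ) - 1 - j)
      (annCoeff r j) * HahnSeries.C (heis N p r g))).coeff e
      = annCoeff r j * (creationPart i).coeff (e + r + 1 + j) * heis N p r g := by
    intro r _
    rw [← mul_assoc, hC, mul_comm (creationPart i), hS]
    congr 3
    ring
  have h4 : ∀ r ∈ Finset.range R, (HahnSeries.single (-(r : ℤ) - 1 - i) (annCoeff r i)
          * field N 0 p [j] (heis N p r g)).coeff e
      = annCoeff r i * (creationPart j).coeff (e + r + 1 + i) * heis N p r g
        + ∑ s ∈ Finset.range R,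
          if e + r + s + 2 + i + j = 0 then
            annCoeff r i * annCoeff s j * heis N p s (heis N p r g) else 0 := by
    intro r _
    rw [hS, h1 _ (hR' r), HahnSeries.coeff_add, hC, HahnSeries.coeff_sum, mul_add, Finset.mul_sum]
    congr 1
    · rw [mul_assoc]
      congr 3
      ring
    · refine Finset.sum_congr rfl fun s _ => ?_
      rw [hS, HahnSeries.C_apply, HahnSeries.coeff_single]
      by_cases h : e + r + s + 2 + i + j = 0
      · rw [if_pos h, if_pos (by linarith)]
        ring
      · rw [if_neg h, if_neg (fun h' => h (by linarith))]
        ring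
  rw [Finset.sum_congr rfl h3, Finset.sum_congr rfl h4, Finset.sum_add_distrib, ← add_assoc,
    ← Finset.sum_add_distrib]
  simp only [add_mul]

lemma sort_pair {i j : ℕ} (h : i ≤ j) :
    (Finsupp.toMultiset (Finsupp.single i 1 + Finsupp.single j 1)).sort = [i, j] := by
  rw [map_add, Finsupp.toMultiset_single, Finsupp.toMultiset_single, one_smul, one_smul]
  have : ({i} + {j} : Multiset ℕ) = ((↑[i, j] : Multiset ℕ)) := rfl
  rw [this, Multiset.coe_sort]
  exact List.mergeSort_of_pairwise (by simpa using h)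

lemma prod_add_left (N : ℤ) (a a' b : Space) (n : ℤ) :
    prod N (a + a') n b = prod N a n b + prod N a' n b := by simp [prod]

lemma prod_smul_left (N : ℤ) (c : ℂ) (a b : Space) (n : ℤ) :
    prod N (c • a) n b = c • prod N a n b := by simp [prod]

lemma prod_add_right (N : ℤ) (a b b' : Space) (n : ℤ) :
    prod N a n (b + b') = prod N a n b + prod N a n b' := by simp [prod]

lemma prod_smul_right (N : ℤ) (c : ℂ) (a b : Space) (n : ℤ) :
    prod N a n (c • b) = c • prod N a n b := by simp [prod]

lemma prod_zero_right (N : ℤ) (a : Space) (n : ℤ) : prod N a n 0 = 0 := by simp [prod]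

lemma prod_zero_left (N : ℤ) (b : Space) (n : ℤ) : prod N 0 n b = 0 := by simp [prod]

lemma prod_monomial_single (N m p n : ℤ) (s : ℕ →₀ ℕ) (g : Fock) :
    prod N (Finsupp.single m (monomial s 1)) n (Finsupp.single p g)
      = Finsupp.single (m + p)
          ((field N m p ((Finsupp.toMultiset s).sort) g).coeff (-n - 1)) := by
  rw [prod_monomial]
  rfl

/-- The quadratic vector `α(-i-1) α(-j-1) 𝟏`. -/
def quadVec (i j : ℕ) : Space := Finsupp.single 0 (X i * X j)

lemma quadVec_prod (N p n : ℤ) {i j : ℕ} (h : i ≤ j) (g : Fock) :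
    prod N (quadVec i j) n (Finsupp.single p g) = Finsupp.single p (quad N p i j (-n - 1) g) := by
  have : (X i * X j : Fock) = monomial (Finsupp.single i 1 + Finsupp.single j 1) 1 := by
    rw [X, X, monomial_mul, one_mul]
  rw [quadVec, this, prod_monomial_single, sort_pair h, zero_add, quad]

lemma heis_finite_bound (N p : ℤ) (g : Fock) : ∃ R, ∀ r, R ≤ r → heis N p r g = 0 := by
  obtain ⟨R, hR⟩ := (heis_finite N p g).bddAbove
  refine ⟨R + 1, fun r hr => ?_⟩
  by_contra h
  exact absurd (hR (show r ∈ Function.support _ from h)) (by omega)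

lemma quad_smul (N p : ℤ) (i j : ℕ) (e : ℤ) (c : ℂ) (g : Fock) :
    quad N p i j e (c • g) = c • quad N p i j e g := by
  simp only [quad, map_smul]
  rfl

/-! ### The conformal vector and the vacuum -/

lemma derivation_sum_apply (f : ℕ → Derivation ℂ Fock Fock) (s : Finset ℕ) (g : Fock) :
    (∑ r ∈ s, f r) g = ∑ r ∈ s, f r g := by
  induction s using Finset.induction_on with
  | empty => simp
  | insert a s ha ih => rw [Finset.sum_insert ha, Finset.sum_insert ha, Derivation.add_apply, ih]

lemma derivation_eq_sum (Δ : Derivation ℂ Fock Fock) {g : Fock} {R : ℕ}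
    (hR : g.vars ⊆ Finset.range R) :
    Δ g = ∑ r ∈ Finset.range R, Δ (X r) * pderiv r g := by
  have h : Δ g = (∑ r ∈ Finset.range R, Δ (X r) • (pderiv r : Derivation ℂ Fock Fock)) g := by
    apply MvPolynomial.derivation_eq_of_forall_mem_vars
    intro i hi
    have hi' := Finset.mem_range.1 (hR hi)
    simp only [derivation_sum_apply, Derivation.smul_apply, smul_eq_mul]
    rw [Finset.sum_eq_single i]
    · simp
    · intro j _ hj
      rw [pderiv_X_of_ne hj.symm, mul_zero]
    · intro h
      exact absurd (Finset.mem_range.2 hi') h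
  rw [h]
  simp only [derivation_sum_apply, Derivation.smul_apply, smul_eq_mul]

lemma exists_vars_subset (g : Fock) : ∃ R, g.vars ⊆ Finset.range R := by
  refine ⟨g.vars.sup id + 1, fun i hi => Finset.mem_range.2 ?_⟩
  have : i ≤ g.vars.sup id := Finset.le_sup (f := id) hi
  omega

lemma heis_succ (N p : ℤ) (r : ℕ) (g : Fock) :
    heis N p (r + 1) g = ((N * (r + 1) : ℤ) : ℂ) • pderiv r g := rfl

lemma heis_zero (N p : ℤ) (g : Fock) : heis N p 0 g = ((N * p : ℤ) : ℂ) • g := rfl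

lemma heis_eq_zero_of_vars {N p : ℤ} {g : Fock} {R : ℕ} (hR : g.vars ⊆ Finset.range R)
    (r : ℕ) (hr : R + 1 ≤ r) : heis N p r g = 0 := by
  obtain ⟨r, rfl⟩ : ∃ k, r = k + 1 := ⟨r - 1, by omega⟩
  rw [heis_succ, pderiv_eq_zero_of_notMem_vars, smul_zero]
  intro h
  have := Finset.mem_range.1 (hR h)
  omega

@[simp] lemma annCoeff_zero (r : ℕ) : annCoeff r 0 = 1 := by simp [annCoeff]

/-- The derivation `α(-k) ↦ k α(-k-1)` of `S(ĥ₋)`. -/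
def transl : Derivation ℂ Fock Fock := mkDerivation ℂ fun k => ((k : ℂ) + 1) • X (k + 1)

/-- The derivation `α(-k) ↦ k α(-k)` of `S(ĥ₋)`. -/
def euler : Derivation ℂ Fock Fock := mkDerivation ℂ fun k => ((k : ℂ) + 1) • X k

@[simp] lemma transl_X (k : ℕ) : transl (X k) = ((k : ℂ) + 1) • X (k + 1) := mkDerivation_X _ _ _

@[simp] lemma euler_X (k : ℕ) : euler (X k) = ((k : ℂ) + 1) • X k := mkDerivation_X _ _ _

lemma omega_eq (N : ℤ) : omega N = (1 / (2 * (N : ℂ))) • quadVec 0 0 := by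
  rw [omega, quadVec, Finsupp.smul_single, smul_eq_C_mul, pow_two]

lemma omega_prod (N p n : ℤ) (g : Fock) :
    prod N (omega N) n (Finsupp.single p g)
      = Finsupp.single p ((1 / (2 * (N : ℂ))) • quad N p 0 0 (-n - 1) g) := by
  rw [omega_eq, prod_smul_left, quadVec_prod N p n le_rfl, Finsupp.smul_single]

lemma creation_mul_coeff_neg (i j : ℕ) (e : ℤ) (he : e < 0) :
    (creationPart i * creationPart j).coeff e = 0 := by
  rw [creationPart, creationPart, ← map_mul, PowerSeries.coeff_coe, if_pos he]

/-- `L(-1)` acts on `M(1, pα)` by `f e^{pα} ↦ (transl f + p α(-1) f) e^{pα}`. -/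
lemma omega_prod_zero {N : ℤ} (hN : N ≠ 0) (p : ℤ) (g : Fock) :
    prod N (omega N) 0 (Finsupp.single p g)
      = Finsupp.single p (transl g + (p : ℂ) • (X 0 * g)) := by
  obtain ⟨R, hR⟩ := exists_vars_subset g
  have hN' : (N : ℂ) ≠ 0 := by exact_mod_cast hN
  rw [omega_prod, quad_eq (heis_eq_zero_of_vars hR), creation_mul_coeff_neg _ _ _ (by norm_num),
    derivation_eq_sum _ hR,
    Finset.sum_eq_zero (s := Finset.range (R + 1)) (f := fun r => ∑ s ∈ _, _)]
  · rw [Finset.sum_range_succ']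
    have h : ∀ r : ℕ, (-0 - 1 + (r : ℤ) + 1 + (0 : ℕ)) = r := by intro r; simp
    simp only [h, creationPart_coeff_nat, heis_zero, heis_succ, transl_X]
    congr 1
    simp only [annCoeff_zero, smul_eq_C_mul]
    simp only [zero_mul, zero_add, add_zero, Nat.choose_zero_right, Nat.cast_one, one_mul, mul_add,
      Finset.mul_sum]
    congr 1
    · refine Finset.sum_congr rfl fun r _ => ?_
      have : (C (1 / (2 * (N : ℂ))) : Fock) * (2 * C (((N * r + N * 1 : ℤ) : ℂ)))
          = C ((r : ℂ) + 1) := by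
        rw [show (2 : Fock) = C 2 from (map_ofNat C 2).symm, ← C_mul, ← C_mul]
        congr 1
        push_cast
        field_simp
      generalize (C (((N * r + N * 1 : ℤ) : ℂ)) : Fock) = c at this ⊢
      linear_combination (X (r + 1) * (pderiv r) g) * this
    · have : (C (1 / (2 * (N : ℂ))) : Fock) * (2 * C (((N * p : ℤ) : ℂ))) = C (p : ℂ) := by
        rw [show (2 : Fock) = C 2 from (map_ofNat C 2).symm, ← C_mul, ← C_mul]
        congr 1
        push_cast
        field_simp
      linear_combination (X 0 * g) * this
  · intro r _
    refine Finset.sum_eq_zero fun s _ => if_neg ?_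
    push_cast
    omega

/-- `L(0)` acts on `M(1, pα)` by `euler + ⟨pα, pα⟩ / 2`. -/
lemma omega_prod_one {N : ℤ} (hN : N ≠ 0) (p : ℤ) (g : Fock) :
    prod N (omega N) 1 (Finsupp.single p g)
      = Finsupp.single p (euler g + ((N : ℂ) * p ^ 2 / 2) • g) := by
  obtain ⟨R, hR⟩ := exists_vars_subset g
  have hN' : (N : ℂ) ≠ 0 := by exact_mod_cast hN
  rw [omega_prod, quad_eq (heis_eq_zero_of_vars hR), creation_mul_coeff_neg _ _ _ (by norm_num),
    derivation_eq_sum _ hR]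
  have h0 : (∑ r ∈ Finset.range (R + 1), ∑ s ∈ Finset.range (R + 1),
      if -1 - 1 + (r : ℤ) + s + 2 + (0 : ℕ) + (0 : ℕ) = 0 then
        annCoeff r 0 * annCoeff s 0 * heis N p s (heis N p r g) else 0)
      = heis N p 0 (heis N p 0 g) := by
    rw [Finset.sum_eq_single 0, Finset.sum_eq_single 0]
    · simp
    · intro s _ hs
      exact if_neg (by push_cast; omega)
    · simp
    · intro r _ hr
      exact Finset.sum_eq_zero fun s _ => if_neg (by push_cast; omega)
    · simp
  rw [h0]
  clear h0
  · rw [Finset.sum_range_succ']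
    have h : ∀ r : ℕ, (-1 - 1 + ((r + 1 : ℕ) : ℤ) + 1 + (0 : ℕ)) = r := by intro r; push_cast; ring
    simp only [h, creationPart_coeff_nat, heis_zero, heis_succ, euler_X]
    congr 1
    rw [creationPart_coeff_neg 0 _ (by norm_num)]
    simp only [annCoeff_zero, smul_eq_C_mul]
    simp only [zero_mul, zero_add, mul_zero, add_zero, Nat.choose_zero_right, Nat.cast_one,
      one_mul, mul_add, Finset.mul_sum]
    congr 1
    · refine Finset.sum_congr rfl fun r _ => ?_
      have : (C (1 / (2 * (N : ℂ))) : Fock) * (2 * C (((N * r + N * 1 : ℤ) : ℂ)))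
          = C ((r : ℂ) + 1) := by
        rw [show (2 : Fock) = C 2 from (map_ofNat C 2).symm, ← C_mul, ← C_mul]
        congr 1
        push_cast
        field_simp
      generalize (C (((N * r + N * 1 : ℤ) : ℂ)) : Fock) = c at this ⊢
      linear_combination (X r * (pderiv r) g) * this
    · rw [← mul_assoc, ← mul_assoc, ← C_mul, ← C_mul]
      congr 2
      push_cast
      field_simp

lemma creationPart_eq_ofPowerSeries (k : ℕ) : ∃ φ : PowerSeries Fock,
    creationPart k = HahnSeries.ofPowerSeries ℤ Fock φ ∧ PowerSeries.coeff 0 φ = X k ∧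
      PowerSeries.coeff 1 φ = transl (X k) := by
  refine ⟨_, rfl, ?_, ?_⟩
  · simp
  · simp [smul_eq_C_mul, add_comm]

lemma annihilationPart_one (N : ℤ) (k : ℕ) (F : Fock →ₗ[ℂ] LaurentSeries Fock) :
    annihilationPart N 0 k F 1 = 0 := by
  have h : ∀ r, 0 ≤ r → heis N 0 r 1 = 0 := by
    intro r _
    cases r <;> simp [heis]
  rw [annihilationPart_eq_sum h]
  simp

lemma expCreation_coeff_zero (m : ℤ) : PowerSeries.coeff 0 (expCreation m) = 1 := by
  unfold expCreation
  rw [PowerSeries.coeff_subst' (PowerSeries.HasSubst.of_constantCoeff_zero' (by simp)),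
    finsum_eq_single _ 0]
  · simp
  · intro n hn
    simp [hn]

lemma expCreation_coeff_one (m : ℤ) : PowerSeries.coeff 1 (expCreation m) = (m : ℂ) • X 0 := by
  unfold expCreation
  rw [PowerSeries.coeff_subst' (PowerSeries.HasSubst.of_constantCoeff_zero' (by simp)),
    finsum_eq_single _ 1]
  · simp [smul_eq_C_mul]
  · intro n hn
    rcases n with _ | _ | n
    · simp
    · simp at hn
    · have h : ∀ φ : PowerSeries Fock, PowerSeries.constantCoeff φ = 0 →
          PowerSeries.coeff 1 (φ ^ (n + 1 + 1)) = 0 := by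
        intro φ hφ
        refine PowerSeries.coeff_of_lt_order _ ?_
        refine lt_of_lt_of_le ?_ (PowerSeries.le_order_pow_of_constantCoeff_eq_zero _ hφ)
        norm_cast
        omega
      rw [h _ (by simp), smul_zero]

/-- The field of a vector `v = l e^{mα}` on the vacuum is `v + x L(-1) v + …`, without negative
powers of `x`. -/
lemma field_one (N m : ℤ) (l : List ℕ) : ∃ φ : PowerSeries Fock,
    field N m 0 l 1 = HahnSeries.ofPowerSeries ℤ Fock φ ∧
      PowerSeries.coeff 0 φ = (l.map X).prod ∧
      PowerSeries.coeff 1 φ = transl (l.map X).prod + (m : ℂ) • (X 0 * (l.map X).prod) := by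
  induction l with
  | nil =>
    refine ⟨expCreation m, ?_, ?_, ?_⟩
    · simp [field, expField]
    · simp [expCreation_coeff_zero]
    · simp [expCreation_coeff_one]
  | cons k l ih =>
    obtain ⟨φ, h, h0, h1⟩ := ih
    obtain ⟨ψ, h', h0', h1'⟩ := creationPart_eq_ofPowerSeries k
    refine ⟨ψ * φ, ?_, ?_, ?_⟩
    · change creationPart k * field N m 0 l 1 + annihilationPart N 0 k _ 1 = _
      rw [annihilationPart_one, add_zero, h, h', map_mul]
    · rw [PowerSeries.coeff_mul]
      simp [h0, h0']
    · rw [PowerSeries.coeff_mul]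
      simp only [List.map_cons, List.prod_cons]
      have : (Finset.HasAntidiagonal.antidiagonal 1 : Finset (ℕ × ℕ)) = {(0, 1), (1, 0)} := rfl
      rw [this, Finset.sum_pair (by simp), h0, h1, h0', h1', Derivation.leibniz]
      simp only [smul_eq_mul, smul_eq_C_mul]
      ring

lemma sort_prod_X (s : ℕ →₀ ℕ) :
    (((Finsupp.toMultiset s).sort).map X).prod = (monomial s 1 : Fock) := by
  rw [← Multiset.prod_coe, ← Multiset.map_coe, Multiset.sort_eq, Finsupp.toMultiset_map,
    Finsupp.prod_toMultiset]
  rw [monomial_eq]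
  simp [Finsupp.prod_mapDomain_index, pow_add]

lemma prod_single_vac_neg_two (N m : ℤ) (f : Fock) :
    prod N (Finsupp.single m f) (-2) vac
      = Finsupp.single m (transl f + (m : ℂ) • (X 0 * f)) := by
  induction f using MvPolynomial.induction_on' with
  | monomial s c =>
    have hc : (Finsupp.single m (monomial s c) : Space)
        = c • Finsupp.single m (monomial s 1) := by
      rw [Finsupp.smul_single, smul_monomial, smul_eq_mul, mul_one]
    have hc' : (monomial s c : Fock) = c • monomial s 1 := by
      rw [smul_monomial, smul_eq_mul, mul_one]
    obtain ⟨φ, h, -, h1⟩ := field_one N m ((Finsupp.toMultiset s).sort)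
    rw [sort_prod_X] at h1
    rw [vac, expVec]
    simp only [hc, prod_smul_left, prod_monomial_single, add_zero, h]
    rw [PowerSeries.coeff_coe, if_neg (by omega), hc', Derivation.map_smul, mul_smul_comm,
      smul_comm (m : ℂ) c, ← smul_add, ← Finsupp.smul_single, ← h1]
    congr 2
  | add f g hf hg =>
    simp only [Finsupp.single_add, prod_add_left, hf, hg, map_add, mul_add, smul_add]
    simp only [← Finsupp.single_add]
    congr 1
    abel

/-- Both sides are the translation operator `L(-1)` of `V_L`. -/
lemma prod_vac_neg_two {N : ℤ} (hN : N ≠ 0) (a : Space) :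
    prod N a (-2) vac = prod N (omega N) 0 a := by
  induction a using Finsupp.induction_linear with
  | zero => rw [prod_zero_left, prod_zero_right]
  | add a b ha hb => rw [prod_add_left, prod_add_right, ha, hb]
  | single m f => rw [prod_single_vac_neg_two N m f, omega_prod_zero hN]

/-! ### Modes of `ω` and `α(-1) α(-3) 𝟏` on the vectors `e^{mα}` -/

lemma annCoeff_eq (r i : ℕ) : annCoeff r i = (-1) ^ i * ((r + i).choose i : Fock) := by
  have h : Ring.choose (-(r : ℤ) - 1) i = (-1) ^ i * ((r + i).choose i : ℤ) := by
    rw [show -(r : ℤ) - 1 = -((r : ℤ) + 1) by ring, Ring.choose_neg,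
      show (r : ℤ) + 1 + i - 1 = ((r + i : ℕ) : ℤ) by push_cast; ring, Ring.choose_natCast,
      Int.negOnePow_def, Units.smul_def]
    simp
  rw [annCoeff, h]
  simp

lemma creation_mul_coeff_nat (i j n : ℕ) :
    (creationPart i * creationPart j).coeff (n : ℤ)
      = ∑ q ∈ Finset.HasAntidiagonal.antidiagonal n,
        (((q.1 + i).choose i : Fock) * X (q.1 + i))
          * (((q.2 + j).choose j : Fock) * X (q.2 + j)) := by
  rw [creationPart, creationPart, ← map_mul, HahnSeries.ofPowerSeries_apply_coeff,
    PowerSeries.coeff_mul]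
  simp only [PowerSeries.coeff_mk]

lemma creation_mul_coeff_zero (i j : ℕ) :
    (creationPart i * creationPart j).coeff 0 = X i * X j := by
  have h := creation_mul_coeff_nat i j 0
  simpa using h

lemma heis_one (N p : ℤ) (r : ℕ) (hr : 1 ≤ r) : heis N p r 1 = 0 := by
  obtain ⟨r, rfl⟩ : ∃ k, r = k + 1 := ⟨r - 1, by omega⟩
  simp [heis_succ]

lemma quad_one (N p : ℤ) (i j : ℕ) (e : ℤ) :
    quad N p i j e 1 = (creationPart i * creationPart j).coeff e
      + ((-1) ^ j * (creationPart i).coeff (e + 1 + j)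
          + (-1) ^ i * (creationPart j).coeff (e + 1 + i)) * C ((N : ℂ) * p)
      + if e + 2 + i + j = 0 then (-1) ^ i * (-1) ^ j * C (((N : ℂ) * p) ^ 2) else 0 := by
  rw [quad_eq (heis_one N p)]
  simp [heis_zero, smul_eq_C_mul, mul_assoc, pow_two, annCoeff_eq]

/-- The action of `ω_n` on `M(1, pα)`. -/
def omegaMode (N p n : ℤ) (g : Fock) : Fock := (1 / (2 * (N : ℂ))) • quad N p 0 0 (-n - 1) g

lemma creationPart_zero_coeff_two : (creationPart 0).coeff 2 = X 2 := by
  have h := creationPart_coeff_nat 0 2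
  simpa using h

lemma creationPart_zero_coeff_three : (creationPart 0).coeff 3 = X 3 := by
  have h := creationPart_coeff_nat 0 3
  simpa using h

lemma creationPart_coeff_zero (k : ℕ) : (creationPart k).coeff 0 = X k := by
  have h := creationPart_coeff_nat k 0
  simpa using h

lemma creationPart_coeff_one (k : ℕ) : (creationPart k).coeff 1 = ((k : Fock) + 1) * X (k + 1) := by
  have h := creationPart_coeff_nat k 1
  rw [add_comm 1 k, Nat.choose_symm_add] at h
  simpa using h

lemma omegaMode_neg_one_one {N : ℤ} (hN : N ≠ 0) (p : ℤ) :
    omegaMode N p (-1) 1 = C (1 / (2 * (N : ℂ))) * X 0 ^ 2 + C (p : ℂ) * X 1 := by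
  have hN' : (N : ℂ) ≠ 0 := by exact_mod_cast hN
  have h : (C (1 / (2 * (N : ℂ))) : Fock) * (2 * C ((N : ℂ) * p)) = C (p : ℂ) := by
    rw [show (2 : Fock) = C 2 from (map_ofNat C 2).symm, ← C_mul, ← C_mul]
    congr 1
    field_simp
  rw [omegaMode, quad_one, smul_eq_C_mul, if_neg (by norm_num), ← h]
  norm_num [creation_mul_coeff_zero, creationPart_coeff_one, -one_div]
  ring

lemma omegaMode_neg_two_one {N : ℤ} (hN : N ≠ 0) (p : ℤ) :
    omegaMode N p (-2) 1 = C (1 / (N : ℂ)) * (X 0 * X 1) + C (p : ℂ) * X 2 := by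
  have hN' : (N : ℂ) ≠ 0 := by exact_mod_cast hN
  have h : (C (1 / (2 * (N : ℂ))) : Fock) * (2 * C ((N : ℂ) * p)) = C (p : ℂ) := by
    rw [show (2 : Fock) = C 2 from (map_ofNat C 2).symm, ← C_mul, ← C_mul]
    congr 1
    field_simp
  have h' : (C (1 / (2 * (N : ℂ))) : Fock) * 2 = C (1 / (N : ℂ)) := by
    rw [show (2 : Fock) = C 2 from (map_ofNat C 2).symm, ← C_mul]
    congr 1
    field_simp
  have h1 := creation_mul_coeff_nat 0 0 1
  rw [show (Finset.HasAntidiagonal.antidiagonal 1 : Finset (ℕ × ℕ)) = {(0, 1), (1, 0)} from rfl,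
    Finset.sum_pair (by simp)] at h1
  rw [omegaMode, quad_one, smul_eq_C_mul, if_neg (by norm_num), ← h, ← h']
  norm_num [creationPart_zero_coeff_two, creationPart_zero_coeff_three, -one_div] at h1 ⊢
  rw [h1]
  ring

lemma omegaMode_neg_three_one {N : ℤ} (hN : N ≠ 0) (p : ℤ) :
    omegaMode N p (-3) 1 = C (1 / (2 * (N : ℂ))) * (2 * X 0 * X 2 + X 1 ^ 2) + C (p : ℂ) * X 3 := by
  have hN' : (N : ℂ) ≠ 0 := by exact_mod_cast hN
  have h : (C (1 / (2 * (N : ℂ))) : Fock) * (2 * C ((N : ℂ) * p)) = C (p : ℂ) := by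
    rw [show (2 : Fock) = C 2 from (map_ofNat C 2).symm, ← C_mul, ← C_mul]
    congr 1
    field_simp
  have h1 := creation_mul_coeff_nat 0 0 2
  rw [show (Finset.HasAntidiagonal.antidiagonal 2 : Finset (ℕ × ℕ)) = {(0, 2), (1, 1), (2, 0)}
    from rfl, Finset.sum_insert (by simp), Finset.sum_pair (by simp)] at h1
  rw [omegaMode, quad_one, smul_eq_C_mul, if_neg (by norm_num), ← h]
  norm_num [creationPart_zero_coeff_two, creationPart_zero_coeff_three, -one_div] at h1 ⊢
  rw [h1]
  ring

lemma omegaMode_neg_one_quadratic {N : ℤ} (hN : N ≠ 0) (p : ℤ) (a b : ℂ) :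
    omegaMode N p (-1) (C a * X 0 ^ 2 + C b * X 1)
      = (C (1 / (2 * (N : ℂ))) * X 0 ^ 2 + C (p : ℂ) * X 1) * (C a * X 0 ^ 2 + C b * X 1)
        + 2 * C a * X 0 * X 2 + 2 * C b * X 3 := by
  have hN' : (N : ℂ) ≠ 0 := by exact_mod_cast hN
  have h : (C (1 / (2 * (N : ℂ))) : Fock) * (2 * C (N : ℂ)) = 1 := by
    rw [show (2 : Fock) = C 2 from (map_ofNat C 2).symm, ← C_mul, ← C_mul, ← C_1]
    congr 1
    field_simp
  have hv : (C a * X 0 ^ 2 + C b * X 1 : Fock).vars ⊆ Finset.range 2 := by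
    refine (vars_add_subset _ _).trans (Finset.union_subset ?_ ?_) <;>
    refine (vars_mul _ _).trans (Finset.union_subset (by simp) ?_)
    · refine (vars_pow _ _).trans ?_
      simp [vars_X]
    · simp [vars_X]
  rw [omegaMode, quad_eq (heis_eq_zero_of_vars hv), smul_eq_C_mul,
    Finset.sum_eq_zero (f := fun r => ∑ s ∈ _, _)]
  · simp only [Finset.sum_range_succ, Finset.sum_range_zero, heis_zero, heis_succ]
    norm_num [creation_mul_coeff_zero, creationPart_zero_coeff_two, creationPart_zero_coeff_three,
      creationPart_coeff_one, -one_div,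
      smul_eq_C_mul, pderiv_X_of_ne]
    simp only [map_intCast, map_ofNat] at h ⊢
    linear_combination (2 * C a * X 0 * X 2 + 2 * C b * X 3
      + (p : Fock) * X 1 * (C a * X 0 ^ 2 + C b * X 1)) * h
  · intro r _
    refine Finset.sum_eq_zero fun s _ => if_neg ?_
    push_cast
    omega

/-- The modes `J_n e^{pα}` of `J = α(-1) α(-3) 𝟏` for `n = 3, 2, 1, 0, -1` and `n ≥ 4`. -/
lemma quad_zero_two_one (N p : ℤ) :
    quad N p 0 2 (-3 - 1) 1 = C (((N : ℂ) * p) ^ 2) ∧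
    quad N p 0 2 (-2 - 1) 1 = C ((N : ℂ) * p) * X 0 ∧
    quad N p 0 2 (-1 - 1) 1 = C ((N : ℂ) * p) * X 1 ∧
    quad N p 0 2 (-0 - 1) 1 = C (2 * ((N : ℂ) * p)) * X 2 ∧
    quad N p 0 2 (-(-1) - 1) 1 = X 0 * X 2 + C (4 * ((N : ℂ) * p)) * X 3 ∧
    ∀ n : ℕ, quad N p 0 2 (-((n : ℤ) + 4) - 1) 1 = 0 := by
  refine ⟨?_, ?_, ?_, ?_, ?_, fun n => ?_⟩
  · rw [quad_one, creation_mul_coeff_neg _ _ _ (by norm_num),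
      creationPart_coeff_neg _ _ (by norm_num), creationPart_coeff_neg _ _ (by norm_num)]
    norm_num
  · rw [quad_one, creation_mul_coeff_neg _ _ _ (by norm_num),
      creationPart_coeff_neg 2 _ (by norm_num)]
    norm_num [creationPart_coeff_zero]
    ring
  · rw [quad_one, creation_mul_coeff_neg _ _ _ (by norm_num),
      creationPart_coeff_neg 2 _ (by norm_num)]
    norm_num [creationPart_coeff_one]
    ring
  · rw [quad_one, creation_mul_coeff_neg _ _ _ (by norm_num)]
    norm_num [creationPart_coeff_zero, creationPart_zero_coeff_two,
      creationPart_zero_coeff_three, map_ofNat]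
    ring
  · rw [quad_one]
    norm_num [creation_mul_coeff_zero, creationPart_coeff_one, creationPart_zero_coeff_two,
      creationPart_zero_coeff_three, map_ofNat]
    ring
  · rw [quad_one, creation_mul_coeff_neg _ _ _ (by omega),
      creationPart_coeff_neg _ _ (by push_cast; omega),
      creationPart_coeff_neg _ _ (by push_cast; omega), if_neg (by push_cast; omega)]
    simp

/-! ### Relations in `V_L^+` -/

lemma VertexSubalgebra.val_injective {N : ℤ} (P : VertexSubalgebra N) :
    Function.Injective P.val := Subtype.val_injective

lemma VertexSubalgebra.val_mul {N : ℤ} (P : VertexSubalgebra N) (a : P) (n : ℤ) (b : P) :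
    P.val (P.mul a n b) = prod N (P.val a) n (P.val b) := rfl

lemma fockTheta_fockTheta (f : Fock) : fockTheta (fockTheta f) = f := by
  have h : fockTheta.comp fockTheta = AlgHom.id ℂ Fock := by
    apply MvPolynomial.algHom_ext
    intro i
    simp
  exact DFunLike.congr_fun h f

lemma theta_theta (a : Space) : theta (theta a) = a := by
  induction a using Finsupp.induction_linear with
  | zero => simp
  | add a b ha hb => rw [map_add, map_add, ha, hb]
  | single m f => rw [theta_single, theta_single, neg_neg, fockTheta_fockTheta]

lemma mem_VLPlus {N : ℤ} {a : Space} : a ∈ (VLPlus N).toSubmodule ↔ theta a = a := by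
  change theta a - a = 0 ↔ _
  rw [sub_eq_zero]

/-- The vector `f e^{mα} + θ(f e^{mα})` of `V_L^+`, as a linear function of `f`. -/
def expPlus (N m : ℤ) : Fock →ₗ[ℂ] VLPlus N :=
  LinearMap.codRestrict (VLPlus N).toSubmodule
    ((LinearMap.id + theta) ∘ₗ Finsupp.lsingle m) fun f => by
      rw [mem_VLPlus]
      simp [theta_theta, add_comm]

lemma val_expPlus (N m : ℤ) (f : Fock) : (VLPlus N).val (expPlus N m f)
    = Finsupp.single m f + theta (Finsupp.single m f) := rfl

/-- The vector `f 𝟏` of `M(1)^+`, for a `θ`-invariant `f`. -/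
def evenVec (N : ℤ) (f : Fock) (hf : fockTheta f = f) : M1Plus N :=
  ⟨Finsupp.single 0 f, ⟨f, rfl⟩, by
    change Finsupp.single 0 f ∈ (VLPlus N).toSubmodule
    rw [mem_VLPlus, theta_single, hf, neg_zero]⟩

lemma fockTheta_quadratic (i j : ℕ) : fockTheta (X i * X j) = X i * X j := by
  simp

/-- The inclusion of `M(1)^+` in `V_L^+`. -/
abbrev plusIncl (N : ℤ) : M1Plus N →ₗ[ℂ] VLPlus N := VertexSubalgebra.incl (M1Plus_le_VLPlus N)

/-- The vector `α(-1) α(-3) 𝟏`, which together with `ω` generates `M(1)^+`. -/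
def quartic (N : ℤ) : M1Plus N := evenVec N (X 0 * X 2) (fockTheta_quadratic 0 2)

lemma mul_expPlus {N m n : ℤ} (a : VLPlus N) {g g' : Fock}
    (h : prod N ((VLPlus N).val a) n (Finsupp.single m g) = Finsupp.single m g') :
    (VLPlus N).mul a n (expPlus N m g) = expPlus N m g' := by
  apply VertexSubalgebra.val_injective
  have ha : theta ((VLPlus N).val a) = (VLPlus N).val a := mem_VLPlus.1 a.2
  rw [VertexSubalgebra.val_mul, val_expPlus, val_expPlus, prod_add_right, h]
  congr 1
  rw [← h, theta_prod, ha]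

lemma omega_mul_expPlus (N m n : ℤ) (g : Fock) :
    (VLPlus N).mul (plusIncl N (omegaM1Plus N)) n (expPlus N m g)
      = expPlus N m (omegaMode N m n g) :=
  mul_expPlus _ (omega_prod N m n g)

lemma omega_zero_mul_expPlus {N : ℤ} (hN : N ≠ 0) (m : ℤ) (g : Fock) :
    (VLPlus N).mul (plusIncl N (omegaM1Plus N)) 0 (expPlus N m g)
      = expPlus N m (transl g + (m : ℂ) • (X 0 * g)) :=
  mul_expPlus _ (omega_prod_zero hN m g)

lemma omega_one_mul_expPlus {N : ℤ} (hN : N ≠ 0) (m : ℤ) (g : Fock) :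
    (VLPlus N).mul (plusIncl N (omegaM1Plus N)) 1 (expPlus N m g)
      = expPlus N m (euler g + ((N : ℂ) * m ^ 2 / 2) • g) :=
  mul_expPlus _ (omega_prod_one hN m g)

lemma quartic_mul_expPlus (N m n : ℤ) (g : Fock) :
    (VLPlus N).mul (plusIncl N (quartic N)) n (expPlus N m g)
      = expPlus N m (quad N m 0 2 (-n - 1) g) :=
  mul_expPlus _ (quadVec_prod N m n (by norm_num) g)

/-- The relations between `ω`, `J = α(-1) α(-3) 𝟏` and a vector `e` of `V_L^+`.  The modes `J_j e`,
`j ≥ 0`, are obtained from `e` by the modes of `ω`, and `J_{-1} e` is `κ ω_{-1} ω_{-1} e` up to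
terms which are linear in `ω` or derivatives. -/
structure QuarticRelations {N : ℤ} (e : VLPlus N) (κ : ℂ) : Prop where
  omega_one : ∃ h : ℂ, (VLPlus N).mul (plusIncl N (omegaM1Plus N)) 1 e = h • e
  omega_ge : ∀ n : ℕ, (VLPlus N).mul (plusIncl N (omegaM1Plus N)) (n + 2) e = 0
  quartic_ge : ∀ n : ℕ, (VLPlus N).mul (plusIncl N (quartic N)) (n + 4) e = 0
  quartic_three : ∃ c : ℂ, (VLPlus N).mul (plusIncl N (quartic N)) 3 e = c • e
  quartic_two : ∃ c : ℂ, (VLPlus N).mul (plusIncl N (quartic N)) 2 e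
    = c • (VLPlus N).mul (plusIncl N (omegaM1Plus N)) 0 e
  quartic_one : ∃ c₁ c₂ : ℂ, (VLPlus N).mul (plusIncl N (quartic N)) 1 e
    = c₁ • (VLPlus N).mul (plusIncl N (omegaM1Plus N)) 0
        ((VLPlus N).mul (plusIncl N (omegaM1Plus N)) 0 e)
      + c₂ • (VLPlus N).mul (plusIncl N (omegaM1Plus N)) (-1) e
  quartic_zero : ∃ c₁ c₂ c₃ : ℂ, (VLPlus N).mul (plusIncl N (quartic N)) 0 e
    = c₁ • (VLPlus N).mul (plusIncl N (omegaM1Plus N)) 0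
        ((VLPlus N).mul (plusIncl N (omegaM1Plus N)) 0
          ((VLPlus N).mul (plusIncl N (omegaM1Plus N)) 0 e))
      + c₂ • (VLPlus N).mul (plusIncl N (omegaM1Plus N)) 0
          ((VLPlus N).mul (plusIncl N (omegaM1Plus N)) (-1) e)
      + c₃ • (VLPlus N).mul (plusIncl N (omegaM1Plus N)) (-2) e
  quartic_neg_one : ∃ c₂ c₃ c₄ c₅ : ℂ, (VLPlus N).mul (plusIncl N (quartic N)) (-1) e
    = κ • (VLPlus N).mul (plusIncl N (omegaM1Plus N)) (-1)
          ((VLPlus N).mul (plusIncl N (omegaM1Plus N)) (-1) e)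
      + c₂ • (VLPlus N).mul (plusIncl N (omegaM1Plus N)) 0
        ((VLPlus N).mul (plusIncl N (omegaM1Plus N)) 0
          ((VLPlus N).mul (plusIncl N (omegaM1Plus N)) (-1) e))
      + c₃ • (VLPlus N).mul (plusIncl N (omegaM1Plus N)) 0
          ((VLPlus N).mul (plusIncl N (omegaM1Plus N)) (-2) e)
      + c₄ • (VLPlus N).mul (plusIncl N (omegaM1Plus N)) (-3) e
      + c₅ • (VLPlus N).mul (plusIncl N (omegaM1Plus N)) 0
        ((VLPlus N).mul (plusIncl N (omegaM1Plus N)) 0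
          ((VLPlus N).mul (plusIncl N (omegaM1Plus N)) 0
            ((VLPlus N).mul (plusIncl N (omegaM1Plus N)) 0 e)))

/-- The coefficient of `ω_{-1} ω_{-1} e^{β}` in `J_{-1} e^{β}`, where `P = ⟨β, β⟩`. -/
def quarticCoeff (N : ℤ) (P : ℂ) : ℂ := -2 * N * (4 * P - 3) / ((2 * P - 1) * (2 * P - 9))

/-- The linear system for the coefficients `A₁, …, A₅` in `J_{-1} e = A₁ ω_{-1}² e + A₂ L(-1)²
ω_{-1} e + A₃ L(-1) ω_{-2} e + A₄ ω_{-3} e + A₅ L(-1)⁴ e`, where `e = e^{Mα}`.  The five equations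
compare the coefficients of `α(-1)⁴`, `α(-1)² α(-2)`, `α(-2)²`, `α(-1) α(-3)` and `α(-4)`. -/
lemma quarticCoeff_system {n M P : ℂ} (hP : P = M ^ 2 * n) (hn : n ≠ 0) (hM : M ≠ 0)
    (h1 : 2 * P - 1 ≠ 0) (h2 : P - 2 ≠ 0) (h9 : 2 * P - 9 ≠ 0) :
    ∃ A₂ A₃ A₄ A₅ : ℂ, let A₁ := -2 * n * (4 * P - 3) / ((2 * P - 1) * (2 * P - 9))
      let q := 1 / (2 * n)
      A₁ * q ^ 2 + A₂ * M ^ 2 * q + A₅ * M ^ 4 = 0 ∧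
      A₁ * 2 * q * M + A₂ * (M ^ 3 + 5 * M * q) + A₃ * M * 2 * q + 6 * A₅ * M ^ 3 = 0 ∧
      A₁ * M ^ 2 + A₂ * (M ^ 2 + 2 * q) + A₃ * 2 * q + A₄ * q + 3 * A₅ * M ^ 2 = 0 ∧
      A₁ * 2 * q + A₂ * (4 * M ^ 2 + 4 * q) + A₃ * (M ^ 2 + 4 * q) + A₄ * 2 * q
        + 8 * A₅ * M ^ 2 = 1 ∧
      2 * A₁ + 6 * A₂ + 3 * A₃ + A₄ + 6 * A₅ = 4 * n := by
  have hP0 : P ≠ 0 := by rw [hP]; positivity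
  set a₁ : ℂ := -2 * (4 * P - 3) / ((2 * P - 1) * (2 * P - 9)) with ha₁
  set a₂ : ℂ := (a₁ * (5 / 2 - 3 * P - 1 / (2 * P)) - 1) / ((P - 2) * (P - 1 / 2)) with ha₂
  have h1' : P - 1 / 2 ≠ 0 := by
    intro h
    apply h1
    linear_combination 2 * h
  have e1 : a₁ * ((2 * P - 1) * (2 * P - 9)) = -2 * (4 * P - 3) := by
    rw [ha₁]; field_simp
  have e2 : a₂ * ((P - 2) * (P - 1 / 2)) = a₁ * (5 / 2 - 3 * P - 1 / (2 * P)) - 1 := by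
    rw [ha₂]; field_simp
  have hA₁ : -2 * n * (4 * P - 3) / ((2 * P - 1) * (2 * P - 9)) = n * a₁ := by
    rw [ha₁]; ring
  have hMn : 1 / (2 * n) = M ^ 2 / (2 * P) := by
    rw [hP]; field_simp
  have hM2 : n = P / M ^ 2 := by rw [hP]; field_simp
  clear_value a₁ a₂
  refine ⟨n * a₂, n * (-a₁ * (1 - 3 / (2 * P)) - a₂ * (P - 1 / 2)),
    n * (a₁ * (2 - 2 * P - 3 / (2 * P))), n * (-a₁ / (4 * P ^ 2) - a₂ / (2 * P)), ?_⟩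
  rw [hA₁]
  intro A₁ q
  simp only [A₁, q, hMn]
  refine ⟨?_, ?_, ?_, ?_, ?_⟩
  · field_simp; ring
  · field_simp; ring
  · field_simp; ring
  · rw [hM2]
    field_simp at e1 e2 ⊢
    linear_combination (-8) * e2
  · rw [hM2]
    field_simp at e1 e2 ⊢
    linear_combination (-12) * e2 - 4 * P * e1

lemma omegaMode_neg_one_one_eq {N : ℤ} (hN : N ≠ 0) (m : ℤ) {q : ℂ} (hq : q = 1 / (2 * N)) :
    omegaMode N m (-1) 1 = C q * X 0 ^ 2 + C (m : ℂ) * X 1 := by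
  rw [hq, omegaMode_neg_one_one hN]

lemma C_two_mul_inv {n q : ℂ} (hn : n ≠ 0) (hq : q = 1 / (2 * n)) :
    (C (1 / n) : Fock) = 2 * C q := by
  rw [show (2 : Fock) = C 2 from (map_ofNat C 2).symm, ← C_mul, hq]
  congr 1
  field_simp

/-- For `P = m² N` outside of `{0, 1/2, 2, 9/2}`, the space `M(1, mα)` has no Virasoro singular
vectors of level at most `4`, so that the modes of `J` on `e^{mα}` are expressed by Virasoro
operators.  The coefficients are found by comparing the coefficients of the monomials. -/
lemma quarticRelations_expPlus {N m : ℤ} (hN : N ≠ 0) (hm : m ≠ 0)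
    (h1 : 2 * ((m : ℂ) ^ 2 * N) - 1 ≠ 0) (h2 : (m : ℂ) ^ 2 * N - 2 ≠ 0)
    (h9 : 2 * ((m : ℂ) ^ 2 * N) - 9 ≠ 0) :
    QuarticRelations (expPlus N m 1) (quarticCoeff N ((m : ℂ) ^ 2 * N)) := by
  have hn : (N : ℂ) ≠ 0 := by exact_mod_cast hN
  have hM : (m : ℂ) ≠ 0 := by exact_mod_cast hm
  obtain ⟨q0, q1, q2, q3, q4, q5⟩ := quad_zero_two_one N m
  obtain ⟨q, hq⟩ : ∃ q : ℂ, q = 1 / (2 * N) := ⟨_, rfl⟩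
  have ht : transl (2 : Fock) = 0 := Derivation.map_natCast _ 2
  have hnq : (2 : ℂ) * N * q = 1 := by rw [hq]; field_simp
  refine ⟨⟨N * m ^ 2 / 2, ?_⟩, fun n => ?_, fun n => ?_, ⟨((N : ℂ) * m) ^ 2, ?_⟩, ⟨N, ?_⟩,
    ?_, ?_, ?_⟩
  · rw [omega_one_mul_expPlus hN, Derivation.map_one_eq_zero, zero_add, map_smul]
  · rw [omega_mul_expPlus, omegaMode, quad_one, creation_mul_coeff_neg _ _ _ (by omega),
      creationPart_coeff_neg _ _ (by push_cast; omega), if_neg (by push_cast; omega)]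
    simp
  · rw [quartic_mul_expPlus, q5 n, map_zero]
  · rw [quartic_mul_expPlus, q0, ← map_smul, smul_eq_C_mul, mul_one]
  · rw [quartic_mul_expPlus, q1, omega_zero_mul_expPlus hN, ← map_smul]
    congr 1
    simp [smul_eq_C_mul, mul_assoc]
  · refine ⟨N / (1 - 2 * (m ^ 2 * N)), -2 * (m ^ 2 * N) * (N / (1 - 2 * (m ^ 2 * N))), ?_⟩
    have h1' : 1 - 2 * ((m : ℂ) ^ 2 * N) ≠ 0 := fun h => h1 (by linear_combination -h)
    obtain ⟨b, hb⟩ : ∃ b : ℂ, b = N / (1 - 2 * (m ^ 2 * N)) := ⟨_, rfl⟩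
    have hb' : b * (1 - 2 * (m ^ 2 * N)) = N := by rw [hb]; exact div_mul_cancel₀ _ h1'
    rw [← hb]
    have E1 : b * (m : ℂ) ^ 2 + (-2 * ((m : ℂ) ^ 2 * N) * b) * q = 0 := by
      linear_combination -(b * (m : ℂ) ^ 2) * hnq
    have E2 : b * (m : ℂ) + (-2 * ((m : ℂ) ^ 2 * N) * b) * m = N * m := by
      linear_combination (m : ℂ) * hb'
    generalize (-2 * ((m : ℂ) ^ 2 * N) * b) = b₂ at *
    have F1 := congrArg (C : ℂ → Fock) E1
    have F2 := congrArg (C : ℂ → Fock) E2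
    simp only [map_add, map_mul, map_pow, map_zero, map_intCast] at F1 F2
    rw [quartic_mul_expPlus, q2]
    simp only [omega_zero_mul_expPlus hN, omega_mul_expPlus, omegaMode_neg_one_one_eq hN m hq,
      ← map_smul, ← map_add]
    congr 1
    simp only [Derivation.map_one_eq_zero, mul_one,
      zero_add, smul_eq_C_mul, map_intCast, map_mul]
    norm_num
    linear_combination (-X 0 ^ 2) * F1 - X 1 * F2
  · have h1' : 1 - 2 * ((m : ℂ) ^ 2 * N) ≠ 0 := fun h => h1 (by linear_combination -h)
    have h2' : 2 - ((m : ℂ) ^ 2 * N) ≠ 0 := fun h => h2 (by linear_combination -h)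
    obtain ⟨b, hb⟩ : ∃ b : ℂ, b = 2 * N / ((1 - 2 * (m ^ 2 * N)) * (2 - m ^ 2 * N)) := ⟨_, rfl⟩
    have hb' : b * ((1 - 2 * (m ^ 2 * N)) * (2 - m ^ 2 * N)) = 2 * N := by
      rw [hb]; exact div_mul_cancel₀ _ (mul_ne_zero h1' h2')
    refine ⟨b, -2 * (m ^ 2 * N) * b, -(1 - 2 * (m ^ 2 * N)) * (m ^ 2 * N) * b, ?_⟩
    have E1 : b * (m : ℂ) ^ 3 + (-2 * ((m : ℂ) ^ 2 * N) * b) * m * q = 0 := by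
      linear_combination -(b * (m : ℂ) ^ 3) * hnq
    have E2 : 3 * b * (m : ℂ) ^ 2 + (-2 * ((m : ℂ) ^ 2 * N) * b) * (2 * q + m ^ 2)
        + (-(1 - 2 * ((m : ℂ) ^ 2 * N)) * (m ^ 2 * N) * b) * (2 * q) = 0 := by
      linear_combination (-2 * b * (m : ℂ) ^ 2 - (1 - 2 * ((m : ℂ) ^ 2 * N)) * m ^ 2 * b) * hnq
    have E3 : 2 * b * (m : ℂ) + (-2 * ((m : ℂ) ^ 2 * N) * b) * 2 * m
        + (-(1 - 2 * ((m : ℂ) ^ 2 * N)) * (m ^ 2 * N) * b) * m = 2 * N * m := by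
      linear_combination (m : ℂ) * hb'
    generalize (-2 * ((m : ℂ) ^ 2 * N) * b) = b₂ at *
    generalize (-(1 - 2 * ((m : ℂ) ^ 2 * N)) * (m ^ 2 * N) * b) = b₃ at *
    have F1 := congrArg (C : ℂ → Fock) E1
    have F2 := congrArg (C : ℂ → Fock) E2
    have F3 := congrArg (C : ℂ → Fock) E3
    simp only [map_add, map_mul, map_pow, map_zero, map_intCast, map_ofNat] at F1 F2 F3
    rw [quartic_mul_expPlus, q3]
    simp only [omega_zero_mul_expPlus hN, omega_mul_expPlus, omegaMode_neg_one_one_eq hN m hq,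
      omegaMode_neg_two_one hN, C_two_mul_inv hn hq, ← map_smul, ← map_add]
    congr 1
    simp only [Derivation.map_one_eq_zero, map_add, transl_X, mul_one,
      zero_add, smul_eq_C_mul, map_intCast, map_mul, Derivation.leibniz, Derivation.leibniz_pow,
      derivation_C, smul_eq_mul, map_ofNat, Derivation.map_intCast]
    norm_num [map_ofNat, smul_eq_C_mul]
    linear_combination (-X 0 ^ 3) * F1 - X 0 * X 1 * F2 - X 2 * F3
  · obtain ⟨A₂, A₃, A₄, A₅, E1, E2, E3, E4, E5⟩ := quarticCoeff_system rfl hn hM h1 h2 h9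
    refine ⟨A₂, A₃, A₄, A₅, ?_⟩
    rw [← quarticCoeff, ← hq] at E1 E2 E3 E4
    rw [← quarticCoeff] at E5
    generalize quarticCoeff N (m ^ 2 * N) = A₁ at *
    have F1 := congrArg (C : ℂ → Fock) E1
    have F2 := congrArg (C : ℂ → Fock) E2
    have F3 := congrArg (C : ℂ → Fock) E3
    have F4 := congrArg (C : ℂ → Fock) E4
    have F5 := congrArg (C : ℂ → Fock) E5
    simp only [map_add, map_mul, map_pow, map_zero, map_one, map_intCast, map_ofNat]
      at F1 F2 F3 F4 F5
    rw [quartic_mul_expPlus, q4]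
    simp only [omega_zero_mul_expPlus hN, omega_mul_expPlus, omegaMode_neg_one_one_eq hN m hq,
      omegaMode_neg_two_one hN, omegaMode_neg_three_one hN, ← hq, omegaMode_neg_one_quadratic hN,
      C_two_mul_inv hn hq, ← map_smul, ← map_add]
    congr 1
    simp only [Derivation.map_one_eq_zero, map_add, transl_X, mul_one,
      zero_add, smul_eq_C_mul, map_intCast, map_mul, Derivation.leibniz, Derivation.leibniz_pow,
      derivation_C, smul_eq_mul, map_ofNat, Derivation.map_intCast, ht]
    norm_num [map_ofNat, smul_eq_C_mul, ht]
    linear_combination (-X 0 ^ 4) * F1 - X 0 ^ 2 * X 1 * F2 - X 1 ^ 2 * F3 - X 0 * X 2 * F4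
      - X 3 * (m : Fock) * F5

/-! ### The Jacobi identity on weak modules and annihilators of vectors -/

namespace WeakModule

variable {N : ℤ} {P : VertexSubalgebra N} {M : Type*} [AddCommGroup M] [Module ℂ M]

lemma exists_act_eq_zero (𝓜 : WeakModule P M) (a : P) (u : M) :
    ∃ T : ℕ, ∀ n : ℤ, T ≤ n → 𝓜.act a n u = 0 := by
  refine ⟨(-((HahnModule.of ℂ).symm (𝓜.Y a u)).order).toNat, fun n hn => ?_⟩
  exact VertexOperator.ncoeff_eq_zero_of_lt_order _ _ _ (by omega)

lemma act_one (𝓜 : WeakModule P M) (n : ℤ) (u : M) :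
    𝓜.act P.one n u = if n = -1 then u else 0 := by
  rw [act, VertexOperator.ncoeff_apply, HVertexOperator.coeff_apply_apply, 𝓜.vacuum]
  simp only [Equiv.symm_apply_apply]
  change (HahnSeries.single 0 u).coeff (-n - 1) = _
  rw [HahnSeries.coeff_single]
  by_cases h : n = -1
  · rw [if_pos h, if_pos (by omega)]
  · rw [if_neg h, if_neg (by omega)]

lemma act_add_vec (𝓜 : WeakModule P M) (a b : P) (n : ℤ) :
    𝓜.act (a + b) n = 𝓜.act a n + 𝓜.act b n := by
  simp [act]

lemma act_smul_vec (𝓜 : WeakModule P M) (c : ℂ) (a : P) (n : ℤ) :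
    𝓜.act (c • a) n = c • 𝓜.act a n := by
  simp [act]

lemma act_zero_vec (𝓜 : WeakModule P M) (n : ℤ) : 𝓜.act 0 n = 0 := by
  simp [act]

/-- The commutator formula. -/
lemma act_commutator (𝓜 : WeakModule P M) {a b : P} {T : ℕ}
    (hT : ∀ i : ℕ, T ≤ i → P.mul a i b = 0) (m n : ℤ) (u : M) :
    𝓜.act a m (𝓜.act b n u) - 𝓜.act b n (𝓜.act a m u)
      = ∑ i ∈ Finset.range T, Ring.choose m i • 𝓜.act (P.mul a i b) (m + n - i) u := by
  have h := 𝓜.jacobi a b u 0 m n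
  rw [finsum_eq_sum_of_support_subset (s := Finset.range T), finsum_eq_single _ 0] at h
  · simp only [zero_add] at h
    rw [show (∑ i ∈ Finset.range T, Ring.choose m i • 𝓜.act (P.mul a i b) (m + n - i) u) = _ from h]
    simp [act]
  · intro i hi
    rw [Ring.choose_zero_pos _ (Nat.pos_of_ne_zero hi), mul_zero, zero_smul]
  · intro i hi
    by_contra hi'
    simp only [Finset.coe_range, Set.mem_Iio, not_lt] at hi'
    apply hi
    simp only [zero_add]
    rw [hT i hi']
    simp

/-- The iterate formula. -/
lemma act_mul (𝓜 : WeakModule P M) (a b : P) {T : ℕ} (l n : ℤ) (u : M)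
    (hb : ∀ i : ℕ, T ≤ i → 𝓜.act b (n + i) u = 0) (ha : ∀ i : ℕ, T ≤ i → 𝓜.act a i u = 0) :
    𝓜.act (P.mul a l b) n u = ∑ i ∈ Finset.range T, ((-1) ^ i * Ring.choose l i : ℤ) •
      (𝓜.act a (l - i) (𝓜.act b (n + i) u)
        - (l.negOnePow : ℤ) • 𝓜.act b (l + n - i) (𝓜.act a i u)) := by
  have h := 𝓜.jacobi a b u l 0 n
  rw [finsum_eq_single _ 0, finsum_eq_sum_of_support_subset (s := Finset.range T)] at h
  · simp only [zero_add, add_zero, Nat.cast_zero, sub_zero, Ring.choose_zero_right, one_smul] at h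
    exact h
  · intro i hi
    by_contra hi'
    simp only [Finset.coe_range, Set.mem_Iio, not_lt] at hi'
    apply hi
    change _ • (𝓜.act a _ (𝓜.act b (n + i) u) - _ • 𝓜.act b _ (𝓜.act a (0 + i) u)) = 0
    rw [zero_add, hb i hi', ha i hi']
    simp
  · intro i hi
    rw [Ring.choose_zero_pos _ (Nat.pos_of_ne_zero hi), zero_smul]

/-- The iterate formula for `l = -1`, the normally ordered product. -/
lemma act_mul_neg_one (𝓜 : WeakModule P M) (a b : P) {T : ℕ} (n : ℤ) (u : M)
    (hb : ∀ i : ℕ, T ≤ i → 𝓜.act b (n + i) u = 0) (ha : ∀ i : ℕ, T ≤ i → 𝓜.act a i u = 0) :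
    𝓜.act (P.mul a (-1) b) n u = ∑ i ∈ Finset.range T,
      (𝓜.act a (-1 - i) (𝓜.act b (n + i) u) + 𝓜.act b (n - 1 - i) (𝓜.act a i u)) := by
  rw [𝓜.act_mul a b (-1) n u hb ha]
  refine Finset.sum_congr rfl fun i _ => ?_
  have h : ((-1) ^ i * Ring.choose (-1 : ℤ) i : ℤ) = 1 := by
    rw [Ring.choose_neg, show (1 : ℤ) + i - 1 = (i : ℤ) by ring, Ring.choose_natCast,
      Int.negOnePow_def, Units.smul_def]
    simp [← mul_pow]
  rw [h, one_smul, show (-1 : ℤ) + n - i = n - 1 - i by ring]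
  simp

lemma exists_bound (𝓜 : WeakModule P M) (a b : P) (n : ℤ) (u : M) : ∃ T : ℕ,
    (∀ i : ℕ, T ≤ i → 𝓜.act b (n + i) u = 0) ∧ (∀ i : ℕ, T ≤ i → 𝓜.act a i u = 0) := by
  obtain ⟨T₁, h₁⟩ := 𝓜.exists_act_eq_zero b u
  obtain ⟨T₂, h₂⟩ := 𝓜.exists_act_eq_zero a u
  refine ⟨T₁ + T₂ + n.natAbs, fun i hi => h₁ _ (by omega), fun i hi => h₂ _ (by omega)⟩

/-- The field of `b_{-2} 𝟏` is the derivative of the field of `b`. -/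
lemma act_translation (𝓜 : WeakModule P M) (b : P) (n : ℤ) (u : M) :
    𝓜.act (P.mul b (-2) P.one) n u = -n • 𝓜.act b (n - 1) u := by
  obtain ⟨T, h1, h2⟩ := 𝓜.exists_bound b P.one n u
  have hT : T ≤ T + n.natAbs + 1 := by omega
  rw [𝓜.act_mul b P.one (T := T + n.natAbs + 1) (-2) n u (fun i hi => h1 i (hT.trans hi))
    (fun i hi => h2 i (hT.trans hi))]
  have hc : ∀ i : ℕ, ((-1) ^ i * Ring.choose (-2 : ℤ) i : ℤ) = i + 1 := by
    intro i
    rw [Ring.choose_neg, show (2 : ℤ) + i - 1 = ((i + 1 : ℕ) : ℤ) by push_cast; ring,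
      Ring.choose_natCast, Int.negOnePow_def, Units.smul_def, Nat.choose_succ_self_right]
    simp [← mul_assoc, ← mul_pow]
  simp only [hc, act_one]
  rcases lt_trichotomy n 0 with hn | hn | hn
  · rw [Finset.sum_eq_single (-1 - n).toNat]
    · rw [if_pos (by omega), if_neg (by omega), smul_zero, sub_zero,
        show ((-1 - n).toNat : ℤ) = -1 - n by omega]
      congr 2
      · omega
      · congr 1; omega
    · intro i _ hi
      rw [if_neg (by omega), if_neg (by omega)]
      simp
    · intro h
      exact absurd (Finset.mem_range.2 (by omega)) h
  · subst hn
    rw [neg_zero, zero_smul]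
    refine Finset.sum_eq_zero fun i _ => ?_
    rw [if_neg (by omega), if_neg (by omega)]
    simp
  · rw [Finset.sum_eq_single (n - 1).toNat]
    · rw [if_neg (by omega), if_pos (by omega), map_zero, zero_sub,
        show ((n - 1).toNat : ℤ) = n - 1 by omega]
      have : ((-2 : ℤ).negOnePow : ℤ) = 1 := by
        rw [Int.negOnePow_even _ (by decide)]; rfl
      rw [this, one_smul, smul_neg, neg_smul]
      congr 2
      omega
    · intro i _ hi
      rw [if_neg (by omega), if_neg (by omega)]
      simp
    · intro h
      exact absurd (Finset.mem_range.2 (by omega)) h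

/-- The annihilator of `u`: the vectors `b` with `Y(b, x) u = 0`. -/
def ann (𝓜 : WeakModule P M) (u : M) : Submodule ℂ P where
  carrier := {b | ∀ n : ℤ, 𝓜.act b n u = 0}
  zero_mem' n := by rw [act_zero_vec]; rfl
  add_mem' ha hb n := by rw [act_add_vec, LinearMap.add_apply, ha, hb, add_zero]
  smul_mem' c a ha n := by rw [act_smul_vec, LinearMap.smul_apply, ha, smul_zero]

end WeakModule

lemma VertexSubalgebra.exists_mul_eq_zero {N : ℤ} {P : VertexSubalgebra N} (a b : P) :
    ∃ T : ℕ, ∀ n : ℤ, T ≤ n → P.mul a n b = 0 := by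
  refine ⟨(-((HahnModule.of ℂ).symm (vertexMap N (P.val a) (P.val b))).order).toNat,
    fun n hn => ?_⟩
  apply VertexSubalgebra.val_injective
  rw [VertexSubalgebra.val_mul, map_zero]
  exact VertexOperator.ncoeff_eq_zero_of_lt_order _ _ _ (by omega)

namespace WeakModule

variable {N : ℤ} {P : VertexSubalgebra N} {M : Type*} [AddCommGroup M] [Module ℂ M]

/-- If `Y(b, x) u = 0` then `Y(b, x) Y(a, y) u = 0`, by locality. -/
lemma act_act_eq_zero (𝓜 : WeakModule P M) {b : P} {u : M} (hb : b ∈ 𝓜.ann u) (a : P) (k m : ℤ) :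
    𝓜.act b k (𝓜.act a m u) = 0 := by
  obtain ⟨T, hT⟩ := 𝓜.exists_act_eq_zero a u
  obtain ⟨L, hL⟩ := VertexSubalgebra.exists_mul_eq_zero a b
  -- descending induction on `m`
  have key : ∀ d : ℕ, ∀ m : ℤ, (T : ℤ) - d ≤ m → ∀ k, 𝓜.act b k (𝓜.act a m u) = 0 := by
    intro d
    induction d with
    | zero =>
      intro m hm k
      rw [hT m (by simpa using hm), map_zero]
    | succ d ih =>
      intro m hm k
      have h := 𝓜.jacobi a b u L m (k - L)
      rw [finsum_eq_zero_of_forall_eq_zero, finsum_eq_single _ 0] at h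
      · simp only [pow_zero, Ring.choose_zero_right, one_mul, one_smul, Nat.cast_zero, sub_zero,
          add_zero] at h
        change 0 = 𝓜.act a _ (𝓜.act b _ u) - _ • 𝓜.act b (L + (k - L)) (𝓜.act a m u) at h
        rw [hb, map_zero, zero_sub, show (L : ℤ) + (k - L) = k by ring, zero_eq_neg] at h
        rcases Int.isUnit_iff.1 (Units.isUnit ((L : ℤ).negOnePow)) with h1 | h1
        · rwa [h1, one_smul] at h
        · rwa [h1, neg_smul, one_smul, neg_eq_zero] at h
      · intro i hi
        change _ • (𝓜.act a _ (𝓜.act b _ u) - _ • 𝓜.act b _ (𝓜.act a (m + i) u)) = 0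
        rw [hb, ih (m + i) (by omega)]
        simp
      · intro i
        rw [hL _ (by omega)]
        simp
  exact key ((T : ℤ) - m).toNat m (by omega) k

/-- The annihilator of a vector is a two-sided ideal. -/
lemma mul_mem_ann (𝓜 : WeakModule P M) {b : P} {u : M} (hb : b ∈ 𝓜.ann u) (a : P) (l : ℤ) :
    P.mul a l b ∈ 𝓜.ann u ∧ P.mul b l a ∈ 𝓜.ann u := by
  constructor <;> intro n
  · obtain ⟨T, h1, h2⟩ := 𝓜.exists_bound a b n u
    rw [𝓜.act_mul a b l n u h1 h2]
    refine Finset.sum_eq_zero fun i _ => ?_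
    rw [𝓜.act_act_eq_zero hb, hb]
    simp
  · obtain ⟨T, h1, h2⟩ := 𝓜.exists_bound b a n u
    rw [𝓜.act_mul b a l n u h1 h2]
    refine Finset.sum_eq_zero fun i _ => ?_
    rw [𝓜.act_act_eq_zero hb, hb]
    simp

lemma eq_zero_of_one_mem_ann (𝓜 : WeakModule P M) {u : M} (h : P.one ∈ 𝓜.ann u) : u = 0 := by
  have := h (-1)
  rwa [act_one, if_pos rfl] at this

end WeakModule

/-! ### The fields of `e^{mα} + e^{-mα}` are injective -/

lemma isHomogeneous_creationPart_coeff (k : ℕ) (e : ℤ) :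
    ((creationPart k).coeff e).IsHomogeneous 1 := by
  rcases lt_or_ge e 0 with he | he
  · rw [creationPart_coeff_neg k e he]
    exact isHomogeneous_zero _ _ _
  · obtain ⟨e, rfl⟩ := Int.eq_ofNat_of_zero_le he
    rw [creationPart_coeff_nat, ← map_natCast (C : ℂ →+* Fock)]
    exact (isHomogeneous_X _ _).C_mul _

lemma annCoeff_eq_C (r i : ℕ) : annCoeff r i = C ((Ring.choose (-(r : ℤ) - 1) i : ℤ) : ℂ) := by
  rw [annCoeff, map_intCast]

lemma totalDegree_heis_le (N p : ℤ) (r : ℕ) {g : Fock} {n : ℕ} (hg : g.IsHomogeneous n) :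
    (heis N p r g).totalDegree ≤ n := by
  cases r with
  | zero =>
    rw [heis_zero]
    exact (totalDegree_smul_le _ _).trans hg.totalDegree_le
  | succ r =>
    rw [heis_succ]
    exact (totalDegree_smul_le _ _).trans (hg.pderiv.totalDegree_le.trans (by omega))

/-- On `M(1, pα)`, the operator `(α(-i-1) α(-j-1))_{-1}` is the multiplication by
`α(-i-1) α(-j-1)`, up to terms which raise the degree by at most `1`. -/
lemma totalDegree_quad_sub_le (N p : ℤ) (i j : ℕ) {g : Fock} {n : ℕ} (hg : g.IsHomogeneous n) :
    (quad N p i j 0 g - X i * X j * g).totalDegree ≤ n + 1 := by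
  obtain ⟨R, hR⟩ := heis_finite_bound N p g
  rw [quad_eq hR, creation_mul_coeff_zero, Finset.sum_eq_zero (f := fun r => ∑ s ∈ _, _), add_zero,
    add_sub_cancel_left]
  · refine totalDegree_finsetSum_le fun r _ => ?_
    refine (totalDegree_mul _ _).trans ?_
    have h1 := totalDegree_heis_le N p r hg
    have h2 : (annCoeff r j * (creationPart i).coeff (0 + r + 1 + j)
          + annCoeff r i * (creationPart j).coeff (0 + r + 1 + i) : Fock).totalDegree ≤ 1 := by
      rw [annCoeff_eq_C, annCoeff_eq_C]
      exact (((isHomogeneous_creationPart_coeff _ _).C_mul _).add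
        ((isHomogeneous_creationPart_coeff _ _).C_mul _)).totalDegree_le
    omega
  · intro r _
    exact Finset.sum_eq_zero fun s _ => if_neg (by omega)

lemma exists_single_add_of_degree (s : ℕ →₀ ℕ) {d : ℕ} (hs : s.degree = d + 1) :
    ∃ (i : ℕ) (t : ℕ →₀ ℕ), t.degree = d ∧ s = Finsupp.single i 1 + t := by
  obtain ⟨i, hi⟩ : ∃ i, s i ≠ 0 := by
    by_contra h
    push Not at h
    rw [show s = 0 from Finsupp.ext h, map_zero] at hs
    omega
  have h : Finsupp.single i 1 + (s - Finsupp.single i 1) = s := by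
    rw [add_comm]
    exact tsub_add_cancel_of_le (Finsupp.single_le_iff.2 (Nat.one_le_iff_ne_zero.2 hi))
  refine ⟨i, s - Finsupp.single i 1, ?_, h.symm⟩
  have h' := congrArg Finsupp.degree h
  rw [map_add, Finsupp.degree_single] at h'
  omega

lemma monomial_eq_mul_of_degree (s : ℕ →₀ ℕ) {d : ℕ} (hs : s.degree = d + 2) :
    ∃ (i j : ℕ) (t : ℕ →₀ ℕ), i ≤ j ∧ t.degree = d ∧
      (monomial s 1 : Fock) = X i * X j * monomial t 1 := by
  obtain ⟨i, t, ht, rfl⟩ := exists_single_add_of_degree s hs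
  obtain ⟨j, t', ht', rfl⟩ := exists_single_add_of_degree t ht
  rcases le_total i j with h | h
  · refine ⟨i, j, t', h, ht', ?_⟩
    simp [X, monomial_mul, add_assoc]
  · refine ⟨j, i, t', h, ht', ?_⟩
    simp [X, monomial_mul, add_left_comm, add_assoc]

/-- For `p ≠ 0`, the space `M(1, pα)` is generated from `e^{pα}` by the modes of the quadratic
vectors. -/
lemma eq_top_of_quad_mem {N p : ℤ} (hN : N ≠ 0) (hp : p ≠ 0) (S : Submodule ℂ Fock) (h1 : 1 ∈ S)
    (hS : ∀ i j : ℕ, i ≤ j → ∀ (e : ℤ), ∀ f ∈ S, quad N p i j e f ∈ S) : S = ⊤ := by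
  have hmono : ∀ d : ℕ, (∀ s : ℕ →₀ ℕ, s.degree ≤ d → (monomial s 1 : Fock) ∈ S) →
      ∀ f : Fock, f.totalDegree ≤ d → f ∈ S := by
    intro d hd f hf
    rw [f.as_sum]
    refine Submodule.sum_mem _ fun s hs => ?_
    rw [← mul_one (coeff s f), ← smul_eq_mul, ← smul_monomial]
    exact S.smul_mem _ (hd s ((le_totalDegree hs).trans hf))
  have key : ∀ d : ℕ, ∀ s : ℕ →₀ ℕ, s.degree ≤ d → (monomial s 1 : Fock) ∈ S := by
    intro d
    induction d with
    | zero =>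
      intro s hs
      rw [(Finsupp.degree_eq_zero_iff s).1 (by omega)]
      exact h1
    | succ d ih =>
      intro s hs
      rcases Nat.lt_or_ge s.degree (d + 1) with h | h
      · exact ih s (by omega)
      have hs' : s.degree = d + 1 := by omega
      cases d with
      | zero =>
        obtain ⟨k, rfl⟩ : ∃ k, s = Finsupp.single k 1 := by
          obtain ⟨k, t, ht, rfl⟩ := exists_single_add_of_degree s hs'
          exact ⟨k, by rw [(Finsupp.degree_eq_zero_iff t).1 ht, add_zero]⟩
        -- the quadratic vector `α(-1) α(-k-2)` has a mode which sends `1` to a multiple of `X k`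
        have h := hS 0 (k + 1) (by omega) (-2) 1 h1
        rw [quad_one, creation_mul_coeff_neg _ _ _ (by norm_num), if_neg (by push_cast; omega),
          show (-2 + 1 + ((k + 1 : ℕ) : ℤ)) = (k : ℤ) by push_cast; ring,
          creationPart_coeff_nat, creationPart_coeff_neg _ _ (by norm_num)] at h
        have hne : (-1) ^ (k + 1) * ((N : ℂ) * p) ≠ 0 := by
          have hN' : (N : ℂ) ≠ 0 := by exact_mod_cast hN
          have hp' : (p : ℂ) ≠ 0 := by exact_mod_cast hp
          exact mul_ne_zero (pow_ne_zero _ (by norm_num)) (mul_ne_zero hN' hp')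
        refine (S.smul_mem_iff hne).1 ?_
        convert h using 1
        rw [smul_eq_C_mul]
        simp [X]
        ring
      | succ d =>
        obtain ⟨i, j, t, hij, ht, hst⟩ := monomial_eq_mul_of_degree s hs'
        have h2 := hS i j hij 0 _ (ih t (by omega))
        have h3 := hmono _ ih _ (totalDegree_quad_sub_le N p i j (isHomogeneous_monomial 1 ht))
        rw [hst]
        have h4 := S.sub_mem h2 h3
        rwa [sub_sub_cancel] at h4
  refine eq_top_iff.2 fun f _ => hmono f.totalDegree (key _) f le_rfl

lemma prod_exp_exp (N m p n : ℤ) : prod N (Finsupp.single m 1) n (Finsupp.single p 1)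
    = Finsupp.single (m + p) ((HahnSeries.ofPowerSeries ℤ Fock (expCreation m)).coeff
        (-n - 1 - m * p * N)) := by
  have h : (1 : Fock) = monomial 0 1 := rfl
  rw [show (Finsupp.single m (1 : Fock)) = Finsupp.single m (monomial 0 1) from rfl,
    prod_monomial_single]
  congr 1
  simp [field, expField]
  rw [HahnSeries.coeff_single_mul, one_mul]

lemma expCreation_coeff_neg (m e : ℤ) (he : e < 0) :
    (HahnSeries.ofPowerSeries ℤ Fock (expCreation m)).coeff e = 0 := by
  rw [PowerSeries.coeff_coe, if_pos he]

lemma expPlus_mul_expPlus (N m n : ℤ) :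
    (VLPlus N).mul (expPlus N m 1) n (expPlus N m 1)
      = expPlus N (2 * m) ((HahnSeries.ofPowerSeries ℤ Fock (expCreation m)).coeff
          (-n - 1 - m ^ 2 * N))
        + expPlus N 0 ((HahnSeries.ofPowerSeries ℤ Fock (expCreation m)).coeff
          (-n - 1 + m ^ 2 * N)) := by
  apply VertexSubalgebra.val_injective
  rw [VertexSubalgebra.val_mul, map_add]
  simp only [val_expPlus]
  rw [prod_add_left, ← theta_theta (Finsupp.single m 1 + theta (Finsupp.single m 1))]
  have h : theta (Finsupp.single m 1 + theta (Finsupp.single m 1) : Space)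
      = Finsupp.single m 1 + theta (Finsupp.single m 1) := by
    rw [map_add, theta_theta, add_comm]
  have h1 : prod N (theta (Finsupp.single m 1)) n (theta (theta (Finsupp.single m 1
      + theta (Finsupp.single m 1)))) = theta (prod N (Finsupp.single m 1) n (Finsupp.single m 1
      + theta (Finsupp.single m 1))) := by
    rw [h, theta_prod]
  have h2 : prod N (Finsupp.single m 1) n (Finsupp.single m 1 + theta (Finsupp.single m 1))
      = Finsupp.single (2 * m) ((HahnSeries.ofPowerSeries ℤ Fock (expCreation m)).coeff
          (-n - 1 - m ^ 2 * N))
        + Finsupp.single 0 ((HahnSeries.ofPowerSeries ℤ Fock (expCreation m)).coeff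
          (-n - 1 + m ^ 2 * N)) := by
    rw [theta_single, map_one, prod_add_right, prod_exp_exp, prod_exp_exp]
    congr 2
    · ring
    · congr 1; ring
    · ring
    · congr 1; ring
  rw [h1, theta_theta, h2, map_add]
  abel

lemma expPlus_zero_one (N : ℤ) : expPlus N 0 1 = (2 : ℂ) • (VLPlus N).one := by
  apply VertexSubalgebra.val_injective
  rw [map_smul, val_expPlus, theta_single, map_one, neg_zero, two_smul]
  rfl

lemma quadVec_mem_VLPlus (N : ℤ) (i j : ℕ) : quadVec i j ∈ (VLPlus N).toSubmodule := by
  rw [mem_VLPlus, quadVec, theta_single, fockTheta_quadratic, neg_zero]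

/-- The vector `α(-i-1) α(-j-1) 𝟏` of `V_L^+`. -/
def quadPlus (N : ℤ) (i j : ℕ) : VLPlus N := ⟨quadVec i j, quadVec_mem_VLPlus N i j⟩

lemma quadPlus_mul_expPlus (N m n : ℤ) {i j : ℕ} (hij : i ≤ j) (g : Fock) :
    (VLPlus N).mul (quadPlus N i j) n (expPlus N m g)
      = expPlus N m (quad N m i j (-n - 1) g) :=
  mul_expPlus _ (quadVec_prod N m n hij g)

/-- The ideal of `V_L^+` generated by `e^{mα} + e^{-mα}` contains the vacuum vector, so that the
field of `e^{mα} + e^{-mα}` does not annihilate any non-zero vector of a weak module. -/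
theorem WeakModule.exists_expPlus_act_ne_zero {N m : ℤ} (hN : N ≠ 0) (hm : m ≠ 0) {M : Type*}
    [AddCommGroup M] [Module ℂ M] (𝓜 : WeakModule (VLPlus N) M) {u : M} (hu : u ≠ 0) :
    ∃ n : ℤ, 𝓜.act (expPlus N m 1) n u ≠ 0 := by
  by_contra! hann
  have hE : expPlus N m 1 ∈ 𝓜.ann u := hann
  have hprod := fun n : ℤ => (𝓜.mul_mem_ann hE (expPlus N m 1) n).1
  simp only [expPlus_mul_expPlus] at hprod
  have hm2 : 0 < m ^ 2 := by positivity
  have h0 : (HahnSeries.ofPowerSeries ℤ Fock (expCreation m)).coeff 0 = 1 := by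
    rw [PowerSeries.coeff_coe, if_neg (by norm_num)]
    exact expCreation_coeff_zero m
  apply hu
  apply 𝓜.eq_zero_of_one_mem_ann
  rw [← (𝓜.ann u).smul_mem_iff (two_ne_zero (α := ℂ)), ← expPlus_zero_one]
  -- for `N < 0`, the product of `e^{mα}` with `e^{mα}` has the higher order pole, and the
  -- annihilator contains `M(1, 2mα)^+`, which is then subtracted from the product of index
  -- `m² N - 1`
  rcases lt_or_gt_of_ne hN with hneg | hpos
  · have hlt : m ^ 2 * N < 0 := mul_neg_of_pos_of_neg hm2 hneg
    have h1 := hprod (-(m ^ 2 * N) - 1)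
    rw [show -(-(m ^ 2 * N) - 1) - 1 - m ^ 2 * N = 0 by ring,
      show -(-(m ^ 2 * N) - 1) - 1 + m ^ 2 * N = 2 * (m ^ 2 * N) by ring, h0,
      expCreation_coeff_neg m (2 * (m ^ 2 * N)) (by omega), map_zero, add_zero] at h1
    have htop : (𝓜.ann u).comap (expPlus N (2 * m)) = ⊤ := by
      refine eq_top_of_quad_mem hN (mul_ne_zero two_ne_zero hm) _ h1 fun i j hij e f hf => ?_
      have h := (𝓜.mul_mem_ann hf (quadPlus N i j) (-e - 1)).1
      rwa [quadPlus_mul_expPlus N _ _ hij, show -(-e - 1) - 1 = e by ring] at h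
    have h2 := hprod (m ^ 2 * N - 1)
    rw [show -(m ^ 2 * N - 1) - 1 + m ^ 2 * N = 0 by ring, h0] at h2
    have h3 : expPlus N (2 * m) ((HahnSeries.ofPowerSeries ℤ Fock (expCreation m)).coeff
        (-(m ^ 2 * N - 1) - 1 - m ^ 2 * N)) ∈ 𝓜.ann u := by
      rw [← Submodule.mem_comap, htop]
      trivial
    exact ((𝓜.ann u).add_mem_iff_right h3).1 h2
  · have hlt : 0 < m ^ 2 * N := mul_pos hm2 hpos
    have h1 := hprod (m ^ 2 * N - 1)
    rwa [show -(m ^ 2 * N - 1) - 1 + m ^ 2 * N = 0 by ring,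
      show -(m ^ 2 * N - 1) - 1 - m ^ 2 * N = -2 * (m ^ 2 * N) by ring, h0,
      expCreation_coeff_neg m (-2 * (m ^ 2 * N)) (by omega), map_zero, zero_add] at h1

/-! ### Commutators of the modes of the generators of `M(1)^+` -/

lemma val_omegaM1Plus (N : ℤ) : (M1Plus N).val (omegaM1Plus N) = omega N := rfl

lemma val_one {N : ℤ} (P : VertexSubalgebra N) : P.val P.one = vac := rfl

lemma omega_eq_single (N : ℤ) :
    omega N = Finsupp.single 0 ((1 / (2 * (N : ℂ))) • (X 0 * X 0 : Fock)) := by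
  rw [omega_eq, quadVec, Finsupp.smul_single]

lemma omega_prod_single_zero (N n : ℤ) (f : Fock) :
    prod N (omega N) n (Finsupp.single 0 f)
      = Finsupp.single 0 ((1 / (2 * (N : ℂ))) • quad N 0 0 0 (-n - 1) f) := omega_prod N 0 n f

lemma vars_X_mul_X (i j : ℕ) : (X i * X j : Fock).vars ⊆ Finset.range (i + j + 1) := by
  refine (vars_mul _ _).trans (Finset.union_subset ?_ ?_) <;>
  · rw [vars_X]
    intro k hk
    rw [Finset.mem_singleton] at hk
    rw [Finset.mem_range]
    omega

lemma smul_C_mul_fock (a b : ℂ) (f : Fock) : a • (C b * f) = C (a * b) * f := by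
  rw [smul_eq_C_mul, C_mul, mul_assoc]

/-- The modes `ω_n ω`, `n ≥ 2`. -/
lemma quad_omega (N : ℤ) : quad N 0 0 0 (-3) (X 0 * X 0) = 0 ∧
    quad N 0 0 0 (-4) (X 0 * X 0) = C (2 * (N : ℂ) ^ 2) ∧
    ∀ n : ℕ, quad N 0 0 0 (-(n : ℤ) - 5) (X 0 * X 0) = 0 := by
  refine ⟨?_, ?_, fun n => ?_⟩ <;>
  · rw [quad_eq (heis_eq_zero_of_vars (vars_X_mul_X 0 0)),
      creation_mul_coeff_neg _ _ _ (by omega)]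
    simp only [Finset.sum_range_succ, Finset.sum_range_zero, heis_zero, heis_succ, annCoeff_eq]
    simp [creationPart_coeff_neg, pderiv_X]
    try simp [creationPart_coeff_neg 0 (-(n : ℤ) - 5 + 1 + 1) (by omega),
      show -(n : ℤ) - 5 + 1 + 1 + 2 ≠ 0 by omega]
    try simp [smul_eq_C_mul, map_ofNat]
    try ring

/-- The modes `ω_n J`, `n ≥ 2`. -/
lemma quad_quartic (N : ℤ) : quad N 0 0 0 (-3) (X 0 * X 2) = C (6 * (N : ℂ)) * (X 0 * X 1) ∧
    quad N 0 0 0 (-4) (X 0 * X 2) = C (6 * (N : ℂ)) * (X 0 * X 0) ∧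
    quad N 0 0 0 (-5) (X 0 * X 2) = 0 ∧
    quad N 0 0 0 (-6) (X 0 * X 2) = C (6 * (N : ℂ) ^ 2) ∧
    ∀ n : ℕ, quad N 0 0 0 (-(n : ℤ) - 7) (X 0 * X 2) = 0 := by
  refine ⟨?_, ?_, ?_, ?_, fun n => ?_⟩ <;>
  · rw [quad_eq (heis_eq_zero_of_vars (vars_X_mul_X 0 2)),
      creation_mul_coeff_neg _ _ _ (by omega)]
    simp only [Finset.sum_range_succ, Finset.sum_range_zero, heis_zero, heis_succ, annCoeff_eq]
    simp [creationPart_coeff_neg, pderiv_X, creationPart_coeff_zero, creationPart_coeff_one]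
    try simp [creationPart_coeff_neg 0 (-(n : ℤ) - 7 + 1 + 1) (by omega),
      creationPart_coeff_neg 0 (-(n : ℤ) - 7 + 3 + 1) (by omega),
      show -(n : ℤ) - 7 + 1 + 3 + 2 ≠ 0 by omega, show -(n : ℤ) - 7 + 3 + 1 + 2 ≠ 0 by omega]
    try simp [smul_eq_C_mul, map_ofNat]
    try ring

lemma omega_mul_omega {N : ℤ} (hN : N ≠ 0) :
    (M1Plus N).mul (omegaM1Plus N) 1 (omegaM1Plus N) = (2 : ℂ) • omegaM1Plus N ∧
    (M1Plus N).mul (omegaM1Plus N) 2 (omegaM1Plus N) = 0 ∧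
    (∃ c : ℂ, (M1Plus N).mul (omegaM1Plus N) 3 (omegaM1Plus N) = c • (M1Plus N).one) ∧
    ∀ n : ℕ, (M1Plus N).mul (omegaM1Plus N) (n + 4) (omegaM1Plus N) = 0 := by
  obtain ⟨q2, q3, q4⟩ := quad_omega N
  have hs : ∀ n : ℤ, (M1Plus N).val ((M1Plus N).mul (omegaM1Plus N) n (omegaM1Plus N))
      = Finsupp.single 0 ((1 / (2 * (N : ℂ))) • quad N 0 0 0 (-n - 1)
          ((1 / (2 * (N : ℂ))) • (X 0 * X 0))) := by
    intro n
    rw [VertexSubalgebra.val_mul, val_omegaM1Plus, ← omega_prod_single_zero, ← omega_eq_single]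
  refine ⟨?_, ?_, ⟨(1 / (2 * (N : ℂ))) ^ 2 * (2 * N ^ 2), ?_⟩, fun n => ?_⟩ <;>
    apply VertexSubalgebra.val_injective
  · have h := omega_prod_one hN 0 ((1 / (2 * (N : ℂ))) • (X 0 * X 0))
    rw [← omega_eq_single] at h
    rw [VertexSubalgebra.val_mul, map_smul, val_omegaM1Plus, h, omega_eq_single,
      Finsupp.smul_single]
    congr 1
    simp [smul_eq_C_mul, map_ofNat]
    ring
  · rw [hs, quad_smul, show -(2 : ℤ) - 1 = -3 by norm_num, q2]
    simp
  · rw [hs, quad_smul, show -(3 : ℤ) - 1 = -4 by norm_num, q3, map_smul, val_one, vac, expVec,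
      Finsupp.smul_single]
    congr 1
    simp [smul_eq_C_mul]
    ring
  · rw [hs, quad_smul, show -((n : ℤ) + 4) - 1 = -(n : ℤ) - 5 by ring, q4]
    simp

lemma val_quartic (N : ℤ) : (M1Plus N).val (quartic N) = Finsupp.single 0 (X 0 * X 2) := rfl

lemma omega_mul_quartic {N : ℤ} (hN : N ≠ 0) :
    (M1Plus N).mul (omegaM1Plus N) 1 (quartic N) = (4 : ℂ) • quartic N ∧
    (M1Plus N).mul (omegaM1Plus N) 2 (quartic N)
      = (3 * N : ℂ) • (M1Plus N).mul (omegaM1Plus N) 0 (omegaM1Plus N) ∧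
    (M1Plus N).mul (omegaM1Plus N) 3 (quartic N) = (6 * N : ℂ) • omegaM1Plus N ∧
    (M1Plus N).mul (omegaM1Plus N) 4 (quartic N) = 0 ∧
    (∃ c : ℂ, (M1Plus N).mul (omegaM1Plus N) 5 (quartic N) = c • (M1Plus N).one) ∧
    ∀ n : ℕ, (M1Plus N).mul (omegaM1Plus N) (n + 6) (quartic N) = 0 := by
  have hN' : (N : ℂ) ≠ 0 := by exact_mod_cast hN
  obtain ⟨q2, q3, q4, q5, q6⟩ := quad_quartic N
  have hs : ∀ n : ℤ, (M1Plus N).val ((M1Plus N).mul (omegaM1Plus N) n (quartic N))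
      = Finsupp.single 0 ((1 / (2 * (N : ℂ))) • quad N 0 0 0 (-n - 1) (X 0 * X 2)) := by
    intro n
    rw [VertexSubalgebra.val_mul, val_omegaM1Plus, ← omega_prod_single_zero]
    rfl
  refine ⟨?_, ?_, ?_, ?_, ⟨1 / (2 * (N : ℂ)) * (6 * N ^ 2), ?_⟩, fun n => ?_⟩ <;>
    apply VertexSubalgebra.val_injective
  · rw [VertexSubalgebra.val_mul, map_smul, val_omegaM1Plus, val_quartic, omega_prod_one hN,
      Finsupp.smul_single]
    congr 1
    simp [smul_eq_C_mul, map_ofNat]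
    ring
  · rw [hs, show -(2 : ℤ) - 1 = -3 by norm_num, q2, map_smul, VertexSubalgebra.val_mul,
      val_omegaM1Plus]
    nth_rw 2 [omega_eq_single]
    rw [omega_prod_zero hN, Finsupp.smul_single]
    congr 1
    have h : 1 / (2 * (N : ℂ)) * (6 * N) = 3 := by field_simp; norm_num
    have h' : (C 3 : Fock) = C (3 * (N : ℂ) * (1 / (2 * (N : ℂ)))) * 2 := by
      rw [show (2 : Fock) = C 2 from (map_ofNat C 2).symm, ← C_mul]
      congr 1
      field_simp
    rw [smul_C_mul_fock, h, h', Derivation.map_smul, Int.cast_zero, zero_smul, add_zero, smul_smul,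
      smul_eq_C_mul]
    generalize C (3 * (N : ℂ) * (1 / (2 * (N : ℂ)))) = c
    simp
    ring
  · rw [hs, show -(3 : ℤ) - 1 = -4 by norm_num, q3, map_smul, val_omegaM1Plus, omega_eq_single,
      Finsupp.smul_single, smul_C_mul_fock, ← smul_eq_C_mul, smul_smul]
    congr 2
    ring
  · rw [hs, show -(4 : ℤ) - 1 = -5 by norm_num, q4]
    simp
  · rw [hs, show -(5 : ℤ) - 1 = -6 by norm_num, q5, map_smul, val_one, vac, expVec,
      Finsupp.smul_single]
    congr 1
    simp [smul_eq_C_mul, -one_div]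
  · rw [hs, show -((n : ℤ) + 6) - 1 = -(n : ℤ) - 7 by ring, q6]
    simp

namespace WeakModule

section

variable {N : ℤ} {P : VertexSubalgebra N} {M : Type*} [AddCommGroup M] [Module ℂ M]

lemma act_omega_zero_mul (hN : N ≠ 0) (𝓜 : WeakModule P M) {w : P} (hw : P.val w = omega N) (b : P)
    (n : ℤ) (u : M) : 𝓜.act (P.mul w 0 b) n u = -(n : ℂ) • 𝓜.act b (n - 1) u := by
  have h : P.mul w 0 b = P.mul b (-2) P.one := by
    apply VertexSubalgebra.val_injective
    rw [VertexSubalgebra.val_mul, VertexSubalgebra.val_mul, hw, val_one, prod_vac_neg_two hN]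
  rw [h, act_translation, ← Int.cast_smul_eq_zsmul ℂ, Int.cast_neg]

/-- The commutator formula for the conformal vector `w`.  The first term of the sum is separated,
since the field of `w_0 b` is the derivative of the field of `b`. -/
lemma act_omega_commutator (hN : N ≠ 0) (𝓜 : WeakModule P M) {w : P} (hw : P.val w = omega N)
    {b : P} {T : ℕ} (hT : ∀ i : ℕ, T + 1 ≤ i → P.mul w i b = 0) (m n : ℤ) (u : M) :
    𝓜.act w m (𝓜.act b n u) = 𝓜.act b n (𝓜.act w m u) - (m + n : ℂ) • 𝓜.act b (m + n - 1) u
      + ∑ i ∈ Finset.range T, ((Ring.choose m (i + 1) : ℤ) : ℂ) •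
          𝓜.act (P.mul w (i + 1) b) (m + n - 1 - i) u := by
  have h := 𝓜.act_commutator hT m n u
  rw [sub_eq_iff_eq_add] at h
  rw [h, Finset.sum_range_succ']
  simp only [Nat.cast_zero, Ring.choose_zero_right, one_smul, sub_zero]
  rw [𝓜.act_omega_zero_mul hN hw]
  have : ∀ i ∈ Finset.range T, Ring.choose m (i + 1) • 𝓜.act (P.mul w ((i + 1 : ℕ) : ℤ) b)
      (m + n - ((i + 1 : ℕ) : ℤ)) u = ((Ring.choose m (i + 1) : ℤ) : ℂ) •
          𝓜.act (P.mul w (i + 1) b) (m + n - 1 - i) u := by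
    intro i _
    rw [← Int.cast_smul_eq_zsmul ℂ, Nat.cast_succ,
      show m + n - ((i : ℤ) + 1) = m + n - 1 - i by ring]
  rw [Finset.sum_congr rfl this]
  push_cast
  module

lemma act_omega_zero_commutator (hN : N ≠ 0) (𝓜 : WeakModule P M) {w : P}
    (hw : P.val w = omega N) (b : P) (n : ℤ) (u : M) :
    𝓜.act b n (𝓜.act w 0 u) = 𝓜.act w 0 (𝓜.act b n u) + (n : ℂ) • 𝓜.act b (n - 1) u := by
  obtain ⟨T, hT⟩ := VertexSubalgebra.exists_mul_eq_zero w b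
  rw [𝓜.act_omega_commutator hN hw (T := T) (fun i hi => hT i (by omega)), Finset.sum_eq_zero]
  · rw [zero_add]
    push_cast
    module
  · intro i _
    rw [Ring.choose_zero_pos _ (Nat.succ_pos i), Int.cast_zero, zero_smul]

lemma act_omega_one_commutator (hN : N ≠ 0) (𝓜 : WeakModule P M) {w : P} (hw : P.val w = omega N)
    {b : P} {d : ℂ} (hd : P.mul w 1 b = d • b) (n : ℤ) (u : M) :
    𝓜.act w 1 (𝓜.act b n u) = 𝓜.act b n (𝓜.act w 1 u) + (d - n - 1) • 𝓜.act b n u := by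
  obtain ⟨T, hT⟩ := VertexSubalgebra.exists_mul_eq_zero w b
  rw [𝓜.act_omega_commutator hN hw (T := T + 1) (fun i hi => hT i (by omega)),
    Finset.sum_eq_single 0]
  · simp only [Nat.cast_zero, zero_add, Ring.choose_one_right, Int.cast_one, one_smul, sub_zero,
      hd, act_smul_vec, LinearMap.smul_apply]
    rw [show (1 : ℤ) + n - 1 = n by ring]
    module
  · intro i _ hi
    have : Ring.choose (1 : ℤ) (i + 1) = 0 := by
      have := Ring.choose_natCast (R := ℤ) 1 (i + 1)
      rw [Nat.cast_one] at this
      rw [this, Nat.choose_eq_zero_of_lt (by omega), Nat.cast_zero]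
    rw [this, Int.cast_zero, zero_smul]
  · intro h
    exact absurd (Finset.mem_range.2 (by omega)) h

end

section

variable {N : ℤ} {M : Type*} [AddCommGroup M] [Module ℂ M]

/-- The Virasoro operator `L(s) = ω_{s+1}`. -/
def vir (𝓜 : WeakModule (M1Plus N) M) (s : ℤ) : Module.End ℂ M := 𝓜.act (omegaM1Plus N) (s + 1)

/-- The operator `J(s) = J_{s+3}`, which like `L(s)` has degree `-s`. -/
def quarticMode (𝓜 : WeakModule (M1Plus N) M) (s : ℤ) : Module.End ℂ M :=
  𝓜.act (quartic N) (s + 3)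

/-- The Virasoro relation, without the central term, which vanishes for `s + t ≠ 0`. -/
lemma vir_vir (hN : N ≠ 0) (𝓜 : WeakModule (M1Plus N) M) {s t : ℤ} (hst : 0 < s + t) (u : M) :
    𝓜.vir s (𝓜.vir t u) = 𝓜.vir t (𝓜.vir s u) + (s - t : ℂ) • 𝓜.vir (s + t) u := by
  obtain ⟨h1, h2, ⟨c, h3⟩, h4⟩ := omega_mul_omega hN
  rw [vir, vir, vir, 𝓜.act_omega_commutator hN rfl (T := 3) (b := omegaM1Plus N)]
  · norm_num [Finset.sum_range_succ, h1, h2, h3, act_smul_vec, act_one, act_zero_vec,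
      show s + 1 + (t + 1) - 1 - 2 ≠ -1 by omega]
    rw [show s + 1 + (t + 1) - 1 = s + t + 1 by ring]
    module
  · intro i hi
    have := h4 (i - 4)
    rwa [show ((i - 4 : ℕ) : ℤ) + 4 = i by omega] at this

/-- `[L(s), J(t)]` is a linear combination of `J(s+t)` and `L(s+t)` if `s + t > 0`. -/
lemma vir_quarticMode (hN : N ≠ 0) (𝓜 : WeakModule (M1Plus N) M) {s t : ℤ} (hst : 0 < s + t) :
    ∃ c : ℂ, ∀ u : M, 𝓜.vir s (𝓜.quarticMode t u) = 𝓜.quarticMode t (𝓜.vir s u)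
      + (3 * s - t : ℂ) • 𝓜.quarticMode (s + t) u + c • 𝓜.vir (s + t) u := by
  obtain ⟨h1, h2, h3, h4, ⟨c, h5⟩, h6⟩ := omega_mul_quartic hN
  refine ⟨((Ring.choose (s + 1) 2 : ℤ) : ℂ) * (3 * N) * (-(s + t + 2))
    + ((Ring.choose (s + 1) 3 : ℤ) : ℂ) * (6 * N), fun u => ?_⟩
  rw [vir, quarticMode, quarticMode, vir, 𝓜.act_omega_commutator hN rfl (T := 5) (b := quartic N)]
  · norm_num [Finset.sum_range_succ, h1, h2, h3, h4, h5, act_smul_vec, act_one, act_zero_vec,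
      show s + 1 + (t + 3) - 1 - 4 ≠ -1 by omega]
    rw [𝓜.act_omega_zero_mul hN rfl]
    rw [show s + 1 + (t + 3) - 1 = s + t + 3 by ring, show s + t + 3 - 1 - 1 = s + t + 1 by ring,
      show s + t + 3 - 2 = s + t + 1 by ring]
    push_cast
    module
  · intro i hi
    have := h6 (i - 6)
    rwa [show ((i - 6 : ℕ) : ℤ) + 6 = i by omega] at this

lemma vir_zero_quarticMode (hN : N ≠ 0) (𝓜 : WeakModule (M1Plus N) M) (t : ℤ) (u : M) :
    𝓜.vir 0 (𝓜.quarticMode t u) = 𝓜.quarticMode t (𝓜.vir 0 u) - (t : ℂ) • 𝓜.quarticMode t u := by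
  rw [vir, quarticMode, zero_add, 𝓜.act_omega_one_commutator hN rfl (omega_mul_quartic hN).1]
  push_cast
  module

end

end WeakModule

/-! ### Leading modes -/

namespace WeakModule

variable {N : ℤ} {M : Type*} [AddCommGroup M] [Module ℂ M]

lemma act_plusIncl (𝓜 : WeakModule (VLPlus N) M) (a : M1Plus N) (n : ℤ) :
    𝓜.act (plusIncl N a) n = 𝓜.toM1Plus.act a n := rfl

lemma toM1Plus_act_omega (𝓜 : WeakModule (VLPlus N) M) (n : ℤ) :
    𝓜.toM1Plus.act (omegaM1Plus N) n = 𝓜.toM1Plus.vir (n - 1) := by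
  rw [vir, sub_add_cancel]

lemma toM1Plus_act_quartic (𝓜 : WeakModule (VLPlus N) M) (n : ℤ) :
    𝓜.toM1Plus.act (quartic N) n = 𝓜.toM1Plus.quarticMode (n - 3) := by
  rw [quarticMode, sub_add_cancel]

/-- The vectors which are annihilated by `L(s)`, `s > S`. -/
def virTrunc (𝓜 : WeakModule (M1Plus N) M) (S : ℕ) : Submodule ℂ M where
  carrier := {u | ∀ s : ℤ, S < s → 𝓜.vir s u = 0}
  zero_mem' _ _ := map_zero _
  add_mem' hu hv s hs := by rw [map_add, hu s hs, hv s hs, add_zero]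
  smul_mem' c u hu s hs := by rw [map_smul, hu s hs, smul_zero]

/-- The vectors which are annihilated by `J(s)`, `s > R`. -/
def quarticTrunc (𝓜 : WeakModule (M1Plus N) M) (R : ℕ) : Submodule ℂ M where
  carrier := {u | ∀ s : ℤ, R < s → 𝓜.quarticMode s u = 0}
  zero_mem' _ _ := map_zero _
  add_mem' hu hv s hs := by rw [map_add, hu s hs, hv s hs, add_zero]
  smul_mem' c u hu s hs := by rw [map_smul, hu s hs, smul_zero]

/-- The vectors `u` with `e_k u = 0` for `k > n`. -/
def fieldTrunc {P : VertexSubalgebra N} (𝓜 : WeakModule P M) (e : P) (n : ℤ) : Submodule ℂ M where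
  carrier := {u | ∀ k : ℤ, n < k → 𝓜.act e k u = 0}
  zero_mem' _ _ := map_zero _
  add_mem' hu hv s hs := by rw [map_add, hu s hs, hv s hs, add_zero]
  smul_mem' c u hu s hs := by rw [map_smul, hu s hs, smul_zero]

lemma vir_mem_virTrunc (hN : N ≠ 0) {𝓜 : WeakModule (M1Plus N) M} {S : ℕ} {s : ℤ} (hs : 0 ≤ s)
    {u : M} (hu : u ∈ 𝓜.virTrunc S) : 𝓜.vir s u ∈ 𝓜.virTrunc S := by
  intro t ht
  rw [𝓜.vir_vir hN (by omega), hu t ht, hu (t + s) (by omega)]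
  simp

lemma vir_mem_quarticTrunc (hN : N ≠ 0) {𝓜 : WeakModule (M1Plus N) M} {S R : ℕ} {s : ℤ}
    (hs : 0 ≤ s) (hSR : S ≤ R + s) {u : M} (hu : u ∈ 𝓜.virTrunc S) (hu' : u ∈ 𝓜.quarticTrunc R) :
    𝓜.vir s u ∈ 𝓜.quarticTrunc R := by
  intro t ht
  obtain ⟨c, hc⟩ := 𝓜.vir_quarticMode hN (s := s) (t := t) (by omega)
  have h := hc u
  rw [hu' t ht, hu' (s + t) (by omega), hu (s + t) (by omega)] at h
  simpa using h.symm

section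

variable {e : VLPlus N} {κ : ℂ}

/-- `[L(s), e_k] = ((s + 1)(h - 1) - k) e_{k+s}` for a primary vector `e` of weight `h`. -/
lemma vir_act (hN : N ≠ 0) (𝓜 : WeakModule (VLPlus N) M) (he : QuarticRelations e κ) :
    ∃ h : ℂ, ∀ (s k : ℤ) (u : M), 𝓜.toM1Plus.vir s (𝓜.act e k u)
      = 𝓜.act e k (𝓜.toM1Plus.vir s u) + ((s + 1) * (h - 1) - k) • 𝓜.act e (k + s) u := by
  obtain ⟨h, hh⟩ := he.omega_one
  refine ⟨h, fun s k u => ?_⟩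
  rw [vir, ← act_plusIncl, 𝓜.act_omega_commutator hN rfl (T := 1) (b := e)]
  · norm_num [hh, act_smul_vec]
    rw [show s + 1 + k - 1 = k + s by ring]
    module
  · intro i hi
    have := he.omega_ge (i - 2)
    rwa [show ((i - 2 : ℕ) : ℤ) + 2 = i by omega] at this

lemma vir_mem_fieldTrunc (hN : N ≠ 0) {𝓜 : WeakModule (VLPlus N) M} (he : QuarticRelations e κ)
    {n s : ℤ} (hs : 0 ≤ s) {u : M} (hu : u ∈ 𝓜.fieldTrunc e n) :
    𝓜.toM1Plus.vir s u ∈ 𝓜.fieldTrunc e n := by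
  obtain ⟨h, hh⟩ := 𝓜.vir_act hN he
  intro k hk
  have := hh s k u
  rw [hu k hk, hu (k + s) (by omega)] at this
  simpa using this.symm

/-- The vectors on which the leading mode `e_n` of `e` is studied. -/
def leadSpace (𝓜 : WeakModule (VLPlus N) M) (e : VLPlus N) (n : ℤ) (S : ℕ) : Submodule ℂ M :=
  𝓜.fieldTrunc e n ⊓ 𝓜.toM1Plus.virTrunc S

lemma vir_mem_leadSpace (hN : N ≠ 0) {𝓜 : WeakModule (VLPlus N) M} (he : QuarticRelations e κ)
    {n : ℤ} {S : ℕ} {s : ℤ} (hs : 0 ≤ s) {u : M} (hu : u ∈ 𝓜.leadSpace e n S) :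
    𝓜.toM1Plus.vir s u ∈ 𝓜.leadSpace e n S :=
  ⟨vir_mem_fieldTrunc hN he hs hu.1, vir_mem_virTrunc hN hs hu.2⟩

/-- On `leadSpace`, the modes `b_k`, `k > τ`, vanish, and `b_τ = e_n p(L(S))`. -/
def HasLead (𝓜 : WeakModule (VLPlus N) M) (e : VLPlus N) (n : ℤ) (S : ℕ) (b : VLPlus N) (τ : ℤ)
    (p : Polynomial ℂ) : Prop :=
  ∀ u ∈ 𝓜.leadSpace e n S, (∀ k : ℤ, τ < k → 𝓜.act b k u = 0) ∧
    𝓜.act b τ u = 𝓜.act e n (Polynomial.aeval (𝓜.toM1Plus.vir S) p u)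

variable {𝓜 : WeakModule (VLPlus N) M} {n : ℤ} {S : ℕ} {b b' : VLPlus N} {τ τ' : ℤ}
  {p p' : Polynomial ℂ}

lemma hasLead_self : HasLead 𝓜 e n S e n 1 := by
  intro u hu
  refine ⟨hu.1, ?_⟩
  simp

lemma HasLead.add (h : HasLead 𝓜 e n S b τ p) (h' : HasLead 𝓜 e n S b' τ p') :
    HasLead 𝓜 e n S (b + b') τ (p + p') := by
  intro u hu
  refine ⟨fun k hk => ?_, ?_⟩
  · rw [act_add_vec, LinearMap.add_apply, (h u hu).1 k hk, (h' u hu).1 k hk, add_zero]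
  · rw [act_add_vec, LinearMap.add_apply, (h u hu).2, (h' u hu).2, map_add, LinearMap.add_apply,
      map_add]

lemma HasLead.smul (h : HasLead 𝓜 e n S b τ p) (c : ℂ) :
    HasLead 𝓜 e n S (c • b) τ (c • p) := by
  intro u hu
  refine ⟨fun k hk => ?_, ?_⟩
  · rw [act_smul_vec, LinearMap.smul_apply, (h u hu).1 k hk, smul_zero]
  · rw [act_smul_vec, LinearMap.smul_apply, (h u hu).2, map_smul, LinearMap.smul_apply, map_smul]

lemma HasLead.of_lt (h : HasLead 𝓜 e n S b τ p) (hτ : τ < τ') : HasLead 𝓜 e n S b τ' 0 := by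
  intro u hu
  refine ⟨fun k hk => (h u hu).1 k (hτ.trans hk), ?_⟩
  rw [(h u hu).1 τ' hτ]
  simp

lemma HasLead.omega_zero (hN : N ≠ 0) (h : HasLead 𝓜 e n S b τ p) :
    HasLead 𝓜 e n S ((VLPlus N).mul (plusIncl N (omegaM1Plus N)) 0 b) (τ + 1)
      ((-(τ + 1) : ℂ) • p) := by
  intro u hu
  refine ⟨fun k hk => ?_, ?_⟩
  · rw [𝓜.act_omega_zero_mul hN rfl, (h u hu).1 (k - 1) (by omega), smul_zero]
  · rw [𝓜.act_omega_zero_mul hN rfl, add_sub_cancel_right, (h u hu).2, map_smul,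
      LinearMap.smul_apply, map_smul]
    push_cast
    rfl

/-- The leading mode of `ω_{-l} b`. -/
lemma HasLead.omega_neg (hN : N ≠ 0) (he : QuarticRelations e κ) (h : HasLead 𝓜 e n S b τ p)
    {l : ℕ} (hl : 1 ≤ l) :
    ∃ γ c : ℂ, (l = 1 → γ = 1) ∧ (S ≠ 0 → c = 0) ∧
      HasLead 𝓜 e n S ((VLPlus N).mul (plusIncl N (omegaM1Plus N)) (-l) b) (τ + S + l + 1)
        (p * (Polynomial.C γ * Polynomial.X + Polynomial.C c)) := by
  -- the coefficient of `b_{-l+k-i} ω_i` in the iterate formula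
  let γ : ℕ → ℂ := fun i =>
    -(((-1) ^ i * Ring.choose (-(l : ℤ)) i : ℤ) * ((-(l : ℤ)).negOnePow : ℤ))
  have hvanish : ∀ u ∈ 𝓜.leadSpace e n S, ∀ k : ℤ, τ + l + 1 ≤ k →
      𝓜.act ((VLPlus N).mul (plusIncl N (omegaM1Plus N)) (-l) b) k u
        = γ 0 • (k - l : ℂ) • 𝓜.act b (k - l - 1) u
          + ∑ i ∈ Finset.range (S + 1),
            γ (i + 1) • 𝓜.act b (k - l - 1 - i) (𝓜.toM1Plus.vir i u) := by
    intro u hu k hk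
    have hterm : ∀ i : ℕ, ((-1) ^ i * Ring.choose (-(l : ℤ)) i : ℤ) •
        (𝓜.act (plusIncl N (omegaM1Plus N)) (-(l : ℤ) - i) (𝓜.act b (k + i) u)
          - ((-(l : ℤ)).negOnePow : ℤ) • 𝓜.act b (-(l : ℤ) + k - i)
              (𝓜.act (plusIncl N (omegaM1Plus N)) i u))
        = γ i • 𝓜.act b (k - l - i) (𝓜.act (plusIncl N (omegaM1Plus N)) i u) := by
      intro i
      rw [(h u hu).1 _ (by omega), map_zero, zero_sub, smul_neg, smul_smul, ← neg_smul,
        ← Int.cast_smul_eq_zsmul ℂ, show -(l : ℤ) + k - i = k - l - i by ring]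
      simp only [γ, Int.cast_neg, Int.cast_mul]
    rw [𝓜.act_mul _ b (T := S + 2), Finset.sum_congr rfl fun i _ => hterm i,
      Finset.sum_range_succ', add_comm]
    · congr 1
      · rw [Nat.cast_zero, 𝓜.act_omega_zero_commutator hN rfl, sub_zero, (h u hu).1 _ (by omega),
          map_zero, zero_add]
        push_cast
        rfl
      · refine Finset.sum_congr rfl fun i _ => ?_
        rw [act_plusIncl, toM1Plus_act_omega]
        push_cast
        rw [add_sub_cancel_right, show k - l - (i + 1 : ℤ) = k - l - 1 - i by ring]
    · intro i hi
      exact (h u hu).1 _ (by omega)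
    · intro i hi
      rw [act_plusIncl, toM1Plus_act_omega]
      exact hu.2 _ (by omega)
  have hvir : ∀ u ∈ 𝓜.leadSpace e n S, ∀ i : ℕ, ∀ k : ℤ, τ < k →
      𝓜.act b k (𝓜.toM1Plus.vir i u) = 0 := fun u hu i k hk =>
    (h _ (vir_mem_leadSpace hN he (by omega) hu)).1 k hk
  refine ⟨γ (S + 1), if S = 0 then γ 0 * (τ + 1) else 0, ?_, fun hS => if_neg hS,
    fun u hu => ⟨?_, ?_⟩⟩
  · rintro rfl
    have hc : ∀ i : ℕ, ((-1) ^ i * Ring.choose (-1 : ℤ) i : ℤ) = 1 := by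
      intro i
      rw [Ring.choose_neg, show (1 : ℤ) + i - 1 = (i : ℤ) by ring, Ring.choose_natCast,
        Int.negOnePow_def, Units.smul_def]
      simp [← mul_pow]
    simp only [γ, Nat.cast_one, hc]
    simp
  · intro k hk
    rw [hvanish u hu k (by omega), (h u hu).1 _ (by omega), smul_zero, smul_zero, zero_add]
    refine Finset.sum_eq_zero fun i hi => ?_
    have := Finset.mem_range.1 hi
    rw [hvir u hu i _ (by omega), smul_zero]
  · rw [hvanish u hu _ (by omega), Finset.sum_range_succ, Finset.sum_eq_zero, zero_add]
    · have h1 := (h _ (vir_mem_leadSpace hN he (s := S) (by omega) hu)).2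
      have h2 : Polynomial.aeval (𝓜.toM1Plus.vir S)
            (p * (Polynomial.C (γ (S + 1)) * Polynomial.X
              + Polynomial.C (if S = 0 then γ 0 * (τ + 1) else 0))) u
          = γ (S + 1) • Polynomial.aeval (𝓜.toM1Plus.vir S) p (𝓜.toM1Plus.vir S u)
            + (if S = 0 then γ 0 * (τ + 1) else 0 : ℂ) •
                Polynomial.aeval (𝓜.toM1Plus.vir S) p u := by
        simp [Module.End.mul_apply, Module.algebraMap_end_apply]
        split_ifs <;> simp
      rw [h2, map_add, map_smul, map_smul, ← h1, ← (h u hu).2,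
        show τ + S + l + 1 - l - 1 - (S : ℤ) = τ by ring, add_comm]
      congr 1
      rcases Nat.eq_zero_or_pos S with hS | hS
      · rw [if_pos hS, hS, smul_smul,
          show (τ + ((0 : ℕ) : ℤ) + l + 1 - l - 1) = τ by push_cast; ring]
        congr 1
        push_cast
        ring
      · rw [if_neg (by omega), (h u hu).1 _ (by omega)]
        simp
    · intro i hi
      have := Finset.mem_range.1 hi
      rw [hvir u hu i _ (by omega), smul_zero]

end

end WeakModule

/-! ### The leading mode of `J_{-1} e` -/

namespace WeakModule

variable {N : ℤ} {M : Type*} [AddCommGroup M] [Module ℂ M] {e : VLPlus N} {κ : ℂ}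
  {𝓜 : WeakModule (VLPlus N) M} {n : ℤ} {S : ℕ} {b b' : VLPlus N} {τ τ' : ℤ}

/-- On `leadSpace`, the modes `b_k`, `k > τ`, vanish, and `b_τ = e_n p(L(S))` with `p` of degree
at most `1`. -/
def HasLinearLead (𝓜 : WeakModule (VLPlus N) M) (e : VLPlus N) (n : ℤ) (S : ℕ) (b : VLPlus N)
    (τ : ℤ) : Prop :=
  ∃ p ∈ Polynomial.degreeLT ℂ 2, HasLead 𝓜 e n S b τ p

lemma HasLinearLead.add (h : HasLinearLead 𝓜 e n S b τ) (h' : HasLinearLead 𝓜 e n S b' τ) :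
    HasLinearLead 𝓜 e n S (b + b') τ := by
  obtain ⟨p, hp, h⟩ := h
  obtain ⟨p', hp', h'⟩ := h'
  exact ⟨p + p', Submodule.add_mem _ hp hp', h.add h'⟩

lemma HasLinearLead.smul (h : HasLinearLead 𝓜 e n S b τ) (c : ℂ) :
    HasLinearLead 𝓜 e n S (c • b) τ := by
  obtain ⟨p, hp, h⟩ := h
  exact ⟨c • p, Submodule.smul_mem _ c hp, h.smul c⟩

lemma HasLinearLead.of_le (h : HasLinearLead 𝓜 e n S b τ) (hτ : τ ≤ τ') :
    HasLinearLead 𝓜 e n S b τ' := by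
  rcases hτ.eq_or_lt with rfl | hτ
  · exact h
  · obtain ⟨p, hp, h⟩ := h
    exact ⟨0, Submodule.zero_mem _, h.of_lt hτ⟩

lemma HasLinearLead.omega_zero (hN : N ≠ 0) (h : HasLinearLead 𝓜 e n S b τ) :
    HasLinearLead 𝓜 e n S ((VLPlus N).mul (plusIncl N (omegaM1Plus N)) 0 b) (τ + 1) := by
  obtain ⟨p, hp, h⟩ := h
  exact ⟨_, Submodule.smul_mem _ _ hp, h.omega_zero hN⟩

lemma linear_mem_degreeLT (a c : ℂ) :
    Polynomial.C a * Polynomial.X + Polynomial.C c ∈ Polynomial.degreeLT ℂ 2 := by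
  rw [Polynomial.mem_degreeLT]
  exact Polynomial.degree_linear_le.trans_lt (by norm_num)

lemma hasLinearLead_self : HasLinearLead 𝓜 e n S e n := by
  refine ⟨_, ?_, hasLead_self⟩
  simpa using linear_mem_degreeLT 0 1

lemma hasLinearLead_omega_neg (hN : N ≠ 0) (he : QuarticRelations e κ) {l : ℕ} (hl : 1 ≤ l) :
    HasLinearLead 𝓜 e n S ((VLPlus N).mul (plusIncl N (omegaM1Plus N)) (-l) e) (n + S + l + 1) := by
  obtain ⟨γ, c, -, -, h⟩ := (hasLead_self (𝓜 := 𝓜) (e := e) (n := n) (S := S)).omega_neg hN he hl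
  exact ⟨_, by rw [one_mul]; exact linear_mem_degreeLT γ c, h⟩

/-- The vectors `J_t e`, `t ≥ 0`. -/
lemma hasLinearLead_quartic (hN : N ≠ 0) (he : QuarticRelations e κ) (t : ℕ) :
    HasLinearLead 𝓜 e n S ((VLPlus N).mul (plusIncl N (quartic N)) t e) (n + S + 3 - t) := by
  have h0 : HasLinearLead 𝓜 e n S e n := hasLinearLead_self
  have h1 := hasLinearLead_omega_neg (𝓜 := 𝓜) (n := n) (S := S) hN he (l := 1) le_rfl
  have h2 := hasLinearLead_omega_neg (𝓜 := 𝓜) (n := n) (S := S) hN he (l := 2) (by norm_num)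
  rcases t with _ | _ | _ | _ | t
  · obtain ⟨c₁, c₂, c₃, h⟩ := he.quartic_zero
    rw [Nat.cast_zero, h]
    exact (((((h0.omega_zero hN).omega_zero hN).omega_zero hN).smul c₁).of_le (by omega)).add
      (((h1.omega_zero hN).smul c₂).of_le (by omega)) |>.add ((h2.smul c₃).of_le (by omega))
  · obtain ⟨c₁, c₂, h⟩ := he.quartic_one
    rw [Nat.cast_add, Nat.cast_zero, Nat.cast_one, zero_add, h]
    exact ((((h0.omega_zero hN).omega_zero hN).smul c₁).of_le (by omega)).add
      ((h1.smul c₂).of_le (by omega))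
  · obtain ⟨c, h⟩ := he.quartic_two
    rw [show ((0 + 1 + 1 : ℕ) : ℤ) = 2 by norm_num, h]
    exact ((h0.omega_zero hN).smul c).of_le (by omega)
  · obtain ⟨c, h⟩ := he.quartic_three
    rw [show ((0 + 1 + 1 + 1 : ℕ) : ℤ) = 3 by norm_num, h]
    exact (h0.smul c).of_le (by omega)
  · rw [show ((t + 1 + 1 + 1 + 1 : ℕ) : ℤ) = t + 4 by push_cast; ring, he.quartic_ge]
    refine ⟨0, Submodule.zero_mem _, fun u _ => ⟨fun k _ => ?_, ?_⟩⟩ <;> simp [act_zero_vec]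

/-- The leading mode of `J_{-1} e`. -/
lemma hasLead_quartic_neg_one (hN : N ≠ 0) (he : QuarticRelations e κ) :
    ∃ q ∈ Polynomial.degreeLT ℂ 2, (S ≠ 0 → q = 0) ∧
      HasLead 𝓜 e n S ((VLPlus N).mul (plusIncl N (quartic N)) (-1) e) (n + 2 * S + 4)
        (Polynomial.C κ * Polynomial.X ^ 2 + q) := by
  have h0 : HasLinearLead 𝓜 e n S e n := hasLinearLead_self
  have h1 := hasLinearLead_omega_neg (𝓜 := 𝓜) (n := n) (S := S) hN he (l := 1) le_rfl
  have h2 := hasLinearLead_omega_neg (𝓜 := 𝓜) (n := n) (S := S) hN he (l := 2) (by norm_num)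
  have h3 := hasLinearLead_omega_neg (𝓜 := 𝓜) (n := n) (S := S) hN he (l := 3) (by norm_num)
  obtain ⟨c₂, c₃, c₄, c₅, h⟩ := he.quartic_neg_one
  obtain ⟨γ, c, hγ, hc, hl⟩ :=
    (hasLead_self (𝓜 := 𝓜) (e := e) (n := n) (S := S)).omega_neg hN he (l := 1) le_rfl
  obtain ⟨γ', c', hγ', hc', hl'⟩ := hl.omega_neg hN he (l := 1) le_rfl
  have htail := ((((h1.omega_zero hN).omega_zero hN).smul c₂).of_le (τ' := n + S + 4)
    (by push_cast; omega)).add (((h2.omega_zero hN).smul c₃).of_le (by push_cast; omega)) |>.add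
    ((h3.smul c₄).of_le (by push_cast; omega)) |>.add
    ((((((h0.omega_zero hN).omega_zero hN).omega_zero hN).omega_zero hN).smul c₅).of_le (by omega))
  rw [hγ rfl] at hl hl'
  rw [hγ' rfl] at hl'
  have hmain := hl'.smul κ
  rw [show n + S + (1 : ℕ) + 1 + S + (1 : ℕ) + 1 = n + 2 * S + 4 by push_cast; ring] at hmain
  have hpoly : κ • ((1 * (Polynomial.C 1 * Polynomial.X + Polynomial.C c)) *
      (Polynomial.C 1 * Polynomial.X + Polynomial.C c'))
      = Polynomial.C κ * Polynomial.X ^ 2 + (Polynomial.C (κ * (c + c')) * Polynomial.X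
        + Polynomial.C (κ * c * c')) := by
    rw [Polynomial.smul_eq_C_mul]
    simp only [map_mul, map_add, map_one]
    ring
  rw [hpoly] at hmain
  obtain ⟨p, hp, htail⟩ := htail
  rw [h]
  rcases Nat.eq_zero_or_pos S with rfl | hS
  · refine ⟨Polynomial.C (κ * (c + c')) * Polynomial.X + Polynomial.C (κ * c * c') + p,
      Submodule.add_mem _ (linear_mem_degreeLT _ _) hp, fun h => absurd rfl h, ?_⟩
    have := hmain.add htail
    simpa only [add_assoc, Nat.cast_one, Nat.cast_ofNat] using this
  · refine ⟨0, Submodule.zero_mem _, fun _ => rfl, ?_⟩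
    rw [hc (by omega), hc' (by omega)] at hmain
    have := hmain.add (htail.of_lt (τ' := n + 2 * S + 4) (by omega))
    simpa [add_assoc] using this

lemma act_quartic_eq (he : QuarticRelations e κ) {u : M} (i k : ℤ) :
    𝓜.toM1Plus.quarticMode i (𝓜.act e k u) = 𝓜.act e k (𝓜.toM1Plus.quarticMode i u)
      + ∑ t ∈ Finset.range 4, ((Ring.choose (i + 3) t : ℤ) : ℂ) •
        𝓜.act ((VLPlus N).mul (plusIncl N (quartic N)) t e) (k + i + 3 - t) u := by
  have h := 𝓜.act_commutator (a := plusIncl N (quartic N)) (b := e) (T := 4) (fun i hi => by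
    have := he.quartic_ge (i - 4)
    rwa [show ((i - 4 : ℕ) : ℤ) + 4 = i by omega] at this) (i + 3) k u
  rw [sub_eq_iff_eq_add] at h
  rw [quarticMode, ← act_plusIncl, h]
  refine (add_comm _ _).trans ?_
  congr 1
  refine Finset.sum_congr rfl fun t _ => ?_
  rw [← Int.cast_smul_eq_zsmul ℂ, show i + 3 + k - t = k + i + 3 - t by ring]

/-- The action of `J(s)` on `e_n u`. -/
lemma quarticMode_act (hN : N ≠ 0) (he : QuarticRelations e κ) {s : ℕ} (hs : S ≤ s)
    (hs' : s = 0 ∨ S < s) : ∃ q ∈ Polynomial.degreeLT ℂ 2, (s ≠ 0 → q = 0) ∧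
      ∀ u ∈ 𝓜.leadSpace e n S, 𝓜.toM1Plus.quarticMode s (𝓜.act e n u)
        = 𝓜.act e n (𝓜.toM1Plus.quarticMode s u
          + Polynomial.aeval (𝓜.toM1Plus.vir S) q u) := by
  choose p hp hlead using fun t : ℕ => hasLinearLead_quartic (𝓜 := 𝓜) (n := n) (S := S) hN he t
  rcases hs' with rfl | hs'
  · obtain rfl : S = 0 := by omega
    refine ⟨∑ t ∈ Finset.range 4, ((Ring.choose ((0 : ℤ) + 3) t : ℤ) : ℂ) • p t,
      Submodule.sum_mem _ fun t _ => Submodule.smul_mem _ _ (hp t), fun h => absurd rfl h,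
      fun u hu => ?_⟩
    rw [act_quartic_eq he, map_add]
    congr 1
    simp only [map_sum, LinearMap.sum_apply, map_smul, LinearMap.smul_apply]
    refine Finset.sum_congr rfl fun t _ => ?_
    rw [← (hlead t u hu).2]
    simp
  · refine ⟨0, Submodule.zero_mem _, fun _ => rfl, fun u hu => ?_⟩
    rw [act_quartic_eq he, map_zero, LinearMap.zero_apply, add_zero, Finset.sum_eq_zero, add_zero]
    intro t _
    rw [(hlead t u hu).1 _ (by omega), smul_zero]

/-- The mode of `J_{-1} e` which involves `e_n J(r)`. -/
lemma act_quartic_neg_one (hN : N ≠ 0) (he : QuarticRelations e κ) {r : ℕ} (hr : 2 * S ≤ r) :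
    ∃ q ∈ Polynomial.degreeLT ℂ 2, (r ≠ 0 → q = 0) ∧
      ∀ u ∈ 𝓜.leadSpace e n S, u ∈ 𝓜.toM1Plus.quarticTrunc r →
        𝓜.act ((VLPlus N).mul (plusIncl N (quartic N)) (-1) e) (n + r + 4) u
        = 𝓜.act e n (𝓜.toM1Plus.quarticMode r u
          + Polynomial.aeval (𝓜.toM1Plus.vir S) q u) := by
  choose p hp hlead using fun t : ℕ => hasLinearLead_quartic (𝓜 := 𝓜) (n := n) (S := S) hN he t
  have key : ∀ u ∈ 𝓜.leadSpace e n S, u ∈ 𝓜.toM1Plus.quarticTrunc r →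
      𝓜.act ((VLPlus N).mul (plusIncl N (quartic N)) (-1) e) (n + r + 4) u
      = 𝓜.act e n (𝓜.toM1Plus.quarticMode r u) + ∑ i ∈ Finset.range (r + 3),
        -∑ t ∈ Finset.range 4, ((Ring.choose (i : ℤ) t : ℤ) : ℂ) •
          𝓜.act ((VLPlus N).mul (plusIncl N (quartic N)) t e) (n + r + 3 - t) u := by
    intro u hu hu'
    rw [𝓜.act_mul_neg_one _ e (T := r + 4), Finset.sum_range_succ, add_comm]
    · congr 1
      · rw [hu.1 _ (by omega), map_zero, zero_add, act_plusIncl, toM1Plus_act_quartic]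
        congr 2
        · push_cast; ring
        · push_cast
          congr 2
          ring
      · refine Finset.sum_congr rfl fun i hi => ?_
        have hi' := Finset.mem_range.1 hi
        rw [hu.1 _ (by omega), map_zero, zero_add, act_plusIncl, toM1Plus_act_quartic,
          eq_neg_iff_add_eq_zero]
        have h := act_quartic_eq (𝓜 := 𝓜) he (u := u) (i - 3) (n + r + 4 - 1 - i)
        rw [hu.1 _ (by omega), map_zero] at h
        rw [h]
        congr 1
        refine Finset.sum_congr rfl fun t _ => ?_
        congr 2
        · congr 2
          ring
        · congr 1
          ring
    · intro i hi
      exact hu.1 _ (by omega)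
    · intro i hi
      rw [act_plusIncl, toM1Plus_act_quartic]
      exact hu' _ (by omega)
  rcases Nat.eq_zero_or_pos r with rfl | hr0
  · obtain rfl : S = 0 := by omega
    refine ⟨∑ i ∈ Finset.range (0 + 3), -∑ t ∈ Finset.range 4,
        ((Ring.choose (i : ℤ) t : ℤ) : ℂ) • p t,
      Submodule.sum_mem _ fun i _ => Submodule.neg_mem _ (Submodule.sum_mem _ fun t _ =>
        Submodule.smul_mem _ _ (hp t)), fun h => absurd rfl h, fun u hu hu' => ?_⟩
    rw [key u hu hu', map_add]
    congr 1
    simp only [map_sum, LinearMap.sum_apply, map_smul, LinearMap.smul_apply, map_neg,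
      LinearMap.neg_apply]
    refine Finset.sum_congr rfl fun i _ => ?_
    congr 1
    refine Finset.sum_congr rfl fun t _ => ?_
    rw [← (hlead t u hu).2]
  · refine ⟨0, Submodule.zero_mem _, fun _ => rfl, fun u hu hu' => ?_⟩
    rw [key u hu hu', map_zero, LinearMap.zero_apply, add_zero, Finset.sum_eq_zero, add_zero]
    intro i _
    rw [neg_eq_zero]
    refine Finset.sum_eq_zero fun t _ => ?_
    rw [(hlead t u hu).1 _ (by omega), smul_zero]

end WeakModule

/-! ### Existence of a highest weight vector -/

namespace WeakModule

variable {N : ℤ} {M : Type*} [AddCommGroup M] [Module ℂ M] {e : VLPlus N} {κ : ℂ}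
  {𝓜 : WeakModule (VLPlus N) M} {n : ℤ} {S : ℕ}

/-- `L(s) u = J(s') u = 0` for `s > S` and `s' > R`. -/
def trunc (𝓜 : WeakModule (VLPlus N) M) (S R : ℕ) : Submodule ℂ M :=
  𝓜.toM1Plus.virTrunc S ⊓ 𝓜.toM1Plus.quarticTrunc R

/-- `J(2S) u = κ L(S)² u`, where for `S = 0` terms of lower order in `L(0)` are allowed. -/
def QuarticEq (𝓜 : WeakModule (VLPlus N) M) (S : ℕ) (κ : ℂ) (u : M) : Prop :=
  ∃ a b : ℂ, (S ≠ 0 → a = 0 ∧ b = 0) ∧ 𝓜.toM1Plus.quarticMode (2 * S : ℕ) u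
    = κ • 𝓜.toM1Plus.vir S (𝓜.toM1Plus.vir S u) + a • 𝓜.toM1Plus.vir S u + b • u

lemma exists_trunc (𝓜 : WeakModule (VLPlus N) M) (u : M) : ∃ S : ℕ, u ∈ 𝓜.trunc S (2 * S) := by
  obtain ⟨T₁, h₁⟩ := 𝓜.toM1Plus.exists_act_eq_zero (omegaM1Plus N) u
  obtain ⟨T₂, h₂⟩ := 𝓜.toM1Plus.exists_act_eq_zero (quartic N) u
  refine ⟨T₁ + T₂, fun s hs => h₁ _ ?_, fun s hs => h₂ _ ?_⟩ <;> push_cast at hs <;> omega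

lemma exists_leading_mode {P : VertexSubalgebra N} (𝓜 : WeakModule P M) {b : P} {u : M}
    (h : ∃ n, 𝓜.act b n u ≠ 0) : ∃ n, 𝓜.act b n u ≠ 0 ∧ u ∈ 𝓜.fieldTrunc b n := by
  obtain ⟨T, hT⟩ := 𝓜.exists_act_eq_zero b u
  obtain ⟨n, hn, hmax⟩ := Int.exists_greatest_of_bdd (P := fun n => 𝓜.act b n u ≠ 0)
    ⟨T, fun n hn => by
      by_contra h
      exact hn (hT n (by omega))⟩ h
  refine ⟨n, hn, fun k hk => ?_⟩
  by_contra h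
  exact absurd (hmax k h) (by omega)

/-- `e_n` intertwines `L(S)` with a translate of `L(S)`. -/
lemma act_vir (hN : N ≠ 0) (he : QuarticRelations e κ) : ∃ c : ℂ, (S ≠ 0 → c = 0) ∧
    ∀ u ∈ 𝓜.leadSpace e n S, 𝓜.act e n (𝓜.toM1Plus.vir S u)
      = 𝓜.toM1Plus.vir S (𝓜.act e n u) + c • 𝓜.act e n u := by
  obtain ⟨h, hh⟩ := 𝓜.vir_act hN he
  rcases Nat.eq_zero_or_pos S with rfl | hS
  · refine ⟨-((0 + 1) * (h - 1) - n), fun h => absurd rfl h, fun u hu => ?_⟩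
    have := hh ((0 : ℕ) : ℤ) n u
    rw [this, Nat.cast_zero, add_zero, Int.cast_zero]
    module
  · refine ⟨0, fun _ => rfl, fun u hu => ?_⟩
    rw [hh, hu.1 _ (by omega)]
    simp

/-- The leading mode `e_n` preserves the vanishing of `L(s)`, `s > S`, and of `J(s)`, `s > R`. -/
lemma act_mem_trunc (hN : N ≠ 0) (he : QuarticRelations e κ) {R : ℕ} (hR : S ≤ R) {u : M}
    (hu : u ∈ 𝓜.leadSpace e n S) (hu' : u ∈ 𝓜.toM1Plus.quarticTrunc R) :
    𝓜.act e n u ∈ 𝓜.trunc S R := by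
  obtain ⟨h, hh⟩ := 𝓜.vir_act hN he
  constructor
  · intro s hs
    rw [hh, hu.2 s hs, hu.1 _ (by omega)]
    simp
  · intro s hs
    obtain ⟨s, rfl⟩ := Int.eq_ofNat_of_zero_le (show 0 ≤ s by omega)
    obtain ⟨q, -, hq, h⟩ := quarticMode_act (𝓜 := 𝓜) (n := n) (S := S) hN he (s := s) (by omega)
      (Or.inr (by omega))
    rw [h u hu, hq (by omega), hu' _ hs]
    simp

lemma exists_linear_of_mem_degreeLT {q : Polynomial ℂ} (hq : q ∈ Polynomial.degreeLT ℂ 2) :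
    ∃ a b : ℂ, q = Polynomial.C a * Polynomial.X + Polynomial.C b := by
  refine ⟨q.coeff 1, q.coeff 0, ?_⟩
  apply Polynomial.eq_X_add_C_of_natDegree_le_one
  rcases eq_or_ne q 0 with rfl | h0
  · simp
  · rw [Polynomial.mem_degreeLT, ← Polynomial.natDegree_lt_iff_degree_lt h0] at hq
    omega

/-- The equation for `J(2S)` is inherited by `e_n u`. -/
lemma QuarticEq.act (hN : N ≠ 0) (he : QuarticRelations e κ) {κ' : ℂ} {u : M}
    (hu : u ∈ 𝓜.leadSpace e n S) {a b : ℂ} (hab : S ≠ 0 → a = 0 ∧ b = 0)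
    (h : 𝓜.act e n (𝓜.toM1Plus.quarticMode (2 * S : ℕ) u)
      = 𝓜.act e n (κ' • 𝓜.toM1Plus.vir S (𝓜.toM1Plus.vir S u) + a • 𝓜.toM1Plus.vir S u + b • u)) :
    QuarticEq 𝓜 S κ' (𝓜.act e n u) := by
  obtain ⟨c, hc, hv⟩ := act_vir (𝓜 := 𝓜) (n := n) (S := S) hN he
  obtain ⟨q, hq, hq0, hJ⟩ := quarticMode_act (𝓜 := 𝓜) (n := n) (S := S) hN he (s := 2 * S)
    (by omega) (by omega)
  obtain ⟨a', b', rfl⟩ := exists_linear_of_mem_degreeLT hq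
  have hu1 := vir_mem_leadSpace hN he (s := S) (by omega) hu
  have hJ' := hJ u hu
  rw [map_add, h] at hJ'
  rcases Nat.eq_zero_or_pos S with rfl | hS
  · refine ⟨2 * c * κ' + a + a', κ' * c ^ 2 + a * c + b + a' * c + b', fun h => absurd rfl h, ?_⟩
    rw [hJ']
    simp only [map_add, map_smul, hv _ hu1, hv u hu, Polynomial.aeval_X, Polynomial.aeval_C,
      map_mul, LinearMap.add_apply, Module.End.mul_apply, Module.algebraMap_end_apply]
    module
  · rw [hq0 (by omega), (hab (by omega)).1, (hab (by omega)).2] at hJ'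
    rw [hc (by omega)] at hv
    refine ⟨0, 0, fun _ => ⟨rfl, rfl⟩, ?_⟩
    rw [hJ']
    simp [hv _ hu1, hv u hu]

/-- The highest modes of the two sides of the relation for `J_{-1} e` on `u` give the equation for
`J(2S)` on the vector `e_n u`. -/
lemma quarticEq_act (hN : N ≠ 0) (he : QuarticRelations e κ) {u : M}
    (hu : u ∈ 𝓜.leadSpace e n S) (hu' : u ∈ 𝓜.toM1Plus.quarticTrunc (2 * S)) :
    QuarticEq 𝓜 S κ (𝓜.act e n u) := by
  obtain ⟨q, hq, hq0, h1⟩ := hasLead_quartic_neg_one (𝓜 := 𝓜) (n := n) (S := S) hN he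
  obtain ⟨q', hq', hq0', h2⟩ := act_quartic_neg_one (𝓜 := 𝓜) (n := n) (S := S) hN he le_rfl
  have h1' := (h1 u hu).2
  have h2' := h2 u hu hu'
  rw [show n + ((2 * S : ℕ) : ℤ) + 4 = n + 2 * S + 4 by push_cast; ring, h1'] at h2'
  obtain ⟨a, b, hab⟩ := exists_linear_of_mem_degreeLT (Submodule.sub_mem _ hq hq')
  refine QuarticEq.act hN he hu (a := a) (b := b) (fun hS => ?_) ?_
  · rw [hq0 hS, hq0' (by omega), sub_zero] at hab
    have h0 := congrArg (fun p => Polynomial.coeff p 0) hab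
    have h1 := congrArg (fun p => Polynomial.coeff p 1) hab
    simp at h0 h1
    exact ⟨h1.symm, h0.symm⟩
  · rw [map_add (𝓜.act e n) (𝓜.toM1Plus.quarticMode _ u), ← sub_eq_iff_eq_add, ← map_sub] at h2'
    rw [← h2']
    congr 1
    rw [map_add, LinearMap.add_apply, add_sub_assoc, ← LinearMap.sub_apply, ← map_sub, hab]
    simp [pow_two, Module.End.mul_apply, Module.algebraMap_end_apply, add_assoc]

variable {e' : VLPlus N} {κ' : ℂ}

lemma exists_quarticEq (hN : N ≠ 0) (he : QuarticRelations e κ)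
    (hne : ∀ u : M, u ≠ 0 → ∃ n, 𝓜.act e n u ≠ 0) {u : M} (hu0 : u ≠ 0)
    (hu : u ∈ 𝓜.trunc S (2 * S)) : ∃ v ≠ 0, v ∈ 𝓜.trunc S (2 * S) ∧ QuarticEq 𝓜 S κ v ∧
      ∀ κ', QuarticEq 𝓜 S κ' u → QuarticEq 𝓜 S κ' v := by
  obtain ⟨n, hn, hF⟩ := 𝓜.exists_leading_mode (hne u hu0)
  have hl : u ∈ 𝓜.leadSpace e n S := ⟨hF, hu.1⟩
  refine ⟨_, hn, act_mem_trunc hN he (by omega) hl hu.2, quarticEq_act hN he hl hu.2, ?_⟩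
  rintro κ' ⟨a, b, hab, h⟩
  exact QuarticEq.act hN he hl hab (by rw [h])

/-- Two vectors `e`, `e'` with different coefficients `κ` give a relation for `L(S)` alone. -/
lemma exists_vir_relation (hN : N ≠ 0) (he : QuarticRelations e κ) (he' : QuarticRelations e' κ')
    (hκ : κ ≠ κ') (hne : ∀ u : M, u ≠ 0 → ∃ n, 𝓜.act e n u ≠ 0)
    (hne' : ∀ u : M, u ≠ 0 → ∃ n, 𝓜.act e' n u ≠ 0) {u : M} (hu0 : u ≠ 0)
    (hu : u ∈ 𝓜.trunc S (2 * S)) : ∃ v ≠ 0, v ∈ 𝓜.trunc S (2 * S) ∧ QuarticEq 𝓜 S κ v ∧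
      ∃ a b : ℂ, (S ≠ 0 → a = 0 ∧ b = 0) ∧
        𝓜.toM1Plus.vir S (𝓜.toM1Plus.vir S v) = a • 𝓜.toM1Plus.vir S v + b • v := by
  obtain ⟨v, hv0, hv, hκv, -⟩ := exists_quarticEq hN he hne hu0 hu
  obtain ⟨w, hw0, hw, hκw', hw'⟩ := exists_quarticEq hN he' hne' hv0 hv
  have hκw := hw' κ hκv
  refine ⟨w, hw0, hw, hκw, ?_⟩
  obtain ⟨a, b, hab, h1⟩ := hκw
  obtain ⟨a', b', hab', h2⟩ := hκw'
  refine ⟨(κ - κ')⁻¹ * (a' - a), (κ - κ')⁻¹ * (b' - b), fun hS => ?_, ?_⟩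
  · rw [(hab hS).1, (hab hS).2, (hab' hS).1, (hab' hS).2]
    simp
  · have hk : κ - κ' ≠ 0 := sub_ne_zero.2 hκ
    have h3 : (κ - κ') • 𝓜.toM1Plus.vir S (𝓜.toM1Plus.vir S w)
        = (a' - a) • 𝓜.toM1Plus.vir S w + (b' - b) • w := by
      rw [h1] at h2
      rw [← sub_eq_zero] at h2 ⊢
      rw [← h2]
      module
    rw [← inv_smul_smul₀ hk (𝓜.toM1Plus.vir S (𝓜.toM1Plus.vir S w)), h3]
    module

/-- The bound `S + 1` can be lowered.  There is `v` with `L(S+1)² v = J(2S+2) v = 0`.  The vector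
`v` or `L(S+1) v` is annihilated by `L(S+1)` and `J(2S+2)`, and a leading mode of `e` on it is
annihilated by `J(2S+1)` as well. -/
lemma exists_trunc_pred (hN : N ≠ 0) (he : QuarticRelations e κ) (he' : QuarticRelations e' κ')
    (hκ : κ ≠ κ') (hne : ∀ u : M, u ≠ 0 → ∃ n, 𝓜.act e n u ≠ 0)
    (hne' : ∀ u : M, u ≠ 0 → ∃ n, 𝓜.act e' n u ≠ 0) {u : M} (hu0 : u ≠ 0)
    (hu : u ∈ 𝓜.trunc (S + 1) (2 * (S + 1))) : ∃ v ≠ 0, v ∈ 𝓜.trunc S (2 * S) := by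
  obtain ⟨v, hv0, hv, ⟨a, b, hab, hJ⟩, a', b', hab', hL⟩ :=
    exists_vir_relation hN he he' hκ hne hne' hu0 hu
  rw [(hab' (by omega)).1, (hab' (by omega)).2, zero_smul, zero_smul, add_zero] at hL
  rw [hL, (hab (by omega)).1, (hab (by omega)).2, zero_smul, zero_smul, smul_zero, add_zero,
    add_zero] at hJ
  have hmem : ∀ w ∈ 𝓜.trunc (S + 1) (2 * (S + 1)), 𝓜.toM1Plus.vir (S + 1 : ℕ) w = 0 →
      𝓜.toM1Plus.quarticMode (2 * (S + 1) : ℕ) w = 0 → w ∈ 𝓜.trunc S (2 * S + 1) := by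
    intro w hw h1 h2
    constructor
    · intro s hs
      rcases (show ((S + 1 : ℕ) : ℤ) ≤ s by push_cast; omega).eq_or_lt with rfl | h
      · exact h1
      · exact hw.1 s h
    · intro s hs
      rcases (show ((2 * (S + 1) : ℕ) : ℤ) ≤ s by push_cast at hs ⊢; omega).eq_or_lt with rfl | h
      · exact h2
      · exact hw.2 s h
  -- `[L(S+1), J(2S+2)]` vanishes on `v`, so `J(2S+2)` annihilates `L(S+1) v`
  obtain ⟨w, hw0, hw⟩ : ∃ w ≠ 0, w ∈ 𝓜.trunc S (2 * S + 1) := by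
    by_cases hLv : 𝓜.toM1Plus.vir (S + 1 : ℕ) v = 0
    · exact ⟨v, hv0, hmem v hv hLv hJ⟩
    · refine ⟨_, hLv, hmem _ ⟨vir_mem_virTrunc hN (by omega) hv.1,
        vir_mem_quarticTrunc hN (by omega) (by omega) hv.1 hv.2⟩ hL ?_⟩
      obtain ⟨c, hc⟩ := 𝓜.toM1Plus.vir_quarticMode hN (s := (S + 1 : ℕ))
        (t := (2 * (S + 1) : ℕ)) (by push_cast; omega)
      have h := hc v
      rw [hJ, hv.1 ((S + 1 : ℕ) + (2 * (S + 1) : ℕ)) (by push_cast; omega),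
        hv.2 ((S + 1 : ℕ) + (2 * (S + 1) : ℕ)) (by push_cast; omega)] at h
      simpa using h.symm
  obtain ⟨n, hn, hF⟩ := 𝓜.exists_leading_mode (hne w hw0)
  have hl : w ∈ 𝓜.leadSpace e n S := ⟨hF, hw.1⟩
  have hm := act_mem_trunc hN he (show S ≤ 2 * S + 1 by omega) hl hw.2
  refine ⟨_, hn, hm.1, fun s hs => ?_⟩
  rcases (show ((2 * S + 1 : ℕ) : ℤ) ≤ s by push_cast at hs ⊢; omega).eq_or_lt with rfl | h
  · obtain ⟨q, -, -, h1⟩ := hasLead_quartic_neg_one (𝓜 := 𝓜) (n := n) (S := S) hN he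
    obtain ⟨q', -, hq', h2⟩ := act_quartic_neg_one (𝓜 := 𝓜) (n := n) (S := S) (r := 2 * S + 1) hN he
      (by omega)
    obtain ⟨q'', -, hq'', h3⟩ := quarticMode_act (𝓜 := 𝓜) (n := n) (S := S) (s := 2 * S + 1) hN he
      (by omega) (by omega)
    have h4 := h2 w hl hw.2
    rw [(h1 w hl).1 _ (by push_cast; omega), hq' (by omega), map_zero, LinearMap.zero_apply,
      add_zero] at h4
    rw [h3 w hl, hq'' (by omega), map_zero, LinearMap.zero_apply, add_zero, h4]
  · exact hm.2 s h

/-- An operator which satisfies a quadratic equation on `v` has an eigenvector in its span. -/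
lemma exists_eigenvector_of_quadratic {V : Type*} [AddCommGroup V] [Module ℂ V]
    (T : Module.End ℂ V) {v : V} (hv : v ≠ 0) {a b : ℂ} (h : T (T v) = a • T v + b • v) :
    ∃ z ≠ 0, (∃ x y : ℂ, z = x • T v + y • v) ∧ ∃ c : ℂ, T z = c • z := by
  obtain ⟨s, hs⟩ := IsAlgClosed.exists_pow_nat_eq (a ^ 2 + 4 * b) (n := 2) (by norm_num)
  by_cases h0 : T v = ((a - s) / 2) • v
  · exact ⟨v, hv, ⟨0, 1, by simp⟩, _, h0⟩
  · refine ⟨T v - ((a - s) / 2) • v, sub_ne_zero.2 h0, ⟨1, -((a - s) / 2), by module⟩,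
      (a + s) / 2, ?_⟩
    have hb : b = (s ^ 2 - a ^ 2) / 4 := by rw [hs]; ring
    rw [map_sub, map_smul, h, hb]
    module

/-- A common eigenvector of `L(0)` and `J(0)` which is annihilated by `L(s)` and `J(s)`, `s > 0`. -/
theorem exists_common_eigenvector (hN : N ≠ 0) (he : QuarticRelations e κ)
    (he' : QuarticRelations e' κ')
    (hκ : κ ≠ κ') (hne : ∀ u : M, u ≠ 0 → ∃ n, 𝓜.act e n u ≠ 0)
    (hne' : ∀ u : M, u ≠ 0 → ∃ n, 𝓜.act e' n u ≠ 0) [Nontrivial M] :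
    ∃ z ≠ 0, z ∈ 𝓜.trunc 0 0 ∧ ∃ h c : ℂ, 𝓜.toM1Plus.vir 0 z = h • z ∧
      𝓜.toM1Plus.quarticMode 0 z = c • z := by
  have hdesc : ∀ S : ℕ, (∃ u ≠ 0, u ∈ 𝓜.trunc S (2 * S)) → ∃ u ≠ 0, u ∈ 𝓜.trunc 0 (2 * 0) := by
    intro S
    induction S with
    | zero => exact id
    | succ S ih =>
      rintro ⟨u, hu0, hu⟩
      exact ih (exists_trunc_pred hN he he' hκ hne hne' hu0 hu)
  obtain ⟨u₀, hu₀⟩ := exists_ne (0 : M)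
  obtain ⟨S, hS⟩ := 𝓜.exists_trunc u₀
  obtain ⟨u, hu0, hu⟩ := hdesc S ⟨u₀, hu₀, hS⟩
  obtain ⟨v, hv0, hv, ⟨a, b, -, hJ⟩, a', b', -, hL⟩ :=
    exists_vir_relation hN he he' hκ hne hne' hu0 hu
  simp only [mul_zero, Nat.cast_zero] at hJ hL hv
  obtain ⟨z, hz0, ⟨x, y, hz⟩, c, hc⟩ := exists_eigenvector_of_quadratic _ hv0 hL
  have hLv : 𝓜.toM1Plus.vir 0 v ∈ 𝓜.trunc 0 0 :=
    ⟨vir_mem_virTrunc hN le_rfl hv.1, vir_mem_quarticTrunc hN le_rfl (by simp) hv.1 hv.2⟩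
  refine ⟨z, hz0, ?_, c, κ * c ^ 2 + a * c + b, hc, ?_⟩
  · rw [hz]
    exact Submodule.add_mem _ (Submodule.smul_mem _ _ hLv) (Submodule.smul_mem _ _ hv)
  · have hcomm := 𝓜.toM1Plus.vir_zero_quarticMode hN 0 v
    rw [Int.cast_zero, zero_smul, sub_zero] at hcomm
    have h1 : 𝓜.toM1Plus.quarticMode 0 z = κ • 𝓜.toM1Plus.vir 0 (𝓜.toM1Plus.vir 0 z)
        + a • 𝓜.toM1Plus.vir 0 z + b • z := by
      rw [hz]
      simp only [map_add, map_smul, ← hcomm, hJ]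
      module
    rw [h1, hc, map_smul, hc]
    module

end WeakModule

/-! ### Weights in the Heisenberg algebra -/

/-- The weight of the monomial `∏ α(-k-1)^{s k}`. -/
def monoWeight (s : ℕ →₀ ℕ) : ℕ := s.sum fun k m => m * (k + 1)

lemma monoWeight_add (s t : ℕ →₀ ℕ) : monoWeight (s + t) = monoWeight s + monoWeight t := by
  rw [monoWeight, Finsupp.sum_add_index']
  · rfl
  · simp
  · intro k m m'
    ring

lemma monoWeight_single (k : ℕ) : monoWeight (Finsupp.single k 1) = k + 1 := by
  simp [monoWeight]

lemma euler_monomial (s : ℕ →₀ ℕ) (c : ℂ) :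
    euler (monomial s c) = (monoWeight s : ℂ) • monomial s c := by
  induction s using Finsupp.induction_linear generalizing c with
  | zero =>
    rw [show monomial 0 c = (C c : Fock) from rfl, derivation_C]
    simp [monoWeight]
  | add s t hs ht =>
    have h : (monomial (s + t) c : Fock) = monomial s c * monomial t 1 := by
      rw [monomial_mul, mul_one]
    rw [h, Derivation.leibniz, hs, ht, monoWeight_add]
    simp only [smul_eq_mul, smul_eq_C_mul, Nat.cast_add, map_add]
    ring
  | single k m =>
    induction m generalizing c with
    | zero =>
      rw [Finsupp.single_zero, show monomial 0 c = (C c : Fock) from rfl, derivation_C]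
      simp [monoWeight]
    | succ m ih =>
      have h : (monomial (Finsupp.single k (m + 1)) c : Fock)
          = monomial (Finsupp.single k m) c * X k := by
        rw [X, monomial_mul, mul_one, Finsupp.single_add]
      rw [h, Derivation.leibniz, ih, euler_X, Finsupp.single_add, monoWeight_add, monoWeight_single]
      simp only [smul_eq_mul, smul_eq_C_mul, Nat.cast_add, map_add, map_natCast, map_one,
        Nat.cast_one]
      ring

lemma coeff_euler (s : ℕ →₀ ℕ) (f : Fock) : coeff s (euler f) = monoWeight s * coeff s f := by
  induction f using MvPolynomial.induction_on' with
  | monomial t c =>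
    rw [euler_monomial, coeff_smul, smul_eq_mul, coeff_monomial]
    split_ifs with h
    · rw [h]
    · simp
  | add f g hf hg => rw [map_add, coeff_add, hf, hg, coeff_add, mul_add]

/-- The vector `f` of `S(ĥ₋)` has weight `d`. -/
def HasWeight (d : ℤ) (f : Fock) : Prop := euler f = (d : ℂ) • f

lemma HasWeight.mul {d d' : ℤ} {f g : Fock} (hf : HasWeight d f) (hg : HasWeight d' g) :
    HasWeight (d + d') (f * g) := by
  rw [HasWeight, Derivation.leibniz, hf, hg]
  simp only [smul_eq_mul, smul_eq_C_mul, Int.cast_add, map_add]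
  ring

lemma HasWeight.smul {d : ℤ} {f : Fock} (hf : HasWeight d f) (c : ℂ) : HasWeight d (c • f) := by
  rw [HasWeight, Derivation.map_smul, hf, smul_comm]

lemma HasWeight.add {d : ℤ} {f g : Fock} (hf : HasWeight d f) (hg : HasWeight d g) :
    HasWeight d (f + g) := by
  rw [HasWeight, map_add, hf, hg, smul_add]

lemma hasWeight_zero (d : ℤ) : HasWeight d 0 := by simp [HasWeight]

lemma HasWeight.sum {ι : Type*} {d : ℤ} (s : Finset ι) {f : ι → Fock}
    (hf : ∀ i ∈ s, HasWeight d (f i)) : HasWeight d (∑ i ∈ s, f i) := by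
  rw [HasWeight, map_sum, Finset.smul_sum]
  exact Finset.sum_congr rfl hf

lemma hasWeight_intCast (c : ℤ) : HasWeight 0 (c : Fock) := by
  rw [HasWeight, Derivation.map_intCast]
  simp

lemma hasWeight_monomial (s : ℕ →₀ ℕ) (c : ℂ) : HasWeight (monoWeight s) (monomial s c) := by
  rw [HasWeight, euler_monomial, Int.cast_natCast]

lemma HasWeight.eq_of_mem_support {d : ℤ} {f : Fock} (hf : HasWeight d f) {s : ℕ →₀ ℕ}
    (hs : s ∈ f.support) : (monoWeight s : ℤ) = d := by
  have h := congrArg (coeff s) hf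
  rw [coeff_euler, coeff_smul, smul_eq_mul] at h
  exact_mod_cast mul_right_cancel₀ (mem_support_iff.1 hs) h

lemma euler_pderiv (i : ℕ) (f : Fock) :
    euler (pderiv i f) = pderiv i (euler f) - ((i : ℂ) + 1) • pderiv i f := by
  have h : ⁅euler, pderiv (R := ℂ) i⁆ = -((i : ℂ) + 1) • pderiv (R := ℂ) i := by
    apply MvPolynomial.derivation_ext
    intro k
    rw [Derivation.commutator_apply, euler_X, Derivation.map_smul, Derivation.smul_apply]
    by_cases hk : k = i
    · subst hk
      simp
      module
    · simp [pderiv_X_of_ne hk]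
  have h' := congrArg (fun D : Derivation ℂ Fock Fock => D f) h
  simp only [Derivation.commutator_apply, Derivation.smul_apply] at h'
  rw [eq_sub_iff_add_eq, ← sub_eq_zero, add_sub_right_comm, h']
  module

lemma HasWeight.heis {d : ℤ} {f : Fock} (hf : HasWeight d f) (N p : ℤ) (r : ℕ) :
    HasWeight (d - r) (heis N p r f) := by
  cases r with
  | zero =>
    rw [heis_zero, Nat.cast_zero, sub_zero]
    exact hf.smul _
  | succ r =>
    rw [heis_succ]
    refine HasWeight.smul ?_ _
    rw [HasWeight, euler_pderiv, hf, Derivation.map_smul]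
    push_cast
    module

lemma hasWeight_creationPart_coeff (k : ℕ) (e : ℤ) :
    HasWeight (k + 1 + e) ((creationPart k).coeff e) := by
  rcases lt_or_ge e 0 with he | he
  · rw [creationPart_coeff_neg k e he]
    exact hasWeight_zero _
  · obtain ⟨e, rfl⟩ := Int.eq_ofNat_of_zero_le he
    rw [creationPart_coeff_nat]
    have h : HasWeight (k + 1 + e) (X (e + k) : Fock) := by
      rw [HasWeight, euler_X]
      push_cast
      congr 1
      ring
    simpa using (hasWeight_intCast (((e + k).choose k : ℕ) : ℤ)).mul h

/-- The coefficients of the field of `l`, applied to a homogeneous vector, are homogeneous. -/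
lemma hasWeight_field_coeff (N p : ℤ) (l : List ℕ) {d : ℤ} {g : Fock} (hg : HasWeight d g) (e : ℤ) :
    HasWeight ((l.map fun k : ℕ => (k : ℤ) + 1).sum + d + e) ((field N 0 p l g).coeff e) := by
  induction l generalizing g d e with
  | nil =>
    rw [field_nil]
    by_cases he : e = 0
    · subst he
      simpa using hg
    · rw [HahnSeries.C_apply, HahnSeries.coeff_single_of_ne he]
      exact hasWeight_zero _
  | cons k l ih =>
    change HasWeight _ ((creationPart k * field N 0 p l g
      + annihilationPart N p k (field N 0 p l) g).coeff e)
    rw [HahnSeries.coeff_add]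
    refine HasWeight.add ?_ ?_
    · rw [HahnSeries.coeff_mul]
      refine HasWeight.sum _ fun q hq => ?_
      have h := (hasWeight_creationPart_coeff k q.1).mul (ih hg q.2)
      rw [Finset.mem_antidiagonal] at hq
      convert h using 1
      rw [List.map_cons, List.sum_cons, ← hq.2.2]
      ring
    · obtain ⟨R, hR⟩ := heis_finite_bound N p g
      rw [annihilationPart_eq_sum hR, HahnSeries.coeff_sum]
      refine HasWeight.sum _ fun r _ => ?_
      rw [HahnSeries.coeff_single_mul]
      have h := (hasWeight_intCast (Ring.choose (-(r : ℤ) - 1) k)).mul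
        (ih (hg.heis N p r) (e - (-(r : ℤ) - 1 - k)))
      convert h using 1
      rw [List.map_cons, List.sum_cons]
      ring

lemma sum_sort_toMultiset (s : ℕ →₀ ℕ) :
    ((Finsupp.toMultiset s).sort.map fun k : ℕ => (k : ℤ) + 1).sum = monoWeight s := by
  rw [← Multiset.sum_coe, ← Multiset.map_coe, Multiset.sort_eq]
  induction s using Finsupp.induction_linear with
  | zero => simp [monoWeight]
  | add s t hs ht => rw [map_add, Multiset.map_add, Multiset.sum_add, hs, ht, monoWeight_add,
      Nat.cast_add]
  | single k m =>
    rw [Finsupp.toMultiset_single, Multiset.map_nsmul, Multiset.sum_nsmul]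
    simp [monoWeight]

lemma single_eq_sum_monomial (f : Fock) : (Finsupp.single 0 f : Space)
    = ∑ s ∈ f.support, coeff s f • Finsupp.single 0 (monomial s 1) := by
  conv_lhs => rw [f.as_sum]
  rw [← Finsupp.lsingle_apply (R := ℂ), map_sum]
  refine Finset.sum_congr rfl fun s _ => ?_
  rw [Finsupp.lsingle_apply, Finsupp.smul_single, smul_monomial, smul_eq_mul, mul_one]

lemma exists_prod_hasWeight (N n : ℤ) {d d' : ℤ} {f g : Fock} (hf : HasWeight d f)
    (hg : HasWeight d' g) : ∃ F : Fock,
      prod N (Finsupp.single 0 f) n (Finsupp.single 0 g) = Finsupp.single 0 F ∧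
        HasWeight (d + d' - n - 1) F := by
  have h : ∀ s ∈ f.support, prod N (coeff s f • Finsupp.single 0 (monomial s 1)) n
      (Finsupp.single 0 g) = Finsupp.single 0 (coeff s f •
        (field N 0 0 ((Finsupp.toMultiset s).sort) g).coeff (-n - 1)) := by
    intro s _
    rw [prod_smul_left, prod_monomial_single, zero_add, Finsupp.smul_single]
  refine ⟨∑ s ∈ f.support, coeff s f •
    (field N 0 0 ((Finsupp.toMultiset s).sort) g).coeff (-n - 1), ?_, ?_⟩
  · have hlin : ∀ t : Finset (ℕ →₀ ℕ), prod N (∑ s ∈ t, coeff s f • Finsupp.single 0 (monomial s 1))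
        n (Finsupp.single 0 g) = ∑ s ∈ t, prod N (coeff s f • Finsupp.single 0 (monomial s 1)) n
          (Finsupp.single 0 g) := by
      intro t
      induction t using Finset.induction_on with
      | empty => rw [Finset.sum_empty, Finset.sum_empty, prod_zero_left]
      | insert s t hs ih => rw [Finset.sum_insert hs, Finset.sum_insert hs, prod_add_left, ih]
    rw [single_eq_sum_monomial, hlin, Finset.sum_congr rfl h]
    simp only [← Finsupp.lsingle_apply (R := ℂ), map_sum]
  · refine HasWeight.sum _ fun s hs => HasWeight.smul ?_ _
    have := hasWeight_field_coeff N 0 ((Finsupp.toMultiset s).sort) hg (-n - 1)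
    rw [sum_sort_toMultiset, hf.eq_of_mem_support hs] at this
    convert this using 1
    ring

lemma exists_val_eq_single {N : ℤ} (a : M1Plus N) :
    ∃ f : Fock, (M1Plus N).val a = Finsupp.single 0 f ∧ fockTheta f = f := by
  obtain ⟨f, hf⟩ := a.2.1
  have h : theta ((M1Plus N).val a) = (M1Plus N).val a := mem_VLPlus.1 a.2.2
  have hf' : (M1Plus N).val a = Finsupp.single 0 f := hf.symm
  refine ⟨f, hf', ?_⟩
  rw [hf', theta_single, neg_zero] at h
  exact Finsupp.single_injective _ h

lemma isHomogeneous_iff {N : ℤ} (hN : N ≠ 0) {d : ℤ} {a : M1Plus N} {f : Fock}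
    (hf : (M1Plus N).val a = Finsupp.single 0 f) :
    VertexSubalgebra.IsHomogeneous d a ↔ HasWeight d f := by
  rw [VertexSubalgebra.IsHomogeneous, hf, omega_prod_one hN, Finsupp.smul_single,
    (Finsupp.single_injective _).eq_iff, HasWeight]
  simp

lemma VertexSubalgebra.IsHomogeneous.mul {N : ℤ} (hN : N ≠ 0) {d d' : ℤ} {a b : M1Plus N}
    (ha : VertexSubalgebra.IsHomogeneous d a) (hb : VertexSubalgebra.IsHomogeneous d' b) (n : ℤ) :
    VertexSubalgebra.IsHomogeneous (d + d' - n - 1) ((M1Plus N).mul a n b) := by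
  obtain ⟨f, hf, -⟩ := exists_val_eq_single a
  obtain ⟨g, hg, -⟩ := exists_val_eq_single b
  obtain ⟨F, hF, hw⟩ := exists_prod_hasWeight N n ((isHomogeneous_iff hN hf).1 ha)
    ((isHomogeneous_iff hN hg).1 hb)
  rw [isHomogeneous_iff hN (f := F)]
  · exact hw
  · rw [VertexSubalgebra.val_mul, hf, hg, hF]

lemma eq_zero_of_isHomogeneous_neg {N : ℤ} (hN : N ≠ 0) {d : ℤ} (hd : d < 0) {a : M1Plus N}
    (ha : VertexSubalgebra.IsHomogeneous d a) : a = 0 := by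
  obtain ⟨f, hf, -⟩ := exists_val_eq_single a
  have hw := (isHomogeneous_iff hN hf).1 ha
  apply VertexSubalgebra.val_injective
  rw [hf, map_zero, Finsupp.single_eq_zero]
  by_contra h
  obtain ⟨s, hs⟩ := Finset.nonempty_iff_ne_empty.2 (mt MvPolynomial.support_eq_empty.1 h)
  have := hw.eq_of_mem_support hs
  omega

/-! ### Words in the modes of the two generators -/

namespace WeakModule

variable {N : ℤ} {M : Type*} [AddCommGroup M] [Module ℂ M]

/-- The generators `ω` (`false`) and `J` (`true`). -/
def generator (N : ℤ) : Bool → M1Plus N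
  | false => omegaM1Plus N
  | true => quartic N

/-- The weight of a generator. -/
def genWeight : Bool → ℕ
  | false => 2
  | true => 4

/-- The operator `L(s)` or `J(s)`. -/
def letter (𝓜 : WeakModule (M1Plus N) M) (x : Bool × ℤ) : Module.End ℂ M :=
  𝓜.act (generator N x.1) (x.2 + genWeight x.1 - 1)

/-- The product of the operators `L(s)` and `J(s)` given by the letters of `l`. -/
def word (𝓜 : WeakModule (M1Plus N) M) (l : List (Bool × ℤ)) : Module.End ℂ M :=
  (l.map 𝓜.letter).prod

/-- The sum of the weights of the letters. -/
def wordWeight (l : List (Bool × ℤ)) : ℕ := (l.map fun x => genWeight x.1).sum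

/-- A word lowers the `L(0)`-eigenvalue by its total index. -/
def wordIndex (l : List (Bool × ℤ)) : ℤ := (l.map Prod.snd).sum

/-- The span of the words of index `s` and weight at most `w`. -/
def words (𝓜 : WeakModule (M1Plus N) M) (w : ℕ) (s : ℤ) : Submodule ℂ (Module.End ℂ M) :=
  Submodule.span ℂ {T | ∃ l, wordWeight l ≤ w ∧ wordIndex l = s ∧ 𝓜.word l = T}

variable {𝓜 : WeakModule (M1Plus N) M}

lemma word_mem_words {l : List (Bool × ℤ)} {w : ℕ} {s : ℤ} (hw : wordWeight l ≤ w)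
    (hs : wordIndex l = s) : 𝓜.word l ∈ 𝓜.words w s :=
  Submodule.subset_span ⟨l, hw, hs, rfl⟩

lemma words_mono {w w' : ℕ} (h : w ≤ w') (s : ℤ) : 𝓜.words w s ≤ 𝓜.words w' s := by
  refine Submodule.span_mono ?_
  rintro _ ⟨l, hl, hs, rfl⟩
  exact ⟨l, hl.trans h, hs, rfl⟩

lemma mul_mem_words {w w' : ℕ} {s s' : ℤ} {T T' : Module.End ℂ M} (hT : T ∈ 𝓜.words w s)
    (hT' : T' ∈ 𝓜.words w' s') : T * T' ∈ 𝓜.words (w + w') (s + s') := by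
  have h := Submodule.mul_mem_mul hT hT'
  rw [words, words, Submodule.span_mul_span] at h
  refine Submodule.span_mono ?_ h
  rintro _ ⟨_, ⟨l, hl, hs, rfl⟩, _, ⟨l', hl', hs', rfl⟩, rfl⟩
  refine ⟨l ++ l', ?_, ?_, ?_⟩
  · rw [wordWeight, List.map_append, List.sum_append]
    exact add_le_add hl hl'
  · rw [wordIndex, List.map_append, List.sum_append, ← hs, ← hs', wordIndex, wordIndex]
  · simp [word]

/-- `a` is a vector of weight `d` whose modes are given by words of weight at most `d`. -/
def IsGenerated (𝓜 : WeakModule (M1Plus N) M) (d : ℕ) (a : M1Plus N) : Prop :=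
  ∀ (n : ℤ) (x : M), ∃ T ∈ 𝓜.words d (n + 1 - d), 𝓜.act a n x = T x

lemma isGenerated_generator (g : Bool) : 𝓜.IsGenerated (genWeight g) (generator N g) := by
  intro n x
  refine ⟨_, word_mem_words (l := [(g, n + 1 - genWeight g)]) ?_ ?_, ?_⟩
  · simp [wordWeight]
  · simp [wordIndex]
  · simp [word, letter]

lemma isGenerated_one : 𝓜.IsGenerated 0 (M1Plus N).one := by
  intro n x
  by_cases h : n = -1
  · refine ⟨_, word_mem_words (l := []) (by simp [wordWeight]) (by simp [wordIndex, h]), ?_⟩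
    simp [act_one, h, word]
  · refine ⟨0, Submodule.zero_mem _, ?_⟩
    simp [act_one, h]

lemma IsGenerated.derivative {d : ℕ} {a : M1Plus N} (h : 𝓜.IsGenerated d a) :
    𝓜.IsGenerated (d + 1) ((M1Plus N).mul a (-2) (M1Plus N).one) := by
  intro n x
  obtain ⟨T, hT, h⟩ := h (n - 1) x
  refine ⟨-(n : ℂ) • T, Submodule.smul_mem _ _ (words_mono (Nat.le_succ d) _ ?_), ?_⟩
  · convert hT using 2
    push_cast
    ring
  · rw [act_translation, h, ← Int.cast_smul_eq_zsmul ℂ, Int.cast_neg, LinearMap.smul_apply]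

lemma IsGenerated.mul {d d' : ℕ} {a b : M1Plus N} (ha : 𝓜.IsGenerated d a)
    (hb : 𝓜.IsGenerated d' b) : 𝓜.IsGenerated (d + d') ((M1Plus N).mul a (-1) b) := by
  have key : ∀ {d d' : ℕ} {a b : M1Plus N}, 𝓜.IsGenerated d a → 𝓜.IsGenerated d' b →
      ∀ (m n : ℤ) (x : M), ∃ T ∈ 𝓜.words (d + d') (m + n + 2 - (d + d')),
        𝓜.act a m (𝓜.act b n x) = T x := by
    intro d d' a b ha hb m n x
    obtain ⟨T, hT, h⟩ := hb n x
    obtain ⟨T', hT', h'⟩ := ha m (T x)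
    refine ⟨T' * T, ?_, ?_⟩
    · convert mul_mem_words hT' hT using 1
      congr 1
      ring
    · rw [h, h']
      rfl
  intro n x
  obtain ⟨R, h1, h2⟩ := 𝓜.exists_bound a b n x
  rw [𝓜.act_mul_neg_one a b n x h1 h2]
  choose T hT hT' using fun i : ℕ => key ha hb (-1 - i) (n + i) x
  choose T₂ hT₂ hT₂' using fun i : ℕ => key hb ha (n - 1 - i) i x
  refine ⟨∑ i ∈ Finset.range R, (T i + T₂ i), Submodule.sum_mem _ fun i _ =>
    Submodule.add_mem _ ?_ ?_, ?_⟩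
  · convert hT i using 2
    push_cast
    ring
  · convert hT₂ i using 2
    · omega
    · push_cast
      ring
  · rw [LinearMap.sum_apply]
    refine Finset.sum_congr rfl fun i _ => ?_
    rw [hT', hT₂', LinearMap.add_apply]

lemma IsGenerated.add {d : ℕ} {a b : M1Plus N} (ha : 𝓜.IsGenerated d a)
    (hb : 𝓜.IsGenerated d b) : 𝓜.IsGenerated d (a + b) := by
  intro n x
  obtain ⟨T, hT, h⟩ := ha n x
  obtain ⟨T', hT', h'⟩ := hb n x
  exact ⟨T + T', Submodule.add_mem _ hT hT', by rw [act_add_vec, LinearMap.add_apply, h, h']; rfl⟩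

lemma IsGenerated.smul {d : ℕ} {a : M1Plus N} (ha : 𝓜.IsGenerated d a) (c : ℂ) :
    𝓜.IsGenerated d (c • a) := by
  intro n x
  obtain ⟨T, hT, h⟩ := ha n x
  exact ⟨c • T, Submodule.smul_mem _ c hT, by rw [act_smul_vec, LinearMap.smul_apply, h]; rfl⟩

/-- The polynomials `f` such that `f 𝟏` lies in `M(1)^+` and its modes are given by words of weight
at most `d`. -/
def generatedFock (𝓜 : WeakModule (M1Plus N) M) (d : ℕ) : Submodule ℂ Fock where
  carrier := {f | ∃ a : M1Plus N, (M1Plus N).val a = Finsupp.single 0 f ∧ 𝓜.IsGenerated d a}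
  zero_mem' := by
    refine ⟨0, by simp, fun n x => ⟨0, Submodule.zero_mem _, ?_⟩⟩
    rw [act_zero_vec]
  add_mem' := by
    rintro f g ⟨a, ha, ha'⟩ ⟨b, hb, hb'⟩
    exact ⟨a + b, by rw [map_add, ha, hb, Finsupp.single_add], ha'.add hb'⟩
  smul_mem' := by
    rintro c f ⟨a, ha, ha'⟩
    exact ⟨c • a, by rw [map_smul, ha, Finsupp.smul_single], ha'.smul c⟩

lemma one_mem_generatedFock : 1 ∈ 𝓜.generatedFock 0 := ⟨_, rfl, isGenerated_one⟩

lemma X_zero_mul_X_zero_mem_generatedFock (hN : N ≠ 0) : X 0 * X 0 ∈ 𝓜.generatedFock 2 := by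
  have hN' : 1 / (2 * (N : ℂ)) ≠ 0 := by
    have : (N : ℂ) ≠ 0 := by exact_mod_cast hN
    exact one_div_ne_zero (mul_ne_zero two_ne_zero this)
  rw [← Submodule.smul_mem_iff _ hN']
  exact ⟨omegaM1Plus N, omega_eq_single N, isGenerated_generator false⟩

lemma X_zero_mul_X_two_mem_generatedFock : X 0 * X 2 ∈ 𝓜.generatedFock 4 :=
  ⟨quartic N, rfl, isGenerated_generator true⟩

lemma transl_mem_generatedFock {d : ℕ} {f : Fock} (hf : f ∈ 𝓜.generatedFock d) :
    transl f ∈ 𝓜.generatedFock (d + 1) := by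
  obtain ⟨a, ha, ha'⟩ := hf
  refine ⟨_, ?_, ha'.derivative⟩
  rw [VertexSubalgebra.val_mul, val_one, ha, prod_single_vac_neg_two N 0 f]
  simp

lemma quad_mem_generatedFock {d d' i j : ℕ} (hij : i ≤ j) {g : Fock}
    (h : X i * X j ∈ 𝓜.generatedFock d) (hg : g ∈ 𝓜.generatedFock d') :
    quad N 0 i j 0 g ∈ 𝓜.generatedFock (d + d') := by
  obtain ⟨a, ha, ha'⟩ := h
  obtain ⟨b, hb, hb'⟩ := hg
  refine ⟨_, ?_, ha'.mul hb'⟩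
  rw [VertexSubalgebra.val_mul, ha, hb]
  exact quadVec_prod N 0 (-1) hij g

end WeakModule

/-- The coefficients of `quadDerivation`. -/
def quadCoeff (i j r : ℕ) : ℂ :=
  (-1) ^ j * (r + j).choose j * (r + 1 + j + i).choose i
    + (-1) ^ i * (r + i).choose i * (r + 1 + i + j).choose j

/-- The difference between the mode `-1` of `α(-i-1) α(-j-1)` on `M(1)` and the multiplication by
`α(-i-1) α(-j-1)`. -/
def quadDerivation (N : ℤ) (i j : ℕ) : Derivation ℂ Fock Fock :=
  mkDerivation ℂ fun k => ((N : ℂ) * (k + 1) * quadCoeff i j (k + 1)) • X (k + 2 + i + j)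

lemma quadDerivation_X (N : ℤ) (i j k : ℕ) : quadDerivation N i j (X k)
    = ((N : ℂ) * (k + 1) * quadCoeff i j (k + 1)) • X (k + 2 + i + j) := mkDerivation_X _ _ _

lemma quad_zero_eq (N : ℤ) (i j : ℕ) (g : Fock) :
    quad N 0 i j 0 g = X i * X j * g + quadDerivation N i j g := by
  obtain ⟨R, hR⟩ := exists_vars_subset g
  rw [quad_eq (heis_eq_zero_of_vars hR), creation_mul_coeff_zero, derivation_eq_sum _ hR,
    Finset.sum_eq_zero (s := Finset.range (R + 1)) (f := fun r => ∑ s ∈ _, _), add_zero]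
  · congr 1
    rw [Finset.sum_range_succ', heis_zero]
    simp only [mul_zero, Int.cast_zero, zero_smul, add_zero]
    refine Finset.sum_congr rfl fun k _ => ?_
    rw [show (0 : ℤ) + ((k + 1 : ℕ) : ℤ) + 1 + j = ((k + 1 + 1 + j : ℕ) : ℤ) by push_cast; ring,
      show (0 : ℤ) + ((k + 1 : ℕ) : ℤ) + 1 + i = ((k + 1 + 1 + i : ℕ) : ℤ) by push_cast; ring,
      creationPart_coeff_nat, creationPart_coeff_nat, annCoeff_eq, annCoeff_eq, heis_succ,
      quadDerivation_X, quadCoeff, show k + 1 + 1 + j + i = k + 2 + i + j by ring,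
      show k + 1 + 1 + i + j = k + 2 + i + j by ring]
    simp only [smul_eq_C_mul, map_mul, map_add, map_pow, map_neg, map_one, map_natCast,
      map_intCast, Int.cast_mul, Int.cast_add, Int.cast_natCast, Int.cast_one]
    ring
  · intro r _
    exact Finset.sum_eq_zero fun s _ => if_neg (by omega)

/-! ### Strong generation of `M(1)^+` -/

lemma cast_choose_three (n : ℕ) : ((n.choose 3 : ℕ) : ℂ) = n * (n - 1) * (n - 2) / 6 := by
  induction n with
  | zero => simp
  | succ n ih =>
    rw [Nat.choose_succ_succ' n 2, Nat.cast_add, ih, Nat.cast_choose_two]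
    push_cast
    ring

lemma HasWeight.unique {d d' : ℤ} {f : Fock} (hf : f ≠ 0) (h : HasWeight d f)
    (h' : HasWeight d' f) : d = d' := by
  rw [HasWeight, h] at h'
  exact_mod_cast smul_left_injective ℂ hf h'

lemma coeff_fockTheta (s : ℕ →₀ ℕ) (f : Fock) :
    coeff s (fockTheta f) = (-1) ^ s.degree * coeff s f := by
  induction f using MvPolynomial.induction_on' with
  | monomial t c =>
    have h : (monomial t c : Fock) = c • monomial t 1 := by
      rw [smul_monomial, smul_eq_mul, mul_one]
    have hd : (Finsupp.toMultiset t).card = t.degree := by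
      rw [Finsupp.card_toMultiset]
      rfl
    rw [h, map_smul, fockTheta_monomial, hd, coeff_smul, coeff_smul, coeff_smul, coeff_monomial]
    split_ifs with hs
    · rw [hs]
      simp [mul_comm]
    · simp
  | add f g hf hg => rw [map_add, coeff_add, hf, hg, coeff_add, mul_add]

namespace WeakModule

variable {N : ℤ} {M : Type*} [AddCommGroup M] [Module ℂ M] {𝓜 : WeakModule (M1Plus N) M}

/-- Modulo derivatives, `α(-i-1) α(-j-1)`, `i + j = w + 1`, is a multiple of `α(-1) α(-w-2)`. -/
lemma pair_sub_mem_generatedFock {w : ℕ}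
    (h : ∀ i j : ℕ, i + j = w → X i * X j ∈ 𝓜.generatedFock (w + 2)) {i j : ℕ}
    (hij : i + j = w + 1) : X i * X j - ((-1 : ℂ) ^ i * ((w + 1).choose i : ℕ)) • (X 0 * X (w + 1))
      ∈ 𝓜.generatedFock (w + 3) := by
  induction i generalizing j with
  | zero =>
    obtain rfl : j = w + 1 := by omega
    simp
  | succ i ih =>
    have h1 := ih (j := j + 1) (by omega)
    have h2 := transl_mem_generatedFock (h i j (by omega))
    have hc : ((w + 1).choose (i + 1) * (i + 1) : ℂ) = (w + 1).choose i * (j + 1) := by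
      have := Nat.choose_succ_right_eq (w + 1) i
      rw [show w + 1 - i = j + 1 by omega] at this
      exact_mod_cast this
    have hi : ((i : ℂ) + 1) ≠ 0 := by exact_mod_cast Nat.succ_ne_zero i
    rw [← Submodule.smul_mem_iff _ hi]
    have h3 := Submodule.sub_mem _ h2 (Submodule.smul_mem _ ((j : ℂ) + 1) h1)
    convert h3 using 1
    have hc' := congrArg (C : ℂ → Fock) hc
    simp only [map_mul, map_add, map_natCast, map_one] at hc'
    simp only [Derivation.leibniz, transl_X, smul_eq_mul, smul_eq_C_mul, map_mul, map_add,
      map_natCast, map_one, map_pow, map_neg]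
    linear_combination ((-1) ^ i * X 0 * X (w + 1) : Fock) * hc'

/-- The difference of `(α(-1)²)_{-1} α(-2) α(-2v-2)` and `(α(-1) α(-2v-2))_{-1} α(-1) α(-2)`.  The
terms of degree four cancel. -/
lemma quad_sub_quad (N : ℤ) (v : ℕ) :
    quad N 0 0 0 0 (X 1 * X (2 * v + 1)) - quad N 0 0 (2 * v + 1) 0 (X 0 * X 1)
      = (4 * N : ℂ) • (X 3 * X (2 * v + 1)) + (2 * N * (2 * v + 2) : ℂ) • (X 1 * X (2 * v + 3))
        - (N * ((2 * v + 2).choose 2 : ℕ) : ℂ) • (X 1 * X (2 * v + 3))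
        - (2 * N * ((2 * v + 3).choose 3 : ℕ) : ℂ) • (X 0 * X (2 * v + 4)) := by
  have h0 : ∀ r, quadCoeff 0 0 r = 2 := by
    intro r
    simp [quadCoeff]
    norm_num
  have h1 : quadCoeff 0 (2 * v + 1) (0 + 1) = (2 * v + 2).choose 2 := by
    have h := Nat.choose_succ_succ' (2 * v + 2) (2 * v)
    rw [Nat.choose_symm_of_eq_add (show 2 * v + 2 = 2 * v + 2 from rfl)] at h
    simp only [quadCoeff, Odd.neg_one_pow ⟨v, rfl⟩]
    rw [show 0 + 1 + (2 * v + 1) = 2 * v + 2 by ring,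
      show 0 + 1 + 1 + 0 + (2 * v + 1) = 2 * v + 3 by ring,
      show 2 * v + 3 = 2 * v + 2 + 1 by ring, h]
    simp
    ring
  have h2 : quadCoeff 0 (2 * v + 1) (1 + 1) = (2 * v + 3).choose 3 := by
    have h := Nat.choose_succ_succ' (2 * v + 3) (2 * v)
    rw [Nat.choose_symm_of_eq_add (show 2 * v + 3 = 2 * v + 3 from rfl)] at h
    simp only [quadCoeff, Odd.neg_one_pow ⟨v, rfl⟩]
    rw [show 1 + 1 + (2 * v + 1) = 2 * v + 3 by ring,
      show 1 + 1 + 1 + 0 + (2 * v + 1) = 2 * v + 4 by ring,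
      show 2 * v + 4 = 2 * v + 3 + 1 by ring, h]
    simp
  rw [quad_zero_eq, quad_zero_eq, Derivation.leibniz, Derivation.leibniz]
  simp only [quadDerivation_X, h0, h1, h2]
  simp only [smul_eq_mul, smul_eq_C_mul, map_mul, map_add, map_natCast, map_one, map_intCast,
    map_ofNat, Nat.cast_add, Nat.cast_mul, Nat.cast_one, Nat.cast_ofNat, Nat.cast_zero]
  norm_num
  ring_nf

/-- The quadratic vectors are generated by `ω` and `J`. -/
lemma pair_mem_generatedFock (hN : N ≠ 0) (w : ℕ) :
    ∀ i j : ℕ, i + j = w → X i * X j ∈ 𝓜.generatedFock (w + 2) := by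
  induction w using Nat.strong_induction_on with
  | _ w ih =>
    rcases w with _ | w
    · intro i j hij
      obtain ⟨rfl, rfl⟩ : i = 0 ∧ j = 0 := by omega
      exact X_zero_mul_X_zero_mem_generatedFock hN
    have hsub : ∀ {i j : ℕ}, i + j = w + 1 → _ :=
      fun {i j} => pair_sub_mem_generatedFock (𝓜 := 𝓜) (i := i) (j := j) (ih w (by omega))
    suffices h : X 0 * X (w + 1) ∈ 𝓜.generatedFock (w + 3) by
      intro i j hij
      exact (Submodule.sub_mem_iff_left _ (Submodule.smul_mem _ _ h)).1 (hsub hij)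
    rcases Nat.even_or_odd' w with ⟨k, rfl | rfl⟩
    -- for odd `w + 1`, exchanging `i` and `j` shows that `α(-1) α(-w-2)` is a derivative
    · have h := hsub (i := 2 * k + 1) (j := 0) rfl
      rw [Nat.choose_self, Odd.neg_one_pow ⟨k, rfl⟩] at h
      have h2 : (2 : ℂ) • (X 0 * X (2 * k + 1) : Fock) ∈ 𝓜.generatedFock (2 * k + 3) := by
        convert h using 1
        simp only [smul_eq_C_mul, map_ofNat, map_mul, map_neg, map_one, Nat.cast_one]
        ring
      exact (Submodule.smul_mem_iff _ two_ne_zero).1 h2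
    rcases k with _ | v
    · exact X_zero_mul_X_two_mem_generatedFock
    -- for even `w + 1 ≥ 4`, two products with the same term of degree four differ by a non-zero
    -- multiple of `α(-1) α(-w-2)`, modulo derivatives
    have hA := quad_mem_generatedFock le_rfl (ih 0 (by omega) 0 0 rfl)
      (ih (2 * v + 2) (by omega) 1 (2 * v + 1) (by ring))
    have h0 := ih (2 * v + 1) (by omega) 0 (2 * v + 1) (by ring)
    have hB := quad_mem_generatedFock (Nat.zero_le _) h0 (ih 1 (by omega) 0 1 (by ring))
    rw [show 0 + 2 + (2 * v + 2 + 2) = 2 * v + 6 by ring] at hA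
    rw [show 2 * v + 1 + 2 + (1 + 2) = 2 * v + 6 by ring] at hB
    have hD := Submodule.sub_mem _ hA hB
    rw [quad_sub_quad] at hD
    have h3 := hsub (i := 3) (j := 2 * v + 1) (by ring)
    have h1 := hsub (i := 1) (j := 2 * v + 3) (by ring)
    rw [show 2 * (v + 1) + 1 + 3 = 2 * v + 6 by ring, show 2 * (v + 1) + 1 + 1 = 2 * v + 4 by ring]
      at h3 h1
    rw [show 2 * (v + 1) + 1 + 3 = 2 * v + 6 by ring, show 2 * (v + 1) + 1 + 1 = 2 * v + 4 by ring]
    have hK : (-(N * ((2 * v + 2) * (2 * v + 5) * (2 * v + 6)) / 2) : ℂ) ≠ 0 := by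
      have hN' : (N : ℂ) ≠ 0 := by exact_mod_cast hN
      have hv : (((2 * v + 2) * (2 * v + 5) * (2 * v + 6) : ℕ) : ℂ) ≠ 0 :=
        Nat.cast_ne_zero.2 (by positivity)
      push_cast at hv
      exact neg_ne_zero.2 (div_ne_zero (mul_ne_zero hN' hv) two_ne_zero)
    rw [← Submodule.smul_mem_iff _ hK]
    have h := Submodule.sub_mem _ (Submodule.sub_mem _ hD (Submodule.smul_mem _ (4 * N : ℂ) h3))
      (Submodule.smul_mem _ (2 * N * (2 * v + 2) - N * ((2 * v + 2).choose 2 : ℕ) : ℂ) h1)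
    convert h using 1
    rw [cast_choose_three, cast_choose_three, Nat.cast_choose_two, Nat.choose_one_right]
    push_cast
    module

/-- The vectors of polynomial degree `2 m` are generated by `ω` and `J`: the product of a quadratic
vector and a vector of degree `2 m` is their `-1`-th product up to a term of degree `2 m`. -/
lemma isHomogeneous_mem_generatedFock (hN : N ≠ 0) (m : ℕ) : ∀ (d : ℕ) (f : Fock),
    f.IsHomogeneous (2 * m) → HasWeight d f → f ∈ 𝓜.generatedFock d := by
  have hred : ∀ (m d : ℕ), (∀ s : ℕ →₀ ℕ, s.degree = 2 * m → monoWeight s = d →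
      (monomial s 1 : Fock) ∈ 𝓜.generatedFock d) → ∀ f : Fock,
      f.IsHomogeneous (2 * m) → HasWeight d f → f ∈ 𝓜.generatedFock d := by
    intro m d h f hf hd
    rw [f.as_sum]
    refine Submodule.sum_mem _ fun s hs => ?_
    rw [← mul_one (coeff s f), ← smul_eq_mul, ← smul_monomial]
    refine Submodule.smul_mem _ _ (h s ?_ (by exact_mod_cast hd.eq_of_mem_support hs))
    by_contra h
    exact mem_support_iff.1 hs (hf.coeff_eq_zero h)
  have hmono : ∀ (i j : ℕ) (t : ℕ →₀ ℕ) (s : ℕ →₀ ℕ),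
      (monomial s 1 : Fock) = X i * X j * monomial t 1 →
      monoWeight s = i + j + 2 + monoWeight t := by
    intro i j t s h
    have h1 := hasWeight_monomial s 1
    have hX : ∀ k : ℕ, HasWeight ((k + 1 : ℕ) : ℤ) (X k : Fock) := fun k => by
      rw [HasWeight, euler_X]
      push_cast
      rfl
    have h2 := ((hX i).mul (hX j)).mul (hasWeight_monomial t 1)
    rw [← h] at h2
    have h3 := h1.unique (by simp) h2
    push_cast at h3
    omega
  induction m with
  | zero =>
    intro d
    refine hred 0 d fun s hs hd => ?_
    obtain rfl := (Finsupp.degree_eq_zero_iff s).1 (by simpa using hs)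
    obtain rfl : d = 0 := by rw [← hd]; simp [monoWeight]
    exact one_mem_generatedFock
  | succ m ih =>
    intro d
    refine hred (m + 1) d fun s hs hd => ?_
    obtain ⟨i, j, t, hij, ht, hst⟩ := monomial_eq_mul_of_degree s (d := 2 * m) (by omega)
    have hw := hmono i j t s hst
    have hX := pair_mem_generatedFock (𝓜 := 𝓜) hN (i + j) i j rfl
    rcases Nat.eq_zero_or_pos m with rfl | hm
    · obtain rfl := (Finsupp.degree_eq_zero_iff t).1 (by simpa using ht)
      rw [hst, show (monomial 0 1 : Fock) = 1 from rfl, mul_one]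
      convert hX using 2
      rw [← hd, hw]
      simp [monoWeight]
    · have ht' : (monomial t 1 : Fock).IsHomogeneous (2 * m) := isHomogeneous_monomial 1 ht
      have h1 := quad_mem_generatedFock hij hX (ih _ _ ht' (hasWeight_monomial t 1))
      rw [← hw, hd, quad_zero_eq, ← hst] at h1
      refine (Submodule.add_mem_iff_left _ (ih d _ ?_ ?_)).1 h1
      all_goals
        obtain ⟨R, hR⟩ := exists_vars_subset (monomial t 1 : Fock)
        rw [derivation_eq_sum _ hR]
      · refine IsHomogeneous.sum _ _ _ fun r _ => ?_
        rw [quadDerivation_X, smul_eq_C_mul]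
        have h := ((isHomogeneous_X ℂ (r + 2 + i + j)).C_mul
          ((N : ℂ) * (r + 1) * quadCoeff i j (r + 1))).mul (ht'.pderiv (i := r))
        convert h using 1
        omega
      · refine HasWeight.sum _ fun r _ => ?_
        rw [quadDerivation_X]
        have h1 : HasWeight (r + 2 + i + j + 1) (X (r + 2 + i + j) : Fock) := by
          rw [HasWeight, euler_X]
          push_cast
          rfl
        have h2 : HasWeight (monoWeight t - (r + 1)) (pderiv r (monomial t (1 : ℂ))) := by
          rw [HasWeight, euler_pderiv, euler_monomial, Derivation.map_smul]
          push_cast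
          module
        have h := (h1.smul ((N : ℂ) * (r + 1) * quadCoeff i j (r + 1))).mul h2
        convert h using 1
        rw [← hd, hw]
        push_cast
        ring

/-- `M(1)^+` is strongly generated by `ω` and `J`: the modes of a homogeneous vector are given by
words in `L(s)`, `J(s)` which do not exceed its weight. -/
theorem exists_words_of_isHomogeneous (hN : N ≠ 0) {d : ℕ} {a : M1Plus N}
    (ha : VertexSubalgebra.IsHomogeneous d a) : 𝓜.IsGenerated d a := by
  obtain ⟨f, hf, hev⟩ := exists_val_eq_single a
  have hd := (isHomogeneous_iff hN hf).1 ha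
  have hmem : f ∈ 𝓜.generatedFock d := by
    rw [f.as_sum]
    refine Submodule.sum_mem _ fun s hs => ?_
    have hdeg : Even s.degree := by
      by_contra h
      rw [Nat.not_even_iff_odd] at h
      have h1 := congrArg (coeff s) hev
      rw [coeff_fockTheta, h.neg_one_pow, neg_one_mul] at h1
      exact mem_support_iff.1 hs (self_eq_neg.1 h1.symm)
    obtain ⟨m, hm⟩ := hdeg.two_dvd
    refine isHomogeneous_mem_generatedFock hN m d _ (isHomogeneous_monomial _ hm) ?_
    rw [← hd.eq_of_mem_support hs]
    exact hasWeight_monomial s _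
  obtain ⟨b, hb, hb'⟩ := hmem
  obtain rfl : a = b := VertexSubalgebra.val_injective _ (hf.trans hb.symm)
  exact hb'

end WeakModule

/-! ### The span of the words on a highest weight vector -/

namespace WeakModule

variable {N : ℤ} {M : Type*} [AddCommGroup M] [Module ℂ M] {𝓜 : WeakModule (M1Plus N) M}

lemma genWeight_pos (g : Bool) : 0 < genWeight g := by
  cases g <;> simp [genWeight]

lemma omega_one_mul_generator (hN : N ≠ 0) (g : Bool) :
    (M1Plus N).mul (omegaM1Plus N) 1 (generator N g) = (genWeight g : ℂ) • generator N g := by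
  cases g with
  | false => exact_mod_cast (omega_mul_omega hN).1
  | true => exact_mod_cast (omega_mul_quartic hN).1

lemma isHomogeneous_generator (hN : N ≠ 0) (g : Bool) :
    VertexSubalgebra.IsHomogeneous (genWeight g) (generator N g) := by
  have h := congrArg (M1Plus N).val (omega_one_mul_generator hN g)
  rw [map_smul] at h
  rw [VertexSubalgebra.IsHomogeneous, Int.cast_natCast]
  exact h

/-- The commutator of two letters is given by words of lower weight. -/
lemma letter_letter (hN : N ≠ 0) (𝓜 : WeakModule (M1Plus N) M) (x y : Bool × ℤ) (u : M) :
    ∃ T ∈ 𝓜.words (genWeight x.1 + genWeight y.1 - 1) (x.2 + y.2),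
      𝓜.letter x (𝓜.letter y u) = 𝓜.letter y (𝓜.letter x u) + T u := by
  set D := genWeight x.1 + genWeight y.1 with hD
  have hhom : ∀ i : ℕ, VertexSubalgebra.IsHomogeneous ((D : ℤ) - i - 1)
      ((M1Plus N).mul (generator N x.1) i (generator N y.1)) := by
    intro i
    rw [hD, Nat.cast_add]
    exact (isHomogeneous_generator hN x.1).mul hN (isHomogeneous_generator hN y.1) i
  have h := 𝓜.act_commutator (T := D)
    (fun i hi => eq_zero_of_isHomogeneous_neg hN (by omega) (hhom i))
    (x.2 + genWeight x.1 - 1) (y.2 + genWeight y.1 - 1) u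
  have hT : ∀ i : ℕ, ∃ T ∈ 𝓜.words (D - 1) (x.2 + y.2), i < D →
      𝓜.act ((M1Plus N).mul (generator N x.1) i (generator N y.1))
        (x.2 + genWeight x.1 - 1 + (y.2 + genWeight y.1 - 1) - i) u = T u := by
    intro i
    by_cases hi : i < D
    · have hi' := hhom i
      rw [show (D : ℤ) - i - 1 = ((D - 1 - i : ℕ) : ℤ) by omega] at hi'
      obtain ⟨T, hT, hTu⟩ := exists_words_of_isHomogeneous (𝓜 := 𝓜) hN hi'
        (x.2 + genWeight x.1 - 1 + (y.2 + genWeight y.1 - 1) - i) u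
      refine ⟨T, ?_, fun _ => hTu⟩
      refine words_mono (show D - 1 - i ≤ D - 1 by omega) _ ?_
      convert hT using 2
      omega
    · exact ⟨0, Submodule.zero_mem _, fun h => absurd h hi⟩
  choose T hTm hTu using hT
  refine ⟨∑ i ∈ Finset.range D, Ring.choose (x.2 + genWeight x.1 - 1) i • T i,
    Submodule.sum_mem _ fun i _ => zsmul_mem (hTm i) _, ?_⟩
  rw [sub_eq_iff_eq_add] at h
  refine h.trans ((add_comm _ _).trans ?_)
  rw [LinearMap.sum_apply]
  refine congrArg₂ _ rfl (Finset.sum_congr rfl fun i hi => ?_)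
  rw [hTu i (Finset.mem_range.1 hi)]
  rfl

/-- `z` is annihilated by `L(s)` and `J(s)`, `s > 0`, and is an eigenvector of `L(0)`, `J(0)`. -/
structure IsHighestWeight (𝓜 : WeakModule (M1Plus N) M) (z : M) : Prop where
  pos : ∀ x : Bool × ℤ, 0 < x.2 → 𝓜.letter x z = 0
  zero : ∀ g : Bool, ∃ c : ℂ, 𝓜.letter (g, 0) z = c • z

/-- The span of the vectors `T z` for the words `T` of index `s` and weight at most `w` in the
letters of negative index. -/
def negWords (𝓜 : WeakModule (M1Plus N) M) (z : M) (w : ℕ) (s : ℤ) : Submodule ℂ M :=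
  Submodule.span ℂ {y | ∃ l : List (Bool × ℤ), (∀ x ∈ l, x.2 < 0) ∧ wordWeight l ≤ w ∧
    wordIndex l = s ∧ 𝓜.word l z = y}

variable {z : M}

lemma negWords_mono {w w' : ℕ} (h : w ≤ w') (s : ℤ) : 𝓜.negWords z w s ≤ 𝓜.negWords z w' s := by
  refine Submodule.span_mono ?_
  rintro _ ⟨l, hl, hl', hs, rfl⟩
  exact ⟨l, hl, hl'.trans h, hs, rfl⟩

lemma word_cons (x : Bool × ℤ) (l : List (Bool × ℤ)) : 𝓜.word (x :: l) = 𝓜.letter x * 𝓜.word l := by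
  simp [word]

lemma wordWeight_cons (x : Bool × ℤ) (l : List (Bool × ℤ)) :
    wordWeight (x :: l) = genWeight x.1 + wordWeight l := by
  simp [wordWeight]

lemma wordIndex_cons (x : Bool × ℤ) (l : List (Bool × ℤ)) :
    wordIndex (x :: l) = x.2 + wordIndex l := by
  simp [wordIndex]

lemma letter_mem_negWords {x : Bool × ℤ} (hx : x.2 < 0) {w : ℕ} {s : ℤ} {u : M}
    (hu : u ∈ 𝓜.negWords z w s) : 𝓜.letter x u ∈ 𝓜.negWords z (genWeight x.1 + w) (x.2 + s) := by
  induction hu using Submodule.span_induction with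
  | mem u hu =>
    obtain ⟨l, hl, hw, hs, rfl⟩ := hu
    refine Submodule.subset_span ⟨x :: l, ?_, ?_, ?_, ?_⟩
    · exact List.forall_mem_cons.2 ⟨hx, hl⟩
    · rw [wordWeight_cons]
      omega
    · rw [wordIndex_cons, hs]
    · rw [word_cons]
      rfl
  | zero => rw [map_zero]; exact Submodule.zero_mem _
  | add u v _ _ hu hv => rw [map_add]; exact Submodule.add_mem _ hu hv
  | smul c u _ hu => rw [map_smul]; exact Submodule.smul_mem _ c hu

/-- Words with letters of arbitrary index, applied to `z`, are combinations of words with letters of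
negative index: moving a letter of non-negative index to the right produces words of lower
weight. -/
lemma apply_mem_negWords (hN : N ≠ 0) (hz : 𝓜.IsHighestWeight z) (w : ℕ) :
    ∀ (s : ℤ), ∀ T ∈ 𝓜.words w s, T z ∈ 𝓜.negWords z w s := by
  induction w using Nat.strong_induction_on with
  | _ w ih =>
    have hletter : ∀ (x : Bool × ℤ) (l : List (Bool × ℤ)), (∀ y ∈ l, y.2 < 0) →
        genWeight x.1 + wordWeight l ≤ w →
        𝓜.letter x (𝓜.word l z) ∈ 𝓜.negWords z w (x.2 + wordIndex l) := by
      intro x l hl hw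
      rcases lt_or_ge x.2 0 with hx | hx
      · refine Submodule.subset_span ⟨x :: l, ?_, ?_, ?_, ?_⟩
        · exact List.forall_mem_cons.2 ⟨hx, hl⟩
        · rwa [wordWeight_cons]
        · rw [wordIndex_cons]
        · rw [word_cons]
          rfl
      · cases l with
        | nil =>
          rcases hx.eq_or_lt with hx | hx
          · obtain ⟨c, hc⟩ := hz.zero x.1
            have hx' : x = (x.1, 0) := Prod.ext rfl hx.symm
            have h1 : 𝓜.letter x (𝓜.word [] z) = c • z := by
              rw [hx', ← hc]
              simp [word]
            rw [h1]
            refine Submodule.smul_mem _ c (Submodule.subset_span ⟨[], by simp, ?_, ?_, ?_⟩)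
            · simp [wordWeight]
            · rw [← hx, zero_add]
            · simp [word]
          · have h1 : 𝓜.letter x (𝓜.word [] z) = 0 := by
              simpa [word] using hz.pos x hx
            rw [h1]
            exact Submodule.zero_mem _
        | cons y l =>
          have hy : y.2 < 0 := hl y (by simp)
          have hyw := genWeight_pos y.1
          have hxw := genWeight_pos x.1
          rw [wordWeight_cons] at hw
          obtain ⟨T, hT, h⟩ := 𝓜.letter_letter hN x y (𝓜.word l z)
          rw [word_cons, Module.End.mul_apply, h]
          refine Submodule.add_mem _ ?_ ?_
          · have h1 := ih (wordWeight (x :: l)) (by rw [wordWeight_cons]; omega) _ _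
              (word_mem_words (𝓜 := 𝓜) (l := x :: l) le_rfl rfl)
            rw [word_cons, Module.End.mul_apply] at h1
            have h2 := letter_mem_negWords hy h1
            refine negWords_mono ?_ _ (?_ : _ ∈ 𝓜.negWords z
              (genWeight y.1 + wordWeight (x :: l)) _)
            · rw [wordWeight_cons]
              omega
            · convert h2 using 2
              rw [wordIndex_cons, wordIndex_cons]
              ring
          · have h1 := ih _ (by omega) _ _ (mul_mem_words hT
              (word_mem_words (𝓜 := 𝓜) (l := l) le_rfl rfl))
            rw [Module.End.mul_apply] at h1
            refine negWords_mono
              (show genWeight x.1 + genWeight y.1 - 1 + wordWeight l ≤ w by omega) _ ?_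
            convert h1 using 2
            rw [wordIndex_cons]
            ring
    intro s T hT
    induction hT using Submodule.span_induction with
    | zero => exact Submodule.zero_mem _
    | add T T' _ _ h h' => exact Submodule.add_mem _ h h'
    | smul c T _ h => exact Submodule.smul_mem _ c h
    | mem T hT =>
      obtain ⟨l, hw, rfl, rfl⟩ := hT
      cases l with
      | nil =>
        refine Submodule.subset_span ⟨[], by simp, hw, rfl, rfl⟩
      | cons x l =>
        have hxw := genWeight_pos x.1
        rw [wordWeight_cons] at hw
        have h1 := ih (wordWeight l) (by omega) _ _ (word_mem_words (𝓜 := 𝓜) (l := l) le_rfl rfl)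
        rw [word_cons, Module.End.mul_apply, wordIndex_cons]
        generalize 𝓜.word l z = u at h1
        induction h1 using Submodule.span_induction with
        | zero => rw [map_zero]; exact Submodule.zero_mem _
        | add u v _ _ hu hv => rw [map_add]; exact Submodule.add_mem _ hu hv
        | smul c u _ hu => rw [map_smul]; exact Submodule.smul_mem _ c hu
        | mem u hu =>
          obtain ⟨l', hl', hw', hs', rfl⟩ := hu
          rw [← hs']
          exact hletter x l' hl' (by omega)

/-- The span of the vectors `T z` for the words `T` of index `s` in letters of negative index. -/
def level (𝓜 : WeakModule (M1Plus N) M) (z : M) (s : ℤ) : Submodule ℂ M :=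
  Submodule.span ℂ {y | ∃ l : List (Bool × ℤ), (∀ x ∈ l, x.2 < 0) ∧ wordIndex l = s ∧
    𝓜.word l z = y}

lemma negWords_le_level (w : ℕ) (s : ℤ) : 𝓜.negWords z w s ≤ 𝓜.level z s := by
  refine Submodule.span_mono ?_
  rintro _ ⟨l, hl, -, hs, rfl⟩
  exact ⟨l, hl, hs, rfl⟩

lemma act_mem_level (hN : N ≠ 0) (hz : 𝓜.IsHighestWeight z) {d : ℤ} {a : M1Plus N}
    (ha : VertexSubalgebra.IsHomogeneous d a) (n : ℤ) {s : ℤ} {u : M} (hu : u ∈ 𝓜.level z s) :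
    𝓜.act a n u ∈ 𝓜.level z (s + n + 1 - d) := by
  rcases lt_or_ge d 0 with hd | hd
  · rw [eq_zero_of_isHomogeneous_neg hN hd ha, act_zero_vec]
    exact Submodule.zero_mem _
  obtain ⟨d, rfl⟩ := Int.eq_ofNat_of_zero_le hd
  induction hu using Submodule.span_induction with
  | zero => rw [map_zero]; exact Submodule.zero_mem _
  | add u v _ _ hu hv => rw [map_add]; exact Submodule.add_mem _ hu hv
  | smul c u _ hu => rw [map_smul]; exact Submodule.smul_mem _ c hu
  | mem u hu =>
    obtain ⟨l, hl, hs, rfl⟩ := hu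
    obtain ⟨T, hT, h⟩ := exists_words_of_isHomogeneous (𝓜 := 𝓜) hN ha n (𝓜.word l z)
    rw [h, ← Module.End.mul_apply]
    refine negWords_le_level _ _ (?_ : _ ∈ 𝓜.negWords z (d + wordWeight l) _)
    refine apply_mem_negWords hN hz _ _ _ ?_
    convert mul_mem_words hT (word_mem_words (𝓜 := 𝓜) (l := l) le_rfl rfl) using 2
    rw [hs]
    ring

lemma wordIndex_neg {l : List (Bool × ℤ)} (hl : ∀ x ∈ l, x.2 < 0) (h : l ≠ []) :
    wordIndex l < 0 := by
  induction l with
  | nil => exact absurd rfl h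
  | cons x l ih =>
    rw [wordIndex_cons]
    have hx := hl x (by simp)
    rcases eq_or_ne l [] with rfl | hl'
    · simpa [wordIndex] using hx
    · have := ih (fun y hy => hl y (by simp [hy])) hl'
      omega

lemma level_of_pos {s : ℤ} (hs : 0 < s) : 𝓜.level z s = ⊥ := by
  rw [level, Submodule.span_eq_bot]
  rintro _ ⟨l, hl, hl', rfl⟩
  rcases eq_or_ne l [] with rfl | h
  · simp [wordIndex] at hl'
    omega
  · have := wordIndex_neg hl h
    omega

lemma level_zero : 𝓜.level z 0 = Submodule.span ℂ {z} := by
  rw [level]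
  congr 1
  ext y
  constructor
  · rintro ⟨l, hl, hl', rfl⟩
    rcases eq_or_ne l [] with rfl | h
    · simp [word]
    · have := wordIndex_neg hl h
      omega
  · rintro rfl
    exact ⟨[], by simp, by simp [wordIndex], by simp [word]⟩

/-- There are finitely many words in letters of negative index with bounded total index. -/
lemma finite_negative_words (n : ℕ) :
    {l : List (Bool × ℤ) | (∀ x ∈ l, x.2 < 0) ∧ -(n : ℤ) ≤ wordIndex l}.Finite := by
  induction n with
  | zero =>
    refine (Set.finite_singleton []).subset ?_
    rintro l ⟨hl, h⟩
    by_contra hne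
    have := wordIndex_neg hl hne
    simp at h
    omega
  | succ n ih =>
    have h2 := Set.Finite.image2 List.cons
      ((Set.finite_univ (α := Bool)).prod (Set.finite_Icc (-(n + 1 : ℤ)) 0)) ih
    refine ((Set.finite_singleton []).union h2).subset ?_
    rintro l ⟨hl, h⟩
    cases l with
    | nil => left; rfl
    | cons x l =>
      right
      have hx := hl x (by simp)
      have hl' : ∀ y ∈ l, y.2 < 0 := fun y hy => hl y (by simp [hy])
      have hle : wordIndex l ≤ 0 := by
        rcases eq_or_ne l [] with rfl | hne
        · simp [wordIndex]
        · exact (wordIndex_neg hl' hne).le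
      rw [wordIndex_cons] at h
      push_cast at h
      refine ⟨x, ⟨Set.mem_univ _, ?_, ?_⟩, l, ⟨hl', ?_⟩, rfl⟩ <;> omega

lemma finiteDimensional_level (s : ℤ) : FiniteDimensional ℂ (𝓜.level z s) := by
  refine FiniteDimensional.span_of_finite ℂ ?_
  refine ((finite_negative_words s.natAbs).image fun l => 𝓜.word l z).subset ?_
  rintro _ ⟨l, hl, hs, rfl⟩
  exact ⟨l, ⟨hl, by omega⟩, rfl⟩

lemma level_le_eigenspace (hN : N ≠ 0) {h : ℂ} (hh : 𝓜.act (omegaM1Plus N) 1 z = h • z) (s : ℤ) :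
    𝓜.level z s ≤ Module.End.eigenspace (𝓜.act (omegaM1Plus N) 1) (h - s) := by
  rw [level, Submodule.span_le]
  rintro _ ⟨l, -, rfl, rfl⟩
  rw [SetLike.mem_coe, Module.End.mem_eigenspace_iff]
  induction l with
  | nil => simpa [word, wordIndex] using hh
  | cons x l ih =>
    rw [word_cons, Module.End.mul_apply, letter,
      𝓜.act_omega_one_commutator hN rfl (omega_one_mul_generator hN x.1), ih, map_smul,
      wordIndex_cons]
    push_cast
    module

end WeakModule

/-! ### The Zhu algebra module and the ordinary module -/

/-- The projection of `M(1)` to `M(1)^+`. -/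
def evenPart (N : ℤ) : Fock →ₗ[ℂ] M1Plus N :=
  LinearMap.codRestrict (M1Plus N).toSubmodule
    (Finsupp.lsingle 0 ∘ₗ ((1 / 2 : ℂ) • (LinearMap.id + fockTheta.toLinearMap))) fun f => by
      refine ⟨⟨_, rfl⟩, ?_⟩
      change _ ∈ (VLPlus N).toSubmodule
      rw [mem_VLPlus, LinearMap.comp_apply, Finsupp.lsingle_apply, theta_single, neg_zero]
      simp [fockTheta_fockTheta, add_comm]

lemma val_evenPart (N : ℤ) (f : Fock) :
    (M1Plus N).val (evenPart N f) = Finsupp.single 0 ((1 / 2 : ℂ) • (f + fockTheta f)) := rfl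

lemma evenPart_eq {N : ℤ} {a : M1Plus N} {f : Fock} (h : (M1Plus N).val a = Finsupp.single 0 f)
    (hf : fockTheta f = f) : evenPart N f = a := by
  apply VertexSubalgebra.val_injective
  rw [val_evenPart, h, hf]
  congr 1
  module

lemma isHomogeneous_evenPart_monomial {N : ℤ} (hN : N ≠ 0) (s : ℕ →₀ ℕ) :
    VertexSubalgebra.IsHomogeneous (monoWeight s) (evenPart N (monomial s 1)) := by
  rw [isHomogeneous_iff hN (val_evenPart N _), fockTheta_monomial]
  exact ((hasWeight_monomial s 1).add ((hasWeight_monomial s 1).smul _)).smul _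

lemma evenPart_eq_sum (N : ℤ) (f : Fock) :
    evenPart N f = ∑ s ∈ f.support, coeff s f • evenPart N (monomial s 1) := by
  conv_lhs => rw [f.as_sum]
  rw [map_sum]
  refine Finset.sum_congr rfl fun s _ => ?_
  rw [← map_smul, smul_monomial, smul_eq_mul, mul_one]

/-- `M(1)^+` is spanned by homogeneous vectors. -/
lemma homogeneous_induction {N : ℤ} (hN : N ≠ 0) {p : M1Plus N → Prop} (a : M1Plus N)
    (hom : ∀ (d : ℤ) (a : M1Plus N), VertexSubalgebra.IsHomogeneous d a → p a) (zero : p 0)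
    (add : ∀ a b, p a → p b → p (a + b)) (smul : ∀ (c : ℂ) (a), p a → p (c • a)) : p a := by
  obtain ⟨f, hf, hf'⟩ := exists_val_eq_single a
  rw [← evenPart_eq hf hf', evenPart_eq_sum]
  exact Finset.sum_induction _ p add zero fun s _ =>
    smul _ _ (hom _ _ (isHomogeneous_evenPart_monomial hN s))

namespace WeakModule

variable {N : ℤ} {M : Type*} [AddCommGroup M] [Module ℂ M]

/-- `o(a) = a_{wt a - 1}` preserves `Ω`. -/
lemma act_mem_Omega (hN : N ≠ 0) (𝓜 : WeakModule (M1Plus N) M) {d : ℤ} {a : M1Plus N}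
    (ha : VertexSubalgebra.IsHomogeneous d a) {u : M} (hu : u ∈ 𝓜.Omega) :
    𝓜.act a (d - 1) u ∈ 𝓜.Omega := by
  intro d' b hb i hi
  obtain ⟨T, hT⟩ := VertexSubalgebra.exists_mul_eq_zero b a
  have h := 𝓜.act_commutator (T := T) (fun i hi => hT i (by omega)) i (d - 1) u
  rw [hu d' b hb i hi, map_zero, sub_zero] at h
  rw [h]
  refine Finset.sum_eq_zero fun j _ => ?_
  rw [hu _ _ (hb.mul hN ha j) _ (by omega), smul_zero]

/-- The operator `o(a)` on `Ω`, for `a` the projection of a monomial to `M(1)^+`. -/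
def zeroModeMonomial (hN : N ≠ 0) (𝓜 : WeakModule (M1Plus N) M) (s : ℕ →₀ ℕ) :
    Module.End ℂ 𝓜.Omega :=
  (𝓜.act (evenPart N (monomial s 1)) (monoWeight s - 1)).restrict fun _ hu =>
    𝓜.act_mem_Omega hN (isHomogeneous_evenPart_monomial hN s) hu

/-- The linear map `a ↦ o(a)`, the extension to `M(1)^+` of `o(a) = a_{wt a - 1}` for homogeneous
`a`. -/
def zeroMode (hN : N ≠ 0) (𝓜 : WeakModule (M1Plus N) M) : M1Plus N →ₗ[ℂ] Module.End ℂ 𝓜.Omega :=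
  (MvPolynomial.basisMonomials ℕ ℂ).constr ℂ (𝓜.zeroModeMonomial hN) ∘ₗ Finsupp.lapply 0
    ∘ₗ (M1Plus N).val

lemma zeroMode_apply (hN : N ≠ 0) (𝓜 : WeakModule (M1Plus N) M) {d : ℤ} {a : M1Plus N}
    (ha : VertexSubalgebra.IsHomogeneous d a) (u : 𝓜.Omega) :
    (𝓜.zeroMode hN a u : M) = 𝓜.act a (d - 1) u := by
  obtain ⟨f, hf, hf'⟩ := exists_val_eq_single a
  have hd := (isHomogeneous_iff hN hf).1 ha
  have h1 : 𝓜.zeroMode hN a = ∑ s ∈ f.support, coeff s f • 𝓜.zeroModeMonomial hN s := by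
    rw [zeroMode, LinearMap.comp_apply, LinearMap.comp_apply, hf, Finsupp.lapply_apply,
      Finsupp.single_eq_same]
    conv_lhs => rw [f.as_sum]
    rw [map_sum]
    refine Finset.sum_congr rfl fun s _ => ?_
    have h : (monomial s (coeff s f) : Fock) = coeff s f • MvPolynomial.basisMonomials ℕ ℂ s := by
      rw [coe_basisMonomials, smul_monomial, smul_eq_mul, mul_one]
    rw [h, map_smul, Module.Basis.constr_basis]
  have h2 : 𝓜.act a (d - 1) = ∑ s ∈ f.support,
      coeff s f • 𝓜.act (evenPart N (monomial s 1)) (d - 1) := by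
    have hlin : ∀ (t : Finset (ℕ →₀ ℕ)) (v : (ℕ →₀ ℕ) → M1Plus N),
        𝓜.act (∑ s ∈ t, v s) (d - 1) = ∑ s ∈ t, 𝓜.act (v s) (d - 1) := by
      intro t v
      induction t using Finset.induction_on with
      | empty => rw [Finset.sum_empty, Finset.sum_empty, act_zero_vec]
      | insert s t hs ih => rw [Finset.sum_insert hs, Finset.sum_insert hs, act_add_vec, ih]
    rw [← evenPart_eq hf hf', evenPart_eq_sum, hlin]
    exact Finset.sum_congr rfl fun s _ => act_smul_vec _ _ _ _
  rw [h1, h2, LinearMap.sum_apply, LinearMap.sum_apply, AddSubmonoidClass.coe_finsetSum]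
  refine Finset.sum_congr rfl fun s hs => ?_
  rw [← hd.eq_of_mem_support hs]
  rfl

lemma zhu_sum_eq {a b : M1Plus N} (d : ℕ) (l : ℤ) :
    ∑ᶠ i : ℕ, Ring.choose (d : ℤ) i • (M1Plus N).mul a (l + i) b
      = ∑ i ∈ Finset.range (d + 1), Ring.choose (d : ℤ) i • (M1Plus N).mul a (l + i) b := by
  refine finsum_eq_sum_of_support_subset _ fun i hi => ?_
  by_contra h
  simp only [Finset.coe_range, Set.mem_Iio, not_lt] at h
  apply hi
  simp only
  rw [Ring.choose_natCast, Nat.choose_eq_zero_of_lt (by omega), Nat.cast_zero, zero_smul]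

/-- The Jacobi identity on `Ω`: a weighted sum of the products `a_{l+i} b`, `l < 0`. -/
lemma zeroMode_zhu_sum (hN : N ≠ 0) (𝓜 : WeakModule (M1Plus N) M) {d : ℕ} {d' : ℤ} {a b : M1Plus N}
    (ha : VertexSubalgebra.IsHomogeneous d a) (hb : VertexSubalgebra.IsHomogeneous d' b) (l : ℕ)
    (u : 𝓜.Omega) :
    (𝓜.zeroMode hN (∑ᶠ i : ℕ, Ring.choose (d : ℤ) i • (M1Plus N).mul a (-(l + 1 : ℤ) + i) b) u : M)
      = if l = 0 then 𝓜.act a (d - 1) (𝓜.act b (d' - 1) u) else 0 := by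
  have h := 𝓜.jacobi a b u (-(l + 1 : ℤ)) d (d' - 1 + l)
  rw [finsum_eq_sum_of_support_subset (s := Finset.range (d + 1)), finsum_eq_single _ 0] at h
  · rw [zhu_sum_eq, map_sum, LinearMap.sum_apply, AddSubmonoidClass.coe_finsetSum]
    have h1 : ∀ i ∈ Finset.range (d + 1),
        (𝓜.zeroMode hN (Ring.choose (d : ℤ) i • (M1Plus N).mul a (-(l + 1 : ℤ) + i) b) u : M)
        = Ring.choose (d : ℤ) i • 𝓜.act ((M1Plus N).mul a (-(l + 1 : ℤ) + i) b)
            (d + (d' - 1 + l) - i) u := by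
      intro i _
      rw [map_zsmul, LinearMap.smul_apply]
      change Ring.choose (d : ℤ) i • (𝓜.zeroMode hN _ u : M) = _
      rw [𝓜.zeroMode_apply hN (ha.mul hN hb _)]
      congr 3
      ring
    rw [Finset.sum_congr rfl h1]
    refine h.trans ?_
    simp only [pow_zero, Ring.choose_zero_right, one_mul, one_smul, Nat.cast_zero, sub_zero,
      add_zero]
    change 𝓜.act a _ (𝓜.act b _ u) - _ • 𝓜.act b _ (𝓜.act a d u) = _
    rw [u.2 d a ha d (by omega), map_zero, smul_zero, sub_zero]
    split_ifs with hl
    · subst hl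
      rw [show -(((0 : ℕ) : ℤ) + 1) + d = d - 1 by push_cast; ring,
        show d' - 1 + ((0 : ℕ) : ℤ) = d' - 1 by simp]
    · rw [u.2 d' b hb _ (by omega), map_zero]
  · intro i hi
    change _ • (𝓜.act a _ (𝓜.act b _ u) - _ • 𝓜.act b _ (𝓜.act a (d + i) u)) = 0
    rw [u.2 d a ha _ (by omega), u.2 d' b hb _ (by omega)]
    simp
  · intro i hi
    by_contra h'
    simp only [Finset.coe_range, Set.mem_Iio, not_lt] at h'
    apply hi
    simp only
    rw [Ring.choose_natCast, Nat.choose_eq_zero_of_lt (by omega), Nat.cast_zero, zero_smul]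

/-- If `F b` is given by `l = 0` or `l > 0` in `zeroMode_zhu_sum` for homogeneous `b`, then it is so
for all `b`; this covers both the product of the Zhu algebra and the elements of `O(M(1)^+)`. -/
lemma zeroMode_eq_of_forall (hN : N ≠ 0) (𝓜 : WeakModule (M1Plus N) M) {d : ℤ} {a : M1Plus N}
    (ha : VertexSubalgebra.IsHomogeneous d a) (l : ℕ) {F : M1Plus N → Module.End ℂ 𝓜.Omega}
    (hadd : ∀ b b', F (b + b') = F b + F b') (hsmul : ∀ (c : ℂ) (b), F (c • b) = c • F b)
    (hF : ∀ (d' : ℤ) (b : M1Plus N), VertexSubalgebra.IsHomogeneous d' b → ∀ u : 𝓜.Omega,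
      (F b u : M) = if l = 0 then 𝓜.act a (d - 1) (𝓜.act b (d' - 1) u) else 0) (b : M1Plus N) :
    𝓜.zeroMode hN (∑ᶠ i : ℕ, Ring.choose d i • (M1Plus N).mul a (-(l + 1 : ℤ) + i) b) = F b := by
  have hmul_add : ∀ (n : ℤ) (b b' : M1Plus N),
      (M1Plus N).mul a n (b + b') = (M1Plus N).mul a n b + (M1Plus N).mul a n b' := by
    intro n b b'
    apply VertexSubalgebra.val_injective
    simp only [VertexSubalgebra.val_mul, map_add, prod_add_right]
  have hmul_smul : ∀ (n : ℤ) (c : ℂ) (b : M1Plus N),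
      (M1Plus N).mul a n (c • b) = c • (M1Plus N).mul a n b := by
    intro n c b
    apply VertexSubalgebra.val_injective
    simp only [VertexSubalgebra.val_mul, map_smul, prod_smul_right]
  have hzero : F 0 = 0 := by
    have := hsmul 0 0
    rwa [zero_smul, zero_smul] at this
  rcases lt_or_ge d 0 with hd | hd
  · obtain rfl := eq_zero_of_isHomogeneous_neg hN hd ha
    have hmul_zero : ∀ n : ℤ, (M1Plus N).mul 0 n b = 0 := by
      intro n
      apply VertexSubalgebra.val_injective
      rw [VertexSubalgebra.val_mul, map_zero, prod_zero_left]
    simp only [hmul_zero, smul_zero, finsum_zero, map_zero]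
    refine (homogeneous_induction (p := fun b => F b = 0) hN b ?_ hzero ?_ ?_).symm
    · intro d' b hb
      ext u
      rw [hF d' b hb, act_zero_vec]
      simp
    · intro b b' h h'
      rw [hadd, h, h', add_zero]
    · intro c b h
      rw [hsmul, h, smul_zero]
  obtain ⟨d, rfl⟩ := Int.eq_ofNat_of_zero_le hd
  refine homogeneous_induction (p := fun b => 𝓜.zeroMode hN (∑ᶠ i : ℕ, Ring.choose (d : ℤ) i •
    (M1Plus N).mul a (-(l + 1 : ℤ) + i) b) = F b) hN b ?_ ?_ ?_ ?_
  · intro d' b hb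
    ext u
    rw [𝓜.zeroMode_zhu_sum hN ha hb, hF d' b hb]
  · have hmul_zero : ∀ n : ℤ, (M1Plus N).mul a n 0 = 0 := by
      intro n
      have := hmul_smul n 0 0
      rwa [zero_smul, zero_smul] at this
    simp only [hmul_zero, smul_zero, finsum_zero, map_zero, hzero]
  · intro b b' h h'
    rw [hadd, ← h, ← h', ← map_add, zhu_sum_eq, zhu_sum_eq, zhu_sum_eq, ← Finset.sum_add_distrib]
    simp only [hmul_add, smul_add]
  · intro c b h
    rw [hsmul, ← h, ← map_smul, zhu_sum_eq, zhu_sum_eq, Finset.smul_sum]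
    simp only [hmul_smul, smul_comm c]

lemma isHomogeneous_one (hN : N ≠ 0) : VertexSubalgebra.IsHomogeneous 0 (M1Plus N).one := by
  rw [isHomogeneous_iff hN (f := 1) rfl, HasWeight, Derivation.map_one_eq_zero]
  simp

/-- The standard `A(M(1)^+)`-module structure on `Ω`. -/
def zhuModule (hN : N ≠ 0) (𝓜 : WeakModule (M1Plus N) M) : ZhuModule (M1Plus N) 𝓜.Omega where
  ρ := (zhuO (M1Plus N)).liftQ (𝓜.zeroMode hN) (by
    rw [zhuO, Submodule.span_le]
    rintro _ ⟨d, a, b, ha, rfl⟩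
    have h := 𝓜.zeroMode_eq_of_forall hN ha 1 (F := fun _ => 0) (by simp) (by simp) (by simp) b
    rw [SetLike.mem_coe, LinearMap.mem_ker, ← h, zhuCirc]
    congr 2)
  map_one := by
    ext u
    change (𝓜.zeroMode hN (M1Plus N).one u : M) = u
    rw [𝓜.zeroMode_apply hN (isHomogeneous_one hN), act_one, if_pos (by norm_num)]
  map_mul d a b ha := by
    have h := 𝓜.zeroMode_eq_of_forall hN ha 0 (F := fun b => 𝓜.zeroMode hN a * 𝓜.zeroMode hN b)
      (fun b b' => by rw [map_add, mul_add]) (fun c b => by rw [map_smul, mul_smul_comm])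
      (fun d' b hb u => by
        rw [if_pos rfl, Module.End.mul_apply, 𝓜.zeroMode_apply hN ha, 𝓜.zeroMode_apply hN hb]) b
    change 𝓜.zeroMode hN (zhuMul (M1Plus N) d a b) = 𝓜.zeroMode hN a * 𝓜.zeroMode hN b
    rw [← h, zhuMul]
    congr 2

lemma zhuModule_isStandard (hN : N ≠ 0) (𝓜 : WeakModule (M1Plus N) M) :
    (𝓜.zhuModule hN).IsStandard := fun _ _ ha u => 𝓜.zeroMode_apply hN ha u

lemma mem_Omega_of_isHighestWeight (hN : N ≠ 0) {𝓜 : WeakModule (M1Plus N) M} {z : M}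
    (hz : 𝓜.IsHighestWeight z) : z ∈ 𝓜.Omega := by
  intro d a ha i hi
  have hzl : z ∈ 𝓜.level z 0 := by
    rw [level_zero]
    exact Submodule.mem_span_singleton_self z
  have := act_mem_level hN hz ha i hzl
  rwa [level_of_pos (by omega), Submodule.mem_bot] at this

lemma zhuModule_mem_span (hN : N ≠ 0) {𝓜 : WeakModule (M1Plus N) M}
    {R : ZhuModule (M1Plus N) 𝓜.Omega} (hR : R.IsStandard) {z : M}
    (hz : 𝓜.IsHighestWeight z) {w : 𝓜.Omega} (hw : (w : M) = z) (a : M1Plus N) :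
    R.ρ (zhuClass (M1Plus N) a) w ∈ Submodule.span ℂ {w} := by
  refine homogeneous_induction
    (p := fun a => R.ρ (zhuClass (M1Plus N) a) w ∈ Submodule.span ℂ {w}) hN a ?_ ?_ ?_ ?_
  · intro d a ha
    have hzl : z ∈ 𝓜.level z 0 := by
      rw [level_zero]
      exact Submodule.mem_span_singleton_self z
    have h := act_mem_level hN hz ha (d - 1) hzl
    rw [show 0 + (d - 1) + 1 - d = 0 by ring, level_zero, Submodule.mem_span_singleton] at h
    obtain ⟨c, hc⟩ := h
    refine Submodule.mem_span_singleton.2 ⟨c, Subtype.ext ?_⟩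
    rw [hR d a ha, hw, ← hc, ← hw]
    rfl
  · rw [zhuClass, map_zero, map_zero]
    exact Submodule.zero_mem _
  · intro a b ha hb
    rw [zhuClass, map_add, map_add]
    exact Submodule.add_mem _ ha hb
  · intro c a ha
    rw [zhuClass, map_smul, map_smul]
    exact Submodule.smul_mem _ c ha

/-- A highest weight vector spans an irreducible module for the Zhu algebra. -/
theorem exists_irreducible (hN : N ≠ 0) {𝓜 : WeakModule (M1Plus N) M}
    {R : ZhuModule (M1Plus N) 𝓜.Omega} (hR : R.IsStandard) {z : M} (hz0 : z ≠ 0)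
    (hz : 𝓜.IsHighestWeight z) :
    ∃ U : Submodule ℂ 𝓜.Omega, R.IsIrreducibleSubmodule U := by
  obtain ⟨w, hw⟩ : ∃ w : 𝓜.Omega, (w : M) = z := ⟨⟨z, mem_Omega_of_isHighestWeight hN hz⟩, rfl⟩
  have hw0 : w ≠ 0 := fun h => hz0 (by rw [← hw, h, ZeroMemClass.coe_zero])
  have hatom := nonzero_span_atom (K := ℂ) w hw0
  refine ⟨Submodule.span ℂ {w}, ?_, hatom.1, fun S' hS' _ => hatom.le_iff.1 hS'⟩
  intro x u hu
  obtain ⟨a, rfl⟩ := (zhuO (M1Plus N)).mkQ_surjective x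
  obtain ⟨c, rfl⟩ := Submodule.mem_span_singleton.1 hu
  rw [map_smul]
  exact Submodule.smul_mem _ c (zhuModule_mem_span hN hR hz hw a)

/-- A highest weight vector generates an ordinary module. -/
theorem isOrdinarySubmodule_iSup_level (hN : N ≠ 0) {𝓜 : WeakModule (M1Plus N) M} {z : M}
    (hz : 𝓜.IsHighestWeight z) :
    𝓜.IsOrdinarySubmodule (omegaM1Plus N) (⨆ s : ℤ, 𝓜.level z s) := by
  obtain ⟨h, hh⟩ := hz.zero false
  have hh' : 𝓜.act (omegaM1Plus N) 1 z = h • z := by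
    simpa [letter, generator, genWeight] using hh
  have hle := fun s => level_le_eigenspace (𝓜 := 𝓜) hN hh' s
  set T := 𝓜.act (omegaM1Plus N) 1 with hT
  have hdisj := Module.End.eigenspaces_iSupIndep T
  -- the eigenspaces of `L(0)` on the module are the levels
  have heig : ∀ s₀ : ℤ, (⨆ s : ℤ, 𝓜.level z s) ⊓ T.eigenspace (h - s₀) ≤ 𝓜.level z s₀ := by
    rintro s₀ y ⟨hy, hy'⟩
    have hsup : (⨆ s : ℤ, 𝓜.level z s) ≤ 𝓜.level z s₀
        ⊔ ⨆ (μ : ℂ) (_ : μ ≠ h - s₀), T.eigenspace μ := by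
      refine iSup_le fun s => ?_
      rcases eq_or_ne s s₀ with rfl | hs
      · exact le_sup_left
      · refine le_sup_of_le_right ((hle s).trans (le_iSup₂_of_le (h - s) ?_ le_rfl))
        intro h'
        exact hs (by exact_mod_cast sub_right_injective h')
    obtain ⟨a, ha, b, hb, rfl⟩ := Submodule.mem_sup.1 (hsup hy)
    have hb' : b ∈ T.eigenspace (h - s₀) := by
      have := Submodule.sub_mem _ hy' (hle s₀ ha)
      rwa [add_sub_cancel_left] at this
    have hb0 : b = 0 := by
      have := (hdisj (h - s₀)).le_bot ⟨hb', hb⟩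
      rwa [Submodule.mem_bot] at this
    rw [hb0, add_zero]
    exact ha
  have hother : ∀ μ : ℂ, (∀ s : ℤ, μ ≠ h - s) →
      (⨆ s : ℤ, 𝓜.level z s) ⊓ T.eigenspace μ = ⊥ := by
    intro μ hμ
    rw [eq_bot_iff]
    rintro y ⟨hy, hy'⟩
    refine (hdisj μ).le_bot ⟨hy', ?_⟩
    exact (iSup_le fun s => (hle s).trans (le_iSup₂_of_le (h - s) (hμ s).symm le_rfl) :
      (⨆ s : ℤ, 𝓜.level z s) ≤ _) hy
  refine ⟨?_, ?_, ?_, h.re, ?_⟩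
  · intro a n u hu
    refine homogeneous_induction (p := fun a => 𝓜.act a n u ∈ _) hN a ?_ ?_ ?_ ?_
    · intro d a ha
      induction hu using Submodule.iSup_induction' with
      | mem s u hu =>
        exact Submodule.mem_iSup_of_mem _ (act_mem_level hN hz ha n hu)
      | zero =>
        rw [map_zero]
        exact Submodule.zero_mem _
      | add u v _ _ hu hv =>
        rw [map_add]
        exact Submodule.add_mem _ hu hv
    · rw [act_zero_vec]
      exact Submodule.zero_mem _
    · intro a b ha hb
      rw [act_add_vec]
      exact Submodule.add_mem _ ha hb
    · intro c a ha
      rw [act_smul_vec]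
      exact Submodule.smul_mem _ c ha
  · refine le_antisymm (iSup_le fun _ => inf_le_left) (iSup_le fun s => ?_)
    exact le_iSup_of_le (h - s) (le_inf (le_iSup _ s) (hle s))
  · intro μ
    by_cases hμ : ∃ s : ℤ, μ = h - s
    · obtain ⟨s, rfl⟩ := hμ
      have := finiteDimensional_level (𝓜 := 𝓜) (z := z) s
      exact Submodule.finiteDimensional_of_le (heig s)
    · push Not at hμ
      rw [hother μ hμ]
      infer_instance
  · intro μ hre
    by_cases hμ : ∃ s : ℤ, μ = h - s
    · obtain ⟨s, rfl⟩ := hμ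
      have hs : 0 < s := by
        rw [Complex.sub_re, Complex.intCast_re] at hre
        exact_mod_cast (show (0 : ℝ) < s by linarith)
      rw [eq_bot_iff, ← level_of_pos (𝓜 := 𝓜) (z := z) hs]
      exact heig s
    · push Not at hμ
      exact hother μ hμ

lemma letter_false (𝓜 : WeakModule (M1Plus N) M) (s : ℤ) : 𝓜.letter (false, s) = 𝓜.vir s := by
  simp only [letter, generator, genWeight, vir]
  congr 1
  ring

lemma letter_true (𝓜 : WeakModule (M1Plus N) M) (s : ℤ) :
    𝓜.letter (true, s) = 𝓜.quarticMode s := by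
  simp only [letter, generator, genWeight, quarticMode]
  congr 1
  ring

end WeakModule

/-- The coefficients agree only if `N² (48 N² - 13 N + 2) = 0`. -/
lemma quarticCoeff_ne {N : ℤ} (hN : N ≠ 0) :
    quarticCoeff N (((2 : ℤ) : ℂ) ^ 2 * N) ≠ quarticCoeff N (((3 : ℤ) : ℂ) ^ 2 * N) := by
  have hN' : (N : ℂ) ≠ 0 := by exact_mod_cast hN
  have h1 : (8 * N - 1 : ℂ) ≠ 0 := by exact_mod_cast (by omega : 8 * N - 1 ≠ 0)
  have h2 : (8 * N - 9 : ℂ) ≠ 0 := by exact_mod_cast (by omega : 8 * N - 9 ≠ 0)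
  have h3 : (18 * N - 1 : ℂ) ≠ 0 := by exact_mod_cast (by omega : 18 * N - 1 ≠ 0)
  have h4 : (18 * N - 9 : ℂ) ≠ 0 := by exact_mod_cast (by omega : 18 * N - 9 ≠ 0)
  intro h
  rw [quarticCoeff, quarticCoeff] at h
  push_cast at h
  rw [show (2 : ℂ) * (2 ^ 2 * N) = 8 * N by ring, show (2 : ℂ) * (3 ^ 2 * N) = 18 * N by ring,
    div_eq_div_iff (mul_ne_zero h1 h2) (mul_ne_zero h3 h4)] at h
  have h5 : (N : ℂ) ^ 2 * (48 * N ^ 2 - 13 * N + 2) = 0 := by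
    linear_combination (-1 / 120) * h
  have h6 : N ^ 2 * (48 * N ^ 2 - 13 * N + 2) = 0 := by exact_mod_cast h5
  rcases mul_eq_zero.1 h6 with h7 | h7
  · exact hN (pow_eq_zero_iff two_ne_zero |>.1 h7)
  · nlinarith [sq_nonneg (N : ℤ), sq_nonneg (4 * N - 1)]

end LatticeVA

end

/-- `L` is a non-degenerate even lattice of rank one with form `B` and generator `α`, and
`𝓜` is a weak `V_L^+`-module structure on the non-zero vector space `M`. -/
theorem proposition3p10 {L : Type*} [AddCommGroup L] [Module.Free ℤ L] [Module.Finite ℤ L]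
    (hrank : Module.finrank ℤ L = 1) (B : LinearMap.BilinForm ℤ L) (hsymm : B.IsSymm)
    (hnondeg : B.Nondegenerate) (heven : ∀ x : L, Even (B x x))
    (α : L) (hα : Submodule.span ℤ {α} = ⊤)
    {M : Type*} [AddCommGroup M] [Module ℂ M] [Nontrivial M]
    (𝓜 : LatticeVA.WeakModule (LatticeVA.VLPlus (B α α)) M) :
    (∃ R : LatticeVA.ZhuModule (LatticeVA.M1Plus (B α α)) 𝓜.toM1Plus.Omega, R.IsStandard ∧
      ∃ U : Submodule ℂ 𝓜.toM1Plus.Omega, R.IsIrreducibleSubmodule U) ∧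
    (∃ W : Submodule ℂ M, W ≠ ⊥ ∧
      𝓜.toM1Plus.IsOrdinarySubmodule (LatticeVA.omegaM1Plus (B α α)) W) := by
  have hN : B α α ≠ 0 := by
    intro h
    have hL : Nontrivial L := Module.nontrivial_of_finrank_pos (R := ℤ) (by omega)
    obtain ⟨x, hx⟩ := exists_ne (0 : L)
    refine hx (hnondeg.1 x fun y => ?_)
    obtain ⟨m, rfl⟩ := Submodule.mem_span_singleton.1
      (hα ▸ Submodule.mem_top : x ∈ Submodule.span ℤ {α})
    obtain ⟨n, rfl⟩ := Submodule.mem_span_singleton.1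
      (hα ▸ Submodule.mem_top : y ∈ Submodule.span ℤ {α})
    simp [h]
  generalize B α α = N at 𝓜 hN
  -- `m = 1` is excluded, since `m² N = 2` is possible
  have he2 := LatticeVA.quarticRelations_expPlus (m := 2) hN (by norm_num)
    (by push_cast; exact_mod_cast (by omega : 2 * (2 ^ 2 * N) - 1 ≠ 0))
    (by push_cast; exact_mod_cast (by omega : 2 ^ 2 * N - 2 ≠ 0))
    (by push_cast; exact_mod_cast (by omega : 2 * (2 ^ 2 * N) - 9 ≠ 0))
  have he3 := LatticeVA.quarticRelations_expPlus (m := 3) hN (by norm_num)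
    (by push_cast; exact_mod_cast (by omega : 2 * (3 ^ 2 * N) - 1 ≠ 0))
    (by push_cast; exact_mod_cast (by omega : 3 ^ 2 * N - 2 ≠ 0))
    (by push_cast; exact_mod_cast (by omega : 2 * (3 ^ 2 * N) - 9 ≠ 0))
  obtain ⟨z, hz0, hz, h, c, hh, hc⟩ := LatticeVA.WeakModule.exists_common_eigenvector (𝓜 := 𝓜) hN
    he2 he3 (LatticeVA.quarticCoeff_ne hN)
    (fun u hu => 𝓜.exists_expPlus_act_ne_zero hN (by norm_num) hu)
    (fun u hu => 𝓜.exists_expPlus_act_ne_zero hN (by norm_num) hu)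
  have hz' : 𝓜.toM1Plus.IsHighestWeight z := by
    constructor
    · rintro ⟨g, s⟩ hs
      cases g with
      | false => rw [LatticeVA.WeakModule.letter_false]; exact hz.1 s (by simpa using hs)
      | true => rw [LatticeVA.WeakModule.letter_true]; exact hz.2 s (by simpa using hs)
    · intro g
      cases g with
      | false => exact ⟨h, by rw [LatticeVA.WeakModule.letter_false, hh]⟩
      | true => exact ⟨c, by rw [LatticeVA.WeakModule.letter_true, hc]⟩
  refine ⟨⟨_, 𝓜.toM1Plus.zhuModule_isStandard hN,
    LatticeVA.WeakModule.exists_irreducible hN (𝓜.toM1Plus.zhuModule_isStandard hN) hz0 hz'⟩,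
    _, ?_, LatticeVA.WeakModule.isOrdinarySubmodule_iSup_level hN hz'⟩
  intro hbot
  have h0 : z ∈ ⨆ s : ℤ, 𝓜.toM1Plus.level z s :=
    Submodule.mem_iSup_of_mem 0 (by
      rw [LatticeVA.WeakModule.level_zero]
      exact Submodule.mem_span_singleton_self z)
  rw [hbot] at h0
  exact hz0 h0
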